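/- Let $\mathcal V=(V,\otimes,k)$ be a commutative unital quantale that is integral ($k=\top$) and whose underlying lattice is continuous, with a basis $B\subseteq V$ that is closed under finite joins and under $\otimes$ and contains $k$. (Here $y\ll x$ means that whenever $x\le\bigvee X$ there is a finite $A\subseteq X$ with $y\le\bigvee A$; $B$ is a basis if for every $x$ the set $B\cap\{y\mid y\ll x\}$ is directed with least upper bound $x$.) Let $G$ be a collection of ground types, and $\Sigma$ a collection of operation symbols $f:\mathbb A_1,\dots,\mathbb A_n\to\mathbb A$ ($n\ge 1$) over the types $\mathbb A::=X\in G\mid \mathbb I\mid\mathbb A\otimes\mathbb A\mid\mathbb A\multimap\mathbb A$. Judgements $\Gamma\rhd v:\mathbb A$ of linear $\lambda$-calculus are generated by the usual rules for the terms $x$, $f(v_1,\dots,v_n)$, $\ast$, $v\ \mathrm{to}\ \ast.\,w$, $v\otimes w$, $\mathrm{pm}\ v\ \mathrm{to}\ x\otimes y.\,w$, $\lambda x:\mathbb A.\,v$ and $v\,w$, where the context of a compound term is a shuffle of the contexts of its immediate subterms, so that each judgement has exactly one derivation. A linear $\mathcal V\lambda$-theory $T$ over $(G,\Sigma)$ is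 a collection of axioms $\Gamma\rhd v=_q w:\mathbb A$ with $q\in B$, $\Gamma\rhd v:\mathbb A$ and $\Gamma\rhd w:\mathbb A$. Its theorems form the smallest class of such $\mathcal V$-equations that contains the axioms; contains, with label $\top$ and in both directions, the equations $$\mathrm{pm}\ v\otimes w\ \mathrm{to}\ x\otimes y.\,u=u[v/x,w/y],\qquad \mathrm{pm}\ v\ \mathrm{to}\ x\otimes y.\,u[x\otimes y/z]=u[v/z],$$ $$\ast\ \mathrm{to}\ \ast.\,v=v,\qquad v\ \mathrm{to}\ \ast.\,w[\ast/z]=w[v/z],\qquad (\lambda x:\mathbb A.\,v)\,w=v[w/x],\qquad \lambda x:\mathbb A.\,(v\,x)=v,$$ $$u[v\ \mathrm{to}\ \ast.\,w/z]=v\ \mathrm{to}\ \ast.\,u[w/z],\qquad u[\mathrm{pm}\ v\ \mathrm{to}\ x\otimes y.\,w/z]=\mathrm{pm}\ v\ \mathrm{to}\ x\otimes y.\,u[w/z];$$ and is closed under: $v=_\top v$; from $v=_q w$ and $w=_r u$ infer $v=_{q\otimes r}u$; from $v=_q w$ and $r\le q$ infer $v=_r w$; from $v=_r w$ for all $r\ll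 q$ infer $v=_q w$; from $v=_{q_i}w$ for all $i$ in a finite (possibly empty) family infer $v=_{\bigvee q_i}w$; compatibility with all term constructors, the labels of the premises being multiplied; permutation of the context; and: from $v=_q w$ and $v'=_r w'$ infer $v[v'/x]=_{q\otimes r}w[w'/x]$. A $\mathcal V$-category is a collection $X$ with a function $a:X\times X\to V$ such that $k\le a(x,x)$ and $a(x,y)\otimes a(y,z)\le a(x,z)$; it is separated if $k\le a(x,y)$ and $k\le a(y,x)$ imply $x=y$. A $\mathcal V$-functor $(X,a)\to(Y,b)$ is a map $f$ with $a(x,y)\le b(f(x),f(y))$; the tensor of $(X,a)$ and $(Y,b)$ is $X\times Y$ with $((x,y),(x',y'))\mapsto a(x,x')\otimes b(y,y')$. A $\mathcal V\text{-}\mathsf{Cat}_{\mathsf{sep}}$-enriched autonomous category is a symmetric monoidal closed category whose hom-sets are separated $\mathcal V$-categories such that composition $\mathsf C(X,Y)\otimes\mathsf C(Y,Z)\to\mathsf C(X,Z)$ and the bifunctor $\otimes$ act on homs by $\mathcal V$-functors and, for every $X$, the functors $-\otimes X$ and $X\multimap -$ act on homs by $\mathcal V$-functors and the bijections $\mathsf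 C(Y\otimes X,Z)\cong\mathsf C(Y,X\multimap Z)$ are isomorphisms of $\mathcal V$-categories. A $\mathcal V\text{-}\mathsf{Cat}_{\mathsf{sep}}$-functor is a functor that acts on homs by $\mathcal V$-functors. A model of $T$ in such a category $\mathsf C$ interprets each ground type by an object and each $f:\mathbb A_1,\dots,\mathbb A_n\to\mathbb A$ in $\Sigma$ by a morphism $[\![\mathbb A_1]\!]\otimes\dots\otimes[\![\mathbb A_n]\!]\to[\![\mathbb A]\!]$ in such a way that, for the induced standard interpretation $[\![\Gamma\rhd v:\mathbb A]\!]:[\![\Gamma]\!]\to[\![\mathbb A]\!]$ of judgements, $q\le a([\![\Gamma\rhd v:\mathbb A]\!],[\![\Gamma\rhd w:\mathbb A]\!])$ for every axiom $\Gamma\rhd v=_q w:\mathbb A$, where $a$ is the $\mathcal V$-category structure of $\mathsf C([\![\Gamma]\!],[\![\mathbb A]\!])$. The syntactic category $\mathrm{Syn}(T)$ has the types as objects. Its hom $\mathrm{Syn}(T)(\mathbb A,\mathbb B)$ is the quotient into a separated $\mathcal V$-category of the collection of terms $v$ with $x:\mathbb A\rhd v:\mathbb B$, equipped with $a(v,w)=\bigvee\{q\mid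 v=_q w\text{ is a theorem of }T\}$; the composite of $[v]:\mathbb A\to\mathbb B$ and $[w]:\mathbb B\to\mathbb C$ is $[w[v/x]]$. Its autonomous operations are given by the type constructors and the evident terms: for instance $[v]\otimes[w]$ is the class of $\mathrm{pm}\ z\ \mathrm{to}\ x\otimes y.\,v\otimes w$ (where $x$ and $y$ are the variables of $v$ and $w$), application is the class of $\mathrm{pm}\ z\ \mathrm{to}\ f\otimes x.\,f\,x$, and the right transpose of $[v]:\mathbb A\otimes\mathbb B\to\mathbb C$ is $[\lambda y:\mathbb B.\,v[x\otimes y/z]]$. \textbf{Theorem.} Let $T$ be a linear $\mathcal V\lambda$-theory. With the above operations $\mathrm{Syn}(T)$ is a $\mathcal V\text{-}\mathsf{Cat}_{\mathsf{sep}}$-enriched autonomous category. Every model of $T$ in a $\mathcal V\text{-}\mathsf{Cat}_{\mathsf{sep}}$-enriched autonomous category $\mathsf C$ induces a $\mathcal V\text{-}\mathsf{Cat}_{\mathsf{sep}}$-functor $F:\mathrm{Syn}(T)\to\mathsf C$ with $F(\mathbb A)=[\![\mathbb A]\!]$ and $F([v])=[\![x:\mathbb A\rhd v:\mathbb B]\!]$,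 and $F$ strictly preserves the autonomous structure: it preserves unit, tensor and $\multimap$ on objects and on morphisms, associators, unitors, symmetries, application and right transposes on the nose. -/

import Mathlib

open CategoryTheory MonoidalCategory

universe u₁ u₂ u₃ u₄ v₄

namespace VLambda

set_option linter.unusedSimpArgs false

/-! ### Types, signatures, contexts and raw terms -/

/-- Types of linear `λ`-calculus over a collection `G` of ground types. -/
inductive Ty (G : Type u₁) : Type u₁
  | ground (X : G) : Ty G
  | unit : Ty G
  | tensor (A B : Ty G) : Ty G
  | lolli (A B : Ty G) : Ty G

/-- A collection of sorted operation symbols `f : A₀, …, Aₙ → A`. Since every operation symbol has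
at least one argument, `pred f` is the number of arguments of `f` *minus one*. -/
structure Signature (G : Type u₁) where
  Op : Type u₂
  pred : Op → ℕ
  dom : ∀ f : Op, Fin (pred f + 1) → Ty G
  cod : Op → Ty G

/-- Typing contexts as lists of typed variables, variables being named by natural numbers.
Lists are read from right to left: the context `Γ, x : A` is `(x, A) :: Γ`, and the context
`Γ, Δ` is `Δ ++ Γ`. -/
abbrev Ctx (G : Type u₁) := List (ℕ × Ty G)

/-- Every variable occurs at most once in the context. -/
def Ctx.Distinct {G : Type u₁} (Γ : Ctx G) : Prop := (Γ.map Prod.fst).Nodup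

/-- Renaming of the variables of a context by `x ↦ x + k`. -/
def Ctx.shift {G : Type u₁} (k : ℕ) (Γ : Ctx G) : Ctx G := Γ.map fun p => (p.1 + k, p.2)

/-- Linear `λ`-terms up to renaming of bound variables. Binders are in de Bruijn style:
under a binder for one variable, that variable is `0` and the variable `n` of the outside is
`n + 1`; under the binder of `pm v to x ⊗ y. w`, the variable `y` is `0`, the variable `x` is `1`
and the variable `n` of the outside is `n + 2`. -/
inductive Tm {G : Type u₁} (S : Signature.{u₁, u₂} G) : Type (max u₁ u₂)
  | var (n : ℕ) : Tm S
  /-- `f(v₀, …, vₙ)` -/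
  | op (f : S.Op) (v : Fin (S.pred f + 1) → Tm S) : Tm S
  /-- `∗` -/
  | star : Tm S
  /-- `v to ∗. w` -/
  | toStar (v w : Tm S) : Tm S
  /-- `v ⊗ w` -/
  | ten (v w : Tm S) : Tm S
  /-- `pm v to x ⊗ y. w` -/
  | pm (v w : Tm S) : Tm S
  /-- `λ x : A. v` -/
  | lam (A : Ty G) (v : Tm S) : Tm S
  /-- `v w` -/
  | app (v w : Tm S) : Tm S

variable {G : Type u₁} {S : Signature.{u₁, u₂} G}

/-- Extension of a renaming under a binder. -/
def upRen (ρ : ℕ → ℕ) : ℕ → ℕ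
  | 0 => 0
  | n + 1 => ρ n + 1

/-- Renaming of free variables. -/
def Tm.rename : (ℕ → ℕ) → Tm S → Tm S
  | ρ, .var n => .var (ρ n)
  | ρ, .op f v => .op f fun i => (v i).rename ρ
  | _, .star => .star
  | ρ, .toStar v w => .toStar (v.rename ρ) (w.rename ρ)
  | ρ, .ten v w => .ten (v.rename ρ) (w.rename ρ)
  | ρ, .pm v w => .pm (v.rename ρ) (w.rename (upRen (upRen ρ)))
  | ρ, .lam A v => .lam A (v.rename (upRen ρ))
  | ρ, .app v w => .app (v.rename ρ) (w.rename ρ)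

/-- `v.shift k` is `v`, seen under binders for `k` further variables. -/
def Tm.shift (k : ℕ) (v : Tm S) : Tm S := v.rename (· + k)

/-- Extension of a substitution under a binder. -/
def up (σ : ℕ → Tm S) : ℕ → Tm S
  | 0 => .var 0
  | n + 1 => (σ n).shift 1

/-- Simultaneous capture-avoiding substitution of `σ n` for the free variables `n`. -/
def Tm.subst : (ℕ → Tm S) → Tm S → Tm S
  | σ, .var n => σ n
  | σ, .op f v => .op f fun i => (v i).subst σ
  | _, .star => .star
  | σ, .toStar v w => .toStar (v.subst σ) (w.subst σ)
  | σ, .ten v w => .ten (v.subst σ) (w.subst σ)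
  | σ, .pm v w => .pm (v.subst σ) (w.subst (up (up σ)))
  | σ, .lam A v => .lam A (v.subst (up σ))
  | σ, .app v w => .app (v.subst σ) (w.subst σ)

/-- `v.replace x w` is `v[w/x]` for a variable `x` that is free in `v`. -/
def Tm.replace (v : Tm S) (x : ℕ) (w : Tm S) : Tm S :=
  v.subst fun n => if n = x then w else .var n

/-- `v.replaceUnder k x w` is `v[w/x]` seen under binders for `k` further variables, which may
occur in `w`. -/
def Tm.replaceUnder (k : ℕ) (v : Tm S) (x : ℕ) (w : Tm S) : Tm S :=
  v.subst fun n => if n = x then w else .var (n + k)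

/-- `v[w/x]` for the body `v` of a binder of `x`. -/
def Tm.inst (v w : Tm S) : Tm S :=
  v.subst fun
    | 0 => w
    | n + 1 => .var n

/-- `u[v/x, w/y]` for the body `u` of a binder of `x ⊗ y`. -/
def Tm.inst₂ (u v w : Tm S) : Tm S :=
  u.subst fun
    | 0 => w
    | 1 => v
    | n + 2 => .var n

/-! ### Shuffles and typing derivations -/

/-- `Shuffle Γ Δ E` is the type of the ways in which `E` is a shuffle of `Γ` and `Δ`. If the
variables of `E` are distinct, then there is at most one. -/
inductive Shuffle {G : Type u₁} : Ctx G → Ctx G → Ctx G → Type u₁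
  | nil : Shuffle [] [] []
  | left {Γ Δ E : Ctx G} (p : ℕ × Ty G) : Shuffle Γ Δ E → Shuffle (p :: Γ) Δ (p :: E)
  | right {Γ Δ E : Ctx G} (p : ℕ × Ty G) : Shuffle Γ Δ E → Shuffle Γ (p :: Δ) (p :: E)

/-- `MultiShuffle n Γ E` is the type of the ways in which `E` is a shuffle of `Γ₀; …; Γₙ`. -/
inductive MultiShuffle {G : Type u₁} : (n : ℕ) → (Fin (n + 1) → Ctx G) → Ctx G → Type u₁
  | one (Γ : Fin 1 → Ctx G) : MultiShuffle 0 Γ (Γ 0)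
  | snoc {n : ℕ} {Γ : Fin (n + 2) → Ctx G} {E' E : Ctx G} :
      MultiShuffle n (fun i => Γ i.castSucc) E' → Shuffle E' (Γ (Fin.last (n + 1))) E →
        MultiShuffle (n + 1) Γ E

/-- Derivations of the judgement `Γ ▷ v : A`. -/
inductive Der {G : Type u₁} {S : Signature.{u₁, u₂} G} :
    Ctx G → Tm S → Ty G → Type (max u₁ u₂)
  | op {E : Ctx G} (f : S.Op) {v : Fin (S.pred f + 1) → Tm S} {Γ : Fin (S.pred f + 1) → Ctx G}
      (d : ∀ i, Der (Γ i) (v i) (S.dom f i)) (s : MultiShuffle (S.pred f) Γ E)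
      (hE : E.Distinct) : Der E (.op f v) (S.cod f)
  | var (x : ℕ) (A : Ty G) : Der [(x, A)] (.var x) A
  | star : Der [] .star .unit
  | toStar {Γ Δ E : Ctx G} {v w : Tm S} {A : Ty G} (d : Der Γ v .unit) (e : Der Δ w A)
      (s : Shuffle Γ Δ E) (hE : E.Distinct) : Der E (.toStar v w) A
  | ten {Γ Δ E : Ctx G} {v w : Tm S} {A B : Ty G} (d : Der Γ v A) (e : Der Δ w B)
      (s : Shuffle Γ Δ E) (hE : E.Distinct) : Der E (.ten v w) (.tensor A B)
  | pm {Γ Δ E : Ctx G} {v w : Tm S} {A B C : Ty G} (d : Der Γ v (.tensor A B))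
      (e : Der ((0, B) :: (1, A) :: Δ.shift 2) w C)
      (s : Shuffle Γ Δ E) (hE : E.Distinct) : Der E (.pm v w) C
  | lam {Γ : Ctx G} {v : Tm S} {A B : Ty G} (d : Der ((0, A) :: Γ.shift 1) v B) :
      Der Γ (.lam A v) (.lolli A B)
  | app {Γ Δ E : Ctx G} {v w : Tm S} {A B : Ty G} (d : Der Γ v (.lolli A B)) (e : Der Δ w A)
      (s : Shuffle Γ Δ E) (hE : E.Distinct) : Der E (.app v w) B

/-- The judgement `Γ ▷ v : A` is derivable. -/
def Typed (Γ : Ctx G) (v : Tm S) (A : Ty G) : Prop := Nonempty (Der Γ v A)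

/-! ### Typing of substitutions -/

theorem Shuffle.perm {Γ Δ E : Ctx G} (s : Shuffle Γ Δ E) : E.Perm (Γ ++ Δ) := by
  induction s with
  | nil => exact .refl _
  | left p _ ih => exact ih.cons p
  | right p _ ih => exact (ih.cons p).trans List.perm_middle.symm

theorem Shuffle.nil_left : ∀ Γ : Ctx G, Nonempty (Shuffle [] Γ Γ)
  | [] => ⟨.nil⟩
  | p :: Γ => (Shuffle.nil_left Γ).map (.right p)

theorem Shuffle.append : ∀ Γ Δ : Ctx G, Nonempty (Shuffle Γ Δ (Γ ++ Δ))
  | [], Δ => Shuffle.nil_left Δ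
  | p :: Γ, Δ => (Shuffle.append Γ Δ).map (.left p)

theorem Shuffle.exch {E E' : Ctx G} (h : E.Perm E') : ∀ {Γ Δ : Ctx G}, Shuffle Γ Δ E →
    ∃ Γ' Δ' : Ctx G, Γ.Perm Γ' ∧ Δ.Perm Δ' ∧ Nonempty (Shuffle Γ' Δ' E') := by
  induction h with
  | nil => exact fun s => ⟨_, _, .refl _, .refl _, ⟨s⟩⟩
  | cons p _ ih =>
    intro Γ Δ s
    cases s with
    | left _ s =>
      obtain ⟨Γ', Δ', h₁, h₂, ⟨t⟩⟩ := ih s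
      exact ⟨_, _, h₁.cons p, h₂, ⟨.left p t⟩⟩
    | right _ s =>
      obtain ⟨Γ', Δ', h₁, h₂, ⟨t⟩⟩ := ih s
      exact ⟨_, _, h₁, h₂.cons p, ⟨.right p t⟩⟩
  | swap p q l =>
    intro Γ Δ s
    cases s with
    | left _ s =>
      cases s with
      | left _ s => exact ⟨_, _, .swap _ _ _, .refl _, ⟨.left _ (.left _ s)⟩⟩
      | right _ s => exact ⟨_, _, .refl _, .refl _, ⟨.right _ (.left _ s)⟩⟩
    | right _ s =>
      cases s with
      | left _ s => exact ⟨_, _, .refl _, .refl _, ⟨.left _ (.right _ s)⟩⟩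
      | right _ s => exact ⟨_, _, .refl _, .swap _ _ _, ⟨.right _ (.right _ s)⟩⟩
  | trans _ _ ih₁ ih₂ =>
    intro Γ Δ s
    obtain ⟨Γ', Δ', h₁, h₂, ⟨t⟩⟩ := ih₁ s
    obtain ⟨Γ'', Δ'', h₁', h₂', ⟨t'⟩⟩ := ih₂ t
    exact ⟨_, _, h₁.trans h₁', h₂.trans h₂', ⟨t'⟩⟩

theorem Shuffle.of_perm {Γ Δ E : Ctx G} (h : E.Perm (Γ ++ Δ)) :
    ∃ Γ' Δ' : Ctx G, Γ.Perm Γ' ∧ Δ.Perm Δ' ∧ Nonempty (Shuffle Γ' Δ' E) :=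
  (Shuffle.append Γ Δ).elim fun s => Shuffle.exch h.symm s

theorem Ctx.Distinct.perm {Γ Δ : Ctx G} (h : Γ.Distinct) (p : Γ.Perm Δ) : Δ.Distinct :=
  (p.map Prod.fst).nodup_iff.1 h

theorem Shuffle.distinct {Γ Δ E : Ctx G} (s : Shuffle Γ Δ E) (h : E.Distinct) :
    Γ.Distinct ∧ Δ.Distinct := by
  have := h.perm s.perm
  unfold Ctx.Distinct at this ⊢
  rw [List.map_append] at this
  exact ⟨this.of_append_left, this.of_append_right⟩

/-- The context `Γ₀, …, Γₙ` up to permutation. -/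
def flat : (n : ℕ) → (Fin (n + 1) → Ctx G) → Ctx G
  | 0, Γ => Γ 0
  | n + 1, Γ => flat n (fun i => Γ i.castSucc) ++ Γ (Fin.last (n + 1))

theorem MultiShuffle.perm {n : ℕ} {Γ : Fin (n + 1) → Ctx G} {E : Ctx G}
    (s : MultiShuffle n Γ E) : E.Perm (flat n Γ) := by
  induction s with
  | one Γ => exact .refl _
  | snoc _ s ih => exact s.perm.trans (ih.append_right _)

theorem MultiShuffle.of_perm : ∀ {n : ℕ} {Γ : Fin (n + 1) → Ctx G} {E : Ctx G},
    E.Perm (flat n Γ) → ∃ Γ' : Fin (n + 1) → Ctx G,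
      (∀ i, (Γ i).Perm (Γ' i)) ∧ Nonempty (MultiShuffle n Γ' E)
  | 0, Γ, E, h => ⟨fun _ => E, fun i => by
      obtain rfl := Fin.fin_one_eq_zero i
      exact h.symm, ⟨.one fun _ => E⟩⟩
  | n + 1, Γ, E, h => by
      obtain ⟨F, Δ, h₁, h₂, ⟨s⟩⟩ := Shuffle.of_perm h
      obtain ⟨Γ', h₃, ⟨t⟩⟩ := MultiShuffle.of_perm h₁.symm
      refine ⟨Fin.snoc (α := fun _ => Ctx G) Γ' Δ, fun i => ?_, ⟨.snoc (E' := F) ?_ ?_⟩⟩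
      · refine Fin.lastCases ?_ (fun j => ?_) i
        · rw [Fin.snoc_last]; exact h₂
        · rw [Fin.snoc_castSucc]; exact h₃ j
      · simpa only [Fin.snoc_castSucc] using t
      · simpa only [Fin.snoc_last] using s

theorem flatMap_flat (K : ℕ × Ty G → Ctx G) : ∀ (n : ℕ) (Γ : Fin (n + 1) → Ctx G),
    (flat n Γ).flatMap K = flat n fun i => (Γ i).flatMap K
  | 0, _ => rfl
  | n + 1, Γ => by
      simp only [flat, List.flatMap_append, flatMap_flat K n]

theorem map_flat (K : ℕ × Ty G → ℕ × Ty G) : ∀ (n : ℕ) (Γ : Fin (n + 1) → Ctx G),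
    (flat n Γ).map K = flat n fun i => (Γ i).map K
  | 0, _ => rfl
  | n + 1, Γ => by
      simp only [flat, List.map_append, map_flat K n]

theorem mem_flat : ∀ {n : ℕ} {Γ : Fin (n + 1) → Ctx G} (i : Fin (n + 1)) {p : ℕ × Ty G},
    p ∈ Γ i → p ∈ flat n Γ
  | 0, Γ, i, p, h => by
      obtain rfl := Fin.fin_one_eq_zero i
      exact h
  | n + 1, Γ, i, p, h => by
      rw [flat, List.mem_append]
      revert h
      refine Fin.lastCases (fun h => .inr h) (fun j h => .inl (mem_flat j h)) i

theorem shift_distinct {Γ : Ctx G} (k : ℕ) (h : Γ.Distinct) : (Γ.shift k).Distinct := by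
  unfold Ctx.Distinct Ctx.shift at *
  rw [List.map_map, show Prod.fst ∘ (fun p : ℕ × Ty G => (p.1 + k, p.2)) = (· + k) ∘ Prod.fst from rfl,
    ← List.map_map]
  exact h.map (add_left_injective k)

theorem cons_distinct {Γ : Ctx G} {A : Ty G} (h : Γ.Distinct) :
    Ctx.Distinct ((0, A) :: Γ.shift 1) := by
  have := shift_distinct 1 h
  unfold Ctx.Distinct at this ⊢
  rw [List.map_cons, List.nodup_cons]
  refine ⟨?_, this⟩
  simp [Ctx.shift]

theorem cons₂_distinct {Γ : Ctx G} {A B : Ty G} (h : Γ.Distinct) :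
    Ctx.Distinct ((0, B) :: (1, A) :: Γ.shift 2) := by
  have := shift_distinct 2 h
  unfold Ctx.Distinct at this ⊢
  rw [List.map_cons, List.nodup_cons, List.map_cons, List.nodup_cons]
  refine ⟨?_, ?_, this⟩ <;> simp [Ctx.shift]

theorem distinct_of_cons {Γ : Ctx G} {A : Ty G} (h : Ctx.Distinct ((0, A) :: Γ.shift 1)) :
    Γ.Distinct := by
  unfold Ctx.Distinct Ctx.shift at *
  rw [List.map_cons, List.nodup_cons, List.map_map,
    show Prod.fst ∘ (fun p : ℕ × Ty G => (p.1 + 1, p.2)) = (· + 1) ∘ Prod.fst from rfl,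
    ← List.map_map] at h
  exact h.2.of_map

theorem Der.distinct {Γ : Ctx G} {v : Tm S} {A : Ty G} (d : Der Γ v A) : Γ.Distinct := by
  induction d with
  | op _ _ _ hE => exact hE
  | var => simp [Ctx.Distinct]
  | star => simp [Ctx.Distinct]
  | toStar _ _ _ hE => exact hE
  | ten _ _ _ hE => exact hE
  | pm _ _ _ hE => exact hE
  | lam _ ih => exact distinct_of_cons ih
  | app _ _ _ hE => exact hE

/-- The exchange rule is admissible. -/
theorem Typed.exch {Γ Γ' : Ctx G} {v : Tm S} {A : Ty G} (h : Typed Γ v A) (p : Γ.Perm Γ') :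
    Typed Γ' v A := by
  obtain ⟨d⟩ := h
  induction d generalizing Γ' with
  | op f d s hE ih =>
    obtain ⟨Γs, h₁, ⟨t⟩⟩ := MultiShuffle.of_perm (p.symm.trans s.perm)
    exact ⟨.op f (fun i => (ih i (h₁ i)).some) t (hE.perm p)⟩
  | var x A => obtain rfl := (List.singleton_perm.1 p).symm; exact ⟨.var x A⟩
  | star => obtain rfl := List.nil_perm.1 p; exact ⟨.star⟩
  | toStar d e s hE ihd ihe =>
    obtain ⟨Γ₁, Δ₁, h₁, h₂, ⟨t⟩⟩ := Shuffle.exch p s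
    obtain ⟨d'⟩ := ihd h₁
    obtain ⟨e'⟩ := ihe h₂
    exact ⟨.toStar d' e' t (hE.perm p)⟩
  | ten d e s hE ihd ihe =>
    obtain ⟨Γ₁, Δ₁, h₁, h₂, ⟨t⟩⟩ := Shuffle.exch p s
    obtain ⟨d'⟩ := ihd h₁
    obtain ⟨e'⟩ := ihe h₂
    exact ⟨.ten d' e' t (hE.perm p)⟩
  | pm d e s hE ihd ihe =>
    obtain ⟨Γ₁, Δ₁, h₁, h₂, ⟨t⟩⟩ := Shuffle.exch p s
    obtain ⟨d'⟩ := ihd h₁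
    obtain ⟨e'⟩ := ihe (((h₂.map _).cons _).cons _)
    exact ⟨.pm d' e' t (hE.perm p)⟩
  | lam d ih =>
    obtain ⟨d'⟩ := ih ((p.map _).cons _)
    exact ⟨.lam d'⟩
  | app d e s hE ihd ihe =>
    obtain ⟨Γ₁, Δ₁, h₁, h₂, ⟨t⟩⟩ := Shuffle.exch p s
    obtain ⟨d'⟩ := ihd h₁
    obtain ⟨e'⟩ := ihe h₂
    exact ⟨.app d' e' t (hE.perm p)⟩

theorem Shuffle.map {Γ Δ E : Ctx G} (ρ : ℕ × Ty G → ℕ × Ty G) (s : Shuffle Γ Δ E) :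
    Nonempty (Shuffle (Γ.map ρ) (Δ.map ρ) (E.map ρ)) := by
  induction s with
  | nil => exact ⟨.nil⟩
  | left p _ ih => exact ih.map (.left _)
  | right p _ ih => exact ih.map (.right _)

theorem MultiShuffle.map {n : ℕ} {Γ : Fin (n + 1) → Ctx G} {E : Ctx G}
    (ρ : ℕ × Ty G → ℕ × Ty G) (s : MultiShuffle n Γ E) :
    Nonempty (MultiShuffle n (fun i => (Γ i).map ρ) (E.map ρ)) := by
  induction s with
  | one Γ => exact ⟨.one fun i => (Γ i).map ρ⟩
  | snoc _ s ih => exact ih.elim fun t => (s.map ρ).map fun s => .snoc t s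

theorem upRen_injective {ρ : ℕ → ℕ} (h : ρ.Injective) : (upRen ρ).Injective := by
  rintro (_ | a) (_ | b) hab
  · rfl
  · simp [upRen] at hab
  · simp [upRen] at hab
  · simp only [upRen, add_left_inj] at hab
    rw [h hab]

theorem map_distinct {Γ : Ctx G} {ρ : ℕ → ℕ} (h : ρ.Injective) (hΓ : Γ.Distinct) :
    Ctx.Distinct (Γ.map fun p => (ρ p.1, p.2)) := by
  unfold Ctx.Distinct at *
  rw [List.map_map, show Prod.fst ∘ (fun p : ℕ × Ty G => (ρ p.1, p.2)) = ρ ∘ Prod.fst from rfl,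
    ← List.map_map]
  exact hΓ.map h

/-- Variables can be renamed injectively. -/
theorem Typed.rename {Γ : Ctx G} {v : Tm S} {A : Ty G} (h : Typed Γ v A) {ρ : ℕ → ℕ}
    (hρ : ρ.Injective) : Typed (Γ.map fun p => (ρ p.1, p.2)) (v.rename ρ) A := by
  obtain ⟨d⟩ := h
  induction d generalizing ρ with
  | op f d s hE ih =>
    obtain ⟨t⟩ := s.map fun p => (ρ p.1, p.2)
    exact ⟨.op f (fun i => (ih i hρ).some) t (map_distinct hρ hE)⟩
  | var x A => exact ⟨.var _ _⟩
  | star => exact ⟨.star⟩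
  | toStar d e s hE ihd ihe =>
    obtain ⟨t⟩ := s.map fun p => (ρ p.1, p.2)
    exact ⟨.toStar (ihd hρ).some (ihe hρ).some t (map_distinct hρ hE)⟩
  | ten d e s hE ihd ihe =>
    obtain ⟨t⟩ := s.map fun p => (ρ p.1, p.2)
    exact ⟨.ten (ihd hρ).some (ihe hρ).some t (map_distinct hρ hE)⟩
  | pm d e s hE ihd ihe =>
    obtain ⟨t⟩ := s.map fun p => (ρ p.1, p.2)
    refine ⟨.pm (ihd hρ).some ?_ t (map_distinct hρ hE)⟩
    have := ihe (upRen_injective (upRen_injective hρ))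
    simp only [Ctx.shift, List.map_cons, List.map_map, Function.comp_def, upRen] at this ⊢
    exact this.some
  | lam d ih =>
    refine ⟨.lam ?_⟩
    have := ih (upRen_injective hρ)
    simp only [Ctx.shift, List.map_cons, List.map_map, Function.comp_def, upRen] at this ⊢
    exact this.some
  | app d e s hE ihd ihe =>
    obtain ⟨t⟩ := s.map fun p => (ρ p.1, p.2)
    exact ⟨.app (ihd hρ).some (ihe hρ).some t (map_distinct hρ hE)⟩

theorem Typed.shift {Γ : Ctx G} {v : Tm S} {A : Ty G} (h : Typed Γ v A) (k : ℕ) :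
    Typed (Γ.shift k) (v.shift k) A :=
  h.rename (add_left_injective k)

/-- The contexts `K` of the terms of a substitution, extended under a binder. -/
def upCtx (A : Ty G) (K : ℕ → Ctx G) : ℕ → Ctx G
  | 0 => [(0, A)]
  | n + 1 => (K n).shift 1

theorem flatMap_upCtx (A : Ty G) (K : ℕ → Ctx G) (Γ : Ctx G) :
    (Γ.shift 1).flatMap (fun p => upCtx A K p.1) =
      Ctx.shift 1 (Γ.flatMap fun p => K p.1) := by
  simp only [Ctx.shift, List.flatMap_map, List.map_flatMap, upCtx]

theorem up_typed {Γ : Ctx G} {A : Ty G} {σ : ℕ → Tm S} {K : ℕ → Ctx G}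
    (hσ : ∀ p ∈ Γ, Typed (K p.1) (σ p.1) p.2) :
    ∀ p ∈ ((0, A) :: Γ.shift 1 : Ctx G), Typed (upCtx A K p.1) (up σ p.1) p.2 := by
  intro p hp
  rcases List.mem_cons.1 hp with rfl | hp
  · exact ⟨.var _ _⟩
  · obtain ⟨q, hq, rfl⟩ := List.mem_map.1 hp
    exact (hσ q hq).shift 1

theorem shift_shift (Γ : Ctx G) : (Γ.shift 1).shift 1 = Γ.shift 2 := by
  simp [Ctx.shift, List.map_map, Function.comp_def, add_assoc]

/-- The substitution rule, for simultaneous substitutions, is admissible. -/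
theorem Typed.subst {Γ : Ctx G} {v : Tm S} {A : Ty G} (h : Typed Γ v A) {σ : ℕ → Tm S}
    {K : ℕ → Ctx G} (hσ : ∀ p ∈ Γ, Typed (K p.1) (σ p.1) p.2) {E : Ctx G} (hE : E.Distinct)
    (p : E.Perm (Γ.flatMap fun p => K p.1)) : Typed E (v.subst σ) A := by
  obtain ⟨d⟩ := h
  induction d generalizing σ K E with
  | op f d s _ ih =>
    have h₁ := p.trans (s.perm.flatMap_right _)
    rw [flatMap_flat] at h₁
    obtain ⟨Γs, h₂, ⟨t⟩⟩ := MultiShuffle.of_perm h₁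
    have hd : ∀ i, (Γs i).Distinct := by
      clear ih h₂ h₁ p
      intro i
      have h := hE.perm t.perm
      have : ∀ {n : ℕ} {Γ : Fin (n + 1) → Ctx G} (i : Fin (n + 1)),
          (flat n Γ).Distinct → (Γ i).Distinct := by
        intro n
        induction n with
        | zero => intro Γ i h; obtain rfl := Fin.fin_one_eq_zero i; exact h
        | succ n ih =>
          intro Γ i h
          unfold flat Ctx.Distinct at h
          rw [List.map_append] at h
          refine Fin.lastCases h.of_append_right (fun j => ?_) i
          exact ih (Γ := fun i => Γ i.castSucc) j h.of_append_left
      exact this i h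
    exact ⟨.op f (fun i => (ih i (fun q hq => hσ q (s.perm.mem_iff.2 (mem_flat i hq))) (hd i)
      (h₂ i).symm).some) t hE⟩
  | var x A =>
    rw [List.flatMap_singleton] at p
    exact (hσ (x, A) (List.mem_singleton.2 rfl)).exch p.symm
  | star =>
    obtain rfl := List.perm_nil.1 p
    exact ⟨.star⟩
  | toStar d e s _ ihd ihe =>
    have h₁ := p.trans (s.perm.flatMap_right _)
    rw [List.flatMap_append] at h₁
    obtain ⟨Γ', Δ', h₂, h₃, ⟨t⟩⟩ := Shuffle.of_perm h₁
    obtain ⟨d'⟩ := ihd (fun q hq => hσ q (s.perm.mem_iff.2 (List.mem_append_left _ hq)))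
      (t.distinct hE).1 h₂.symm
    obtain ⟨e'⟩ := ihe (fun q hq => hσ q (s.perm.mem_iff.2 (List.mem_append_right _ hq)))
      (t.distinct hE).2 h₃.symm
    exact ⟨.toStar d' e' t hE⟩
  | ten d e s _ ihd ihe =>
    have h₁ := p.trans (s.perm.flatMap_right _)
    rw [List.flatMap_append] at h₁
    obtain ⟨Γ', Δ', h₂, h₃, ⟨t⟩⟩ := Shuffle.of_perm h₁
    obtain ⟨d'⟩ := ihd (fun q hq => hσ q (s.perm.mem_iff.2 (List.mem_append_left _ hq)))
      (t.distinct hE).1 h₂.symm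
    obtain ⟨e'⟩ := ihe (fun q hq => hσ q (s.perm.mem_iff.2 (List.mem_append_right _ hq)))
      (t.distinct hE).2 h₃.symm
    exact ⟨.ten d' e' t hE⟩
  | app d e s _ ihd ihe =>
    have h₁ := p.trans (s.perm.flatMap_right _)
    rw [List.flatMap_append] at h₁
    obtain ⟨Γ', Δ', h₂, h₃, ⟨t⟩⟩ := Shuffle.of_perm h₁
    obtain ⟨d'⟩ := ihd (fun q hq => hσ q (s.perm.mem_iff.2 (List.mem_append_left _ hq)))
      (t.distinct hE).1 h₂.symm
    obtain ⟨e'⟩ := ihe (fun q hq => hσ q (s.perm.mem_iff.2 (List.mem_append_right _ hq)))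
      (t.distinct hE).2 h₃.symm
    exact ⟨.app d' e' t hE⟩
  | @pm Γ Δ E₀ v w A B C d e s _ ihd ihe =>
    have h₁ := p.trans (s.perm.flatMap_right _)
    rw [List.flatMap_append] at h₁
    obtain ⟨Γ', Δ', h₂, h₃, ⟨t⟩⟩ := Shuffle.of_perm h₁
    obtain ⟨d'⟩ := ihd (fun q hq => hσ q (s.perm.mem_iff.2 (List.mem_append_left _ hq)))
      (t.distinct hE).1 h₂.symm
    have hΔ : ∀ q ∈ Δ, Typed (K q.1) (σ q.1) q.2 :=
      fun q hq => hσ q (s.perm.mem_iff.2 (List.mem_append_right _ hq))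
    have h₄ := up_typed (A := B) (up_typed (A := A) hΔ)
    have h₅ : (0, B) :: Ctx.shift 1 ((0, A) :: Ctx.shift 1 Δ) =
        (0, B) :: (1, A) :: Δ.shift 2 := by
      rw [← shift_shift]; rfl
    rw [h₅] at h₄
    obtain ⟨e'⟩ := ihe h₄ (E := (0, B) :: (1, A) :: Δ'.shift 2)
      (cons₂_distinct (t.distinct hE).2) (by
        rw [← h₅, List.flatMap_cons, flatMap_upCtx, List.flatMap_cons, flatMap_upCtx]
        refine List.Perm.cons _ (List.Perm.cons _ ?_)
        change List.Perm _ (Ctx.shift 1 (Ctx.shift 1 _))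
        rw [shift_shift]
        exact h₃.symm.map _)
    exact ⟨.pm d' e' t hE⟩
  | @lam Γ v A B d ih =>
    obtain ⟨d'⟩ := ih (up_typed (A := A) hσ) (E := (0, A) :: E.shift 1) (cons_distinct hE) (by
        rw [List.flatMap_cons, flatMap_upCtx]
        exact (p.map _).cons _)
    exact ⟨.lam d'⟩

/-! ### Quantales, `V`-categories and enrichment -/

section Quantale

variable {V : Type u₃}

/-- The way-below relation `y ≪ x` of a complete lattice. -/
def WayBelow [CompleteLattice V] (y x : V) : Prop :=
  ∀ X : Set V, x ≤ sSup X → ∃ F : Finset V, (F : Set V) ⊆ X ∧ y ≤ sSup (F : Set V)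

/-- The complete lattice `V` is continuous. -/
def IsContinuousLattice (V : Type u₃) [CompleteLattice V] : Prop :=
  ∀ x : V, x = sSup {y | WayBelow y x}

/-- `B` is a basis of the complete lattice `V`. -/
def IsLatticeBasis [CompleteLattice V] (B : Set V) : Prop :=
  ∀ x : V, (B ∩ {y | WayBelow y x}).Nonempty ∧
    DirectedOn (· ≤ ·) (B ∩ {y | WayBelow y x}) ∧ IsLUB (B ∩ {y | WayBelow y x}) x

theorem IsLatticeBasis.isContinuousLattice [CompleteLattice V] {B : Set V}
    (hB : IsLatticeBasis B) : IsContinuousLattice V := fun x =>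
  le_antisymm ((hB x).2.2.2 fun _ hy => le_sSup hy.2) (sSup_le fun y hy => by
    obtain ⟨F, hF, h⟩ := hy {x} (by simp)
    exact h.trans (sSup_le fun z hz => (hF hz).le))

/-- A basis of the underlying lattice of a commutative unital quantale that is closed under finite
joins and the multiplication, and contains the unit. -/
structure IsQuantaleBasis [CommMonoid V] [CompleteLattice V] (B : Set V) : Prop where
  basis : IsLatticeBasis B
  bot_mem : ⊥ ∈ B
  sup_mem : ∀ {q r : V}, q ∈ B → r ∈ B → q ⊔ r ∈ B
  mul_mem : ∀ {q r : V}, q ∈ B → r ∈ B → q * r ∈ B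
  one_mem : 1 ∈ B

/-- The structure of a `V`-category on `X`. -/
structure VCategory (V : Type u₃) [CommMonoid V] [CompleteLattice V] (X : Type*) where
  dist : X → X → V
  one_le_dist : ∀ x, 1 ≤ dist x x
  dist_mul_dist_le : ∀ x y z, dist x y * dist y z ≤ dist x z

variable [CommMonoid V] [CompleteLattice V]

/-- `f` is a `V`-functor. -/
def IsVFunctor {X Y : Type*} (a : VCategory V X) (b : VCategory V Y) (f : X → Y) : Prop :=
  ∀ x y, a.dist x y ≤ b.dist (f x) (f y)

namespace VCategory

variable {X Y Z : Type*}

/-- The `V`-category is separated, i.e. its natural order is antisymmetric. -/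
def IsSeparated (a : VCategory V X) : Prop :=
  ∀ x y, 1 ≤ a.dist x y → 1 ≤ a.dist y x → x = y

variable [IsQuantale V]

/-- The tensor product of `V`-categories. -/
def tensor (a : VCategory V X) (b : VCategory V Y) : VCategory V (X × Y) where
  dist p q := a.dist p.1 q.1 * b.dist p.2 q.2
  one_le_dist p := one_le_mul (a.one_le_dist _) (b.one_le_dist _)
  dist_mul_dist_le p q r := by
    rw [mul_mul_mul_comm]
    exact mul_le_mul' (a.dist_mul_dist_le _ _ _) (b.dist_mul_dist_le _ _ _)

/-- The equivalence relation `x ≤ y` and `y ≤ x` of the natural order. -/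
def setoid (a : VCategory V X) : Setoid X where
  r x y := 1 ≤ a.dist x y ∧ 1 ≤ a.dist y x
  iseqv :=
    { refl := fun x => ⟨a.one_le_dist x, a.one_le_dist x⟩
      symm := fun h => ⟨h.2, h.1⟩
      trans := fun h h' => ⟨(one_le_mul h.1 h'.1).trans (a.dist_mul_dist_le _ _ _),
        (one_le_mul h'.2 h.2).trans (a.dist_mul_dist_le _ _ _)⟩ }

theorem dist_le_of_rel (a : VCategory V X) {x x' y y' : X} (hx : a.setoid.r x x')
    (hy : a.setoid.r y y') : a.dist x y ≤ a.dist x' y' :=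
  calc a.dist x y = 1 * a.dist x y * 1 := by simp
    _ ≤ a.dist x' x * a.dist x y * a.dist y y' :=
      mul_le_mul' (mul_le_mul' hx.2 le_rfl) hy.1
    _ ≤ a.dist x' y * a.dist y y' := mul_le_mul' (a.dist_mul_dist_le _ _ _) le_rfl
    _ ≤ a.dist x' y' := a.dist_mul_dist_le _ _ _

/-- The quotient of a `V`-category into a separated `V`-category. -/
def separation (a : VCategory V X) : VCategory V (Quotient a.setoid) where
  dist := Quotient.lift₂ a.dist fun _ _ _ _ hx hy => le_antisymm (a.dist_le_of_rel hx hy)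
    (a.dist_le_of_rel (a.setoid.symm' hx) (a.setoid.symm' hy))
  one_le_dist := by rintro ⟨x⟩; exact a.one_le_dist x
  dist_mul_dist_le := by rintro ⟨x⟩ ⟨y⟩ ⟨z⟩; exact a.dist_mul_dist_le x y z

theorem separation_isSeparated (a : VCategory V X) : a.separation.IsSeparated := by
  rintro ⟨x⟩ ⟨y⟩ h h'
  exact Quotient.sound ⟨h, h'⟩

/-- A `V`-functor induces a map between the separated quotients. -/
def sepMap {a : VCategory V X} {b : VCategory V Y} (f : X → Y) (hf : IsVFunctor a b f) :
    Quotient a.setoid → Quotient b.setoid :=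
  Quotient.map f fun _ _ h => ⟨h.1.trans (hf _ _), h.2.trans (hf _ _)⟩

/-- A `V`-functor in two variables induces a map between the separated quotients. -/
def sepMap₂ {a : VCategory V X} {b : VCategory V Y} {c : VCategory V Z} (f : X → Y → Z)
    (hf : IsVFunctor (a.tensor b) c fun p => f p.1 p.2) :
    Quotient a.setoid → Quotient b.setoid → Quotient c.setoid :=
  Quotient.map₂ f fun x x' hx y y' hy =>
    ⟨(one_le_mul hx.1 hy.1).trans (hf (x, y) (x', y')),
      (one_le_mul hx.2 hy.2).trans (hf (x', y') (x, y))⟩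

end VCategory

end Quantale

section Enriched

variable (V : Type u₃) [CommMonoid V] [CompleteLattice V] [IsQuantale V]

/-- The structure of a category enriched over separated `V`-categories. -/
class VCatSepCategory (C : Type u₄) [Category.{v₄} C] where
  hom : ∀ X Y : C, VCategory V (X ⟶ Y)
  isSeparated : ∀ X Y : C, (hom X Y).IsSeparated
  comp : ∀ X Y Z : C, IsVFunctor ((hom X Y).tensor (hom Y Z)) (hom X Z) fun p => p.1 ≫ p.2

/-- The functor `F` is a `V-Cat`-functor. -/
def IsVCatFunctor {C : Type*} [Category* C] [VCatSepCategory V C] {D : Type*} [Category* D]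
    [VCatSepCategory V D] (F : C ⥤ D) : Prop :=
  ∀ X Y : C, IsVFunctor (VCatSepCategory.hom (V := V) X Y)
    (VCatSepCategory.hom (V := V) (F.obj X) (F.obj Y)) fun f => F.map f

/-- The adjunction is a `V-Cat`-adjunction. -/
structure IsVCatAdjunction {C : Type*} [Category* C] [VCatSepCategory V C] {D : Type*}
    [Category* D] [VCatSepCategory V D] {L : C ⥤ D} {R : D ⥤ C} (adj : L ⊣ R) : Prop where
  left : IsVCatFunctor V L
  right : IsVCatFunctor V R
  homEquiv : ∀ X Y, IsVFunctor (VCatSepCategory.hom (V := V) (L.obj X) Y)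
    (VCatSepCategory.hom (V := V) X (R.obj Y)) (adj.homEquiv X Y)
  homEquiv_symm : ∀ X Y, IsVFunctor (VCatSepCategory.hom (V := V) X (R.obj Y))
    (VCatSepCategory.hom (V := V) (L.obj X) Y) (adj.homEquiv X Y).symm

/-- The adjunction `(- ⊗ X) ⊣ (X ⊸ -)` of an autonomous (symmetric monoidal closed) category. -/
def lolliAdjunction {C : Type u₄} [Category.{v₄} C] [MonoidalCategory C] [SymmetricCategory C]
    [MonoidalClosed C] (X : C) : tensorRight X ⊣ ihom X :=
  (ihom.adjunction X).ofNatIsoLeft (BraidedCategory.tensorLeftIsoTensorRight X)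

/-- The autonomous category `C` is enriched over separated `V`-categories as an autonomous
category. -/
class VCatSepAutonomous (C : Type u₄) [Category.{v₄} C] [MonoidalCategory C]
    [SymmetricCategory C] [MonoidalClosed C] [VCatSepCategory V C] : Prop where
  tensor : ∀ X X' Y Y' : C, IsVFunctor
    ((VCatSepCategory.hom (V := V) X Y).tensor (VCatSepCategory.hom (V := V) X' Y'))
    (VCatSepCategory.hom (V := V) (X ⊗ X') (Y ⊗ Y')) fun p => p.1 ⊗ₘ p.2
  adjunction : ∀ X : C, IsVCatAdjunction V (lolliAdjunction X)

end Enriched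

section Types

variable {C : Type u₄} [Category.{v₄} C] [MonoidalCategory C] [MonoidalClosed C]

/-- The interpretation of types. -/
def Ty.interp (I : G → C) : Ty G → C
  | .ground X => I X
  | .unit => 𝟙_ C
  | .tensor A B => A.interp I ⊗ B.interp I
  | .lolli A B => (ihom (A.interp I)).obj (B.interp I)

/-- The interpretation of contexts. -/
def Ctx.interp (I : G → C) : Ctx G → C
  | [] => 𝟙_ C
  | [p] => p.2.interp I
  | p :: q :: Γ => Ctx.interp I (q :: Γ) ⊗ p.2.interp I

/-- The isomorphism `⟦Γ⟧ ⊗ ⟦A⟧ ≅ ⟦Γ, x : A⟧`. -/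
def Ctx.joinIso (I : G → C) (p : ℕ × Ty G) :
    (Γ : Ctx G) → (Ctx.interp I Γ ⊗ p.2.interp I ≅ Ctx.interp I (p :: Γ))
  | [] => λ_ _
  | _ :: _ => Iso.refl _

theorem Ctx.interp_shift (I : G → C) (k : ℕ) :
    ∀ Γ : Ctx G, Ctx.interp I Γ = Ctx.interp I (Γ.shift k)
  | [] => rfl
  | [_] => rfl
  | p :: q :: Γ => by
      have h := Ctx.interp_shift I k (q :: Γ)
      change _ ⊗ _ = Ctx.interp I (Ctx.shift k (q :: Γ)) ⊗ _
      rw [← h]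

end Types

section Autonomous

variable {C : Type u₄} [Category.{v₄} C] [MonoidalCategory C] [SymmetricCategory C]
  [MonoidalClosed C]

/-- The application `(X ⊸ Y) ⊗ X ⟶ Y`. -/
def appHom (X Y : C) : (ihom X).obj Y ⊗ X ⟶ Y := (lolliAdjunction X).counit.app Y

/-- The right transpose of `f : X ⊗ Y ⟶ Z`. -/
def curryHom {X Y Z : C} (f : X ⊗ Y ⟶ Z) : X ⟶ (ihom Y).obj Z :=
  (lolliAdjunction Y).homEquiv X Z f

/-- The functor `F` strictly preserves the autonomous structure. -/
structure StrictlyPreservesAutonomous {D : Type*} [Category* D] [MonoidalCategory D]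
    [SymmetricCategory D] [MonoidalClosed D] (F : D ⥤ C) : Prop where
  unit : F.obj (𝟙_ D) = 𝟙_ C
  tensorObj : ∀ X Y : D, F.obj (X ⊗ Y) = F.obj X ⊗ F.obj Y
  lolli : ∀ X Y : D, F.obj ((ihom X).obj Y) = (ihom (F.obj X)).obj (F.obj Y)
  tensorHom : ∀ {X X' Y Y' : D} (f : X ⟶ Y) (g : X' ⟶ Y'),
    F.map (f ⊗ₘ g) ≍ F.map f ⊗ₘ F.map g
  associator : ∀ X Y Z : D, F.map (α_ X Y Z).hom ≍ (α_ (F.obj X) (F.obj Y) (F.obj Z)).hom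
  leftUnitor : ∀ X : D, F.map (λ_ X).hom ≍ (λ_ (F.obj X)).hom
  rightUnitor : ∀ X : D, F.map (ρ_ X).hom ≍ (ρ_ (F.obj X)).hom
  braiding : ∀ X Y : D, F.map (β_ X Y).hom ≍ (β_ (F.obj X) (F.obj Y)).hom
  app : ∀ X Y : D, F.map (appHom X Y) ≍ appHom (F.obj X) (F.obj Y)
  curry : ∀ {X Y Z : D} (f : X ⊗ Y ⟶ Z) (g : F.obj X ⊗ F.obj Y ⟶ F.obj Z),
    F.map f ≍ g → F.map (curryHom f) ≍ curryHom g
  lolliMap : ∀ (X : D) {Y Y' : D} (f : Y ⟶ Y'),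
    F.map ((ihom X).map f) ≍ (ihom (F.obj X)).map (F.map f)

/-! ### Interpretation in an autonomous category -/

/-- The object `X₀ ⊗ … ⊗ Xₙ`, bracketed to the left. -/
def famTensor : (n : ℕ) → (Fin (n + 1) → C) → C
  | 0, X => X 0
  | n + 1, X => famTensor n (fun i => X i.castSucc) ⊗ X (Fin.last (n + 1))

/-- The morphism `m₀ ⊗ … ⊗ mₙ`. -/
def famTensorMap : (n : ℕ) → {X Y : Fin (n + 1) → C} → (∀ i, X i ⟶ Y i) →
    (famTensor n X ⟶ famTensor n Y)
  | 0, _, _, m => m 0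
  | n + 1, _, _, m => famTensorMap n (fun i => m i.castSucc) ⊗ₘ m (Fin.last (n + 1))

/-- The morphism `⟦Γ⟧ ⊗ ⟦A⟧ ⟶ ⟦Γ, x : A⟧` for the context of the body of a binder of `x`. -/
def joinBinder (I : G → C) (Γ : Ctx G) (A : Ty G) :
    Ctx.interp I Γ ⊗ A.interp I ⟶ Ctx.interp I ((0, A) :: Γ.shift 1) :=
  eqToHom (Ctx.interp_shift I 1 Γ) ▷ _ ≫ (Ctx.joinIso I (0, A) (Γ.shift 1)).hom

/-- The morphism `(⟦Γ⟧ ⊗ ⟦A⟧) ⊗ ⟦B⟧ ⟶ ⟦Γ, x : A, y : B⟧` for the context of the body of a binder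
of `x ⊗ y`. -/
def joinBinder₂ (I : G → C) (Γ : Ctx G) (A B : Ty G) :
    (Ctx.interp I Γ ⊗ A.interp I) ⊗ B.interp I ⟶
      Ctx.interp I ((0, B) :: (1, A) :: Γ.shift 2) :=
  (eqToHom (Ctx.interp_shift I 2 Γ) ▷ _ ≫ (Ctx.joinIso I (1, A) (Γ.shift 2)).hom) ▷ _ ≫
    (Ctx.joinIso I (0, B) ((1, A) :: Γ.shift 2)).hom

/-- The composite `⟦E⟧ ⟶ ⟦Γ, Δ⟧ ⟶ ⟦Γ⟧ ⊗ ⟦Δ⟧` of the shuffling and the splitting morphism of a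
shuffle `E` of `Γ` and `Δ`. -/
def Shuffle.mor (I : G → C) : {Γ Δ E : Ctx G} → Shuffle Γ Δ E →
    (Ctx.interp I E ⟶ Ctx.interp I Γ ⊗ Ctx.interp I Δ)
  | _, _, _, .nil => (λ_ (𝟙_ C)).inv
  | _, _, _, .left (Γ := Γ) (Δ := Δ) (E := E) p s =>
      (Ctx.joinIso I p E).inv ≫ s.mor I ▷ _ ≫ (α_ _ _ _).hom ≫ _ ◁ (β_ _ _).hom ≫
        (α_ _ _ _).inv ≫ (Ctx.joinIso I p Γ).hom ▷ Ctx.interp I Δ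
  | _, _, _, .right (Γ := Γ) (Δ := Δ) (E := E) p s =>
      (Ctx.joinIso I p E).inv ≫ s.mor I ▷ _ ≫ (α_ _ _ _).hom ≫
        Ctx.interp I Γ ◁ (Ctx.joinIso I p Δ).hom

/-- The composite `⟦E⟧ ⟶ ⟦Γ₀, …, Γₙ⟧ ⟶ ⟦Γ₀⟧ ⊗ … ⊗ ⟦Γₙ⟧` of the shuffling and the splitting
morphism of a shuffle `E` of `Γ₀; …; Γₙ`. -/
def MultiShuffle.mor (I : G → C) : {n : ℕ} → {Γ : Fin (n + 1) → Ctx G} → {E : Ctx G} →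
    MultiShuffle n Γ E → (Ctx.interp I E ⟶ famTensor n fun i => Ctx.interp I (Γ i))
  | _, _, _, .one _ => 𝟙 _
  | _, _, _, .snoc t s => s.mor I ≫ t.mor I ▷ _

variable (S C) in
/-- An interpretation of the ground types and of the operation symbols. -/
structure Interpretation where
  ground : G → C
  op : ∀ f : S.Op, (famTensor (S.pred f) fun i => (S.dom f i).interp ground) ⟶
    (S.cod f).interp ground

/-- The interpretation `⟦Γ ▷ v : A⟧` of judgements, by recursion on the derivation. -/
def Der.interp (M : Interpretation S C) : {Γ : Ctx G} → {v : Tm S} → {A : Ty G} → Der Γ v A →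
    (Ctx.interp M.ground Γ ⟶ A.interp M.ground)
  | _, _, _, .op f d s _ =>
      s.mor M.ground ≫ famTensorMap (S.pred f) (fun i => (d i).interp M) ≫ M.op f
  | _, _, _, .var _ _ => 𝟙 _
  | _, _, _, .star => 𝟙 _
  | _, _, _, .toStar d e s _ =>
      s.mor M.ground ≫ d.interp M ▷ _ ≫ (λ_ _).hom ≫ e.interp M
  | _, _, _, .ten d e s _ => s.mor M.ground ≫ (d.interp M ⊗ₘ e.interp M)
  | _, _, _, .pm d e s _ =>
      s.mor M.ground ≫ d.interp M ▷ _ ≫ (β_ _ _).hom ≫ (α_ _ _ _).inv ≫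
        joinBinder₂ M.ground _ _ _ ≫ e.interp M
  | _, _, _, .lam d => curryHom (joinBinder M.ground _ _ ≫ d.interp M)
  | _, _, _, .app d e s _ =>
      s.mor M.ground ≫ (d.interp M ⊗ₘ e.interp M) ≫ appHom _ _

end Autonomous

/-! ### Theories, their theorems and their models -/

variable {V : Type u₃} [CommMonoid V] [CompleteLattice V]

/-- A `V`-equation-in-context `Γ ▷ v =_q w : A` with label in `B`. -/
structure VEquation (S : Signature.{u₁, u₂} G) (B : Set V) where
  ctx : Ctx G
  lhs : Tm S
  label : V
  rhs : Tm S
  ty : Ty G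
  label_mem : label ∈ B
  lhs_typed : Typed ctx lhs ty
  rhs_typed : Typed ctx rhs ty

/-- A linear `Vλ`-theory over the signature `S`, with labels in `B`: a collection of axioms. -/
structure VTheory (S : Signature.{u₁, u₂} G) (B : Set V) where
  axioms : Set (VEquation S B)

/-- The equations-in-context `E ▷ v = w : A` that hold in all autonomous categories.
In each of them `E` is an arbitrary permutation of the concatenation of the contexts of the terms
that occur in it. -/
inductive BaseEq : Ctx G → Tm S → Tm S → Ty G → Prop
  /-- `pm v ⊗ w to x ⊗ y. u = u[v/x, w/y]` -/
  | pm_ten {Γ Δ Θ E : Ctx G} {v w u : Tm S} {A B C : Ty G} :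
      Typed Γ v A → Typed Δ w B → Typed ((0, B) :: (1, A) :: Θ.shift 2) u C →
      E.Perm (Θ ++ Δ ++ Γ) → E.Distinct →
      BaseEq E (.pm (.ten v w) u) (u.inst₂ v w) C
  /-- `pm v to x ⊗ y. u[x ⊗ y/z] = u[v/z]` -/
  | pm_eta {Γ Δ E : Ctx G} {v u : Tm S} {z : ℕ} {A B C : Ty G} :
      Typed Γ v (.tensor A B) → Typed ((z, .tensor A B) :: Δ) u C →
      E.Perm (Δ ++ Γ) → E.Distinct →
      BaseEq E (.pm v (u.replaceUnder 2 z (.ten (.var 1) (.var 0)))) (u.replace z v) C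
  /-- `∗ to ∗. v = v` -/
  | star_toStar {E : Ctx G} {v : Tm S} {A : Ty G} :
      Typed E v A → BaseEq E (.toStar .star v) v A
  /-- `v to ∗. w[∗/z] = w[v/z]` -/
  | toStar_eta {Γ Δ E : Ctx G} {v w : Tm S} {z : ℕ} {A : Ty G} :
      Typed Γ v .unit → Typed ((z, .unit) :: Δ) w A →
      E.Perm (Δ ++ Γ) → E.Distinct →
      BaseEq E (.toStar v (w.replace z .star)) (w.replace z v) A
  /-- `(λ x : A. v) w = v[w/x]` -/
  | lam_beta {Γ Δ E : Ctx G} {v w : Tm S} {A B : Ty G} :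
      Typed ((0, A) :: Γ.shift 1) v B → Typed Δ w A →
      E.Perm (Δ ++ Γ) → E.Distinct →
      BaseEq E (.app (.lam A v) w) (v.inst w) B
  /-- `λ x : A. v x = v` -/
  | lam_eta {E : Ctx G} {v : Tm S} {A B : Ty G} :
      Typed E v (.lolli A B) → BaseEq E (.lam A (.app (v.shift 1) (.var 0))) v (.lolli A B)
  /-- `u[v to ∗. w/z] = v to ∗. u[w/z]` -/
  | toStar_comm {Γ Δ Θ E : Ctx G} {u v w : Tm S} {z : ℕ} {A B : Ty G} :
      Typed ((z, A) :: Γ) u B → Typed Δ v .unit → Typed Θ w A →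
      E.Perm (Θ ++ Δ ++ Γ) → E.Distinct →
      BaseEq E (u.replace z (.toStar v w)) (.toStar v (u.replace z w)) B
  /-- `u[pm v to x ⊗ y. w/z] = pm v to x ⊗ y. u[w/z]` -/
  | pm_comm {Γ Δ Θ E : Ctx G} {u v w : Tm S} {z : ℕ} {A B C D : Ty G} :
      Typed ((z, C) :: Γ) u D → Typed Δ v (.tensor A B) →
      Typed ((0, B) :: (1, A) :: Θ.shift 2) w C →
      E.Perm (Θ ++ Δ ++ Γ) → E.Distinct →
      BaseEq E (u.replace z (.pm v w)) (.pm v (u.replaceUnder 2 z w)) D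

/-- `T.Thm Γ v q w A` means that `Γ ▷ v =_q w : A` is a theorem of `T`. -/
inductive VTheory.Thm {B : Set V} (T : VTheory S B) : Ctx G → Tm S → V → Tm S → Ty G → Prop
  | ax (e : VEquation S B) : e ∈ T.axioms → Thm T e.ctx e.lhs e.label e.rhs e.ty
  | base {Γ : Ctx G} {v w : Tm S} {A : Ty G} : BaseEq Γ v w A → Thm T Γ v ⊤ w A
  | base_symm {Γ : Ctx G} {v w : Tm S} {A : Ty G} : BaseEq Γ v w A → Thm T Γ w ⊤ v A
  | refl {Γ : Ctx G} {v : Tm S} {A : Ty G} : Typed Γ v A → Thm T Γ v ⊤ v A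
  | trans {Γ : Ctx G} {v w u : Tm S} {A : Ty G} {q r : V} :
      Thm T Γ v q w A → Thm T Γ w r u A → Thm T Γ v (q * r) u A
  | weak {Γ : Ctx G} {v w : Tm S} {A : Ty G} {q r : V} :
      Thm T Γ v q w A → r ∈ B → r ≤ q → Thm T Γ v r w A
  | arch {Γ : Ctx G} {v w : Tm S} {A : Ty G} {q : V} : Typed Γ v A → Typed Γ w A → q ∈ B →
      (∀ r ∈ B, WayBelow r q → Thm T Γ v r w A) → Thm T Γ v q w A
  | join {Γ : Ctx G} {v w : Tm S} {A : Ty G} {n : ℕ} {q : Fin n → V} :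
      Typed Γ v A → Typed Γ w A → (∀ i, Thm T Γ v (q i) w A) → Thm T Γ v (⨆ i, q i) w A
  | op {E : Ctx G} (f : S.Op) {Γ : Fin (S.pred f + 1) → Ctx G}
      {v w : Fin (S.pred f + 1) → Tm S} {q : Fin (S.pred f + 1) → V} :
      (∀ i, Thm T (Γ i) (v i) (q i) (w i) (S.dom f i)) → MultiShuffle (S.pred f) Γ E →
      E.Distinct → Thm T E (.op f v) (∏ i, q i) (.op f w) (S.cod f)
  | ten {Γ Δ E : Ctx G} {v v' w w' : Tm S} {A A' : Ty G} {q r : V} :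
      Thm T Γ v q w A → Thm T Δ v' r w' A' → Shuffle Γ Δ E → E.Distinct →
      Thm T E (.ten v v') (q * r) (.ten w w') (.tensor A A')
  | pm {Γ Δ E : Ctx G} {v v' w w' : Tm S} {A A' C : Ty G} {q r : V} :
      Thm T Γ v q w (.tensor A A') → Thm T ((0, A') :: (1, A) :: Δ.shift 2) v' r w' C →
      Shuffle Γ Δ E → E.Distinct → Thm T E (.pm v v') (q * r) (.pm w w') C
  | toStar {Γ Δ E : Ctx G} {v v' w w' : Tm S} {A : Ty G} {q r : V} :
      Thm T Γ v q w .unit → Thm T Δ v' r w' A → Shuffle Γ Δ E → E.Distinct →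
      Thm T E (.toStar v v') (q * r) (.toStar w w') A
  | lam {Γ : Ctx G} {v w : Tm S} {A C : Ty G} {q : V} :
      Thm T ((0, A) :: Γ.shift 1) v q w C → Thm T Γ (.lam A v) q (.lam A w) (.lolli A C)
  | app {Γ Δ E : Ctx G} {v v' w w' : Tm S} {A C : Ty G} {q r : V} :
      Thm T Γ v q w (.lolli A C) → Thm T Δ v' r w' A → Shuffle Γ Δ E → E.Distinct →
      Thm T E (.app v v') (q * r) (.app w w') C
  | perm {Γ Δ : Ctx G} {v w : Tm S} {A : Ty G} {q : V} :
      Thm T Γ v q w A → Δ.Perm Γ → Thm T Δ v q w A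
  | subst {Γ Δ : Ctx G} {x : ℕ} {v v' w w' : Tm S} {A C : Ty G} {q r : V} :
      Thm T ((x, A) :: Γ) v q w C → Thm T Δ v' r w' A → Ctx.Distinct (Δ ++ Γ) →
      Thm T (Δ ++ Γ) (v.replace x v') (q * r) (w.replace x w') C

variable [IsQuantale V] {B : Set V}

/-- A model of the theory `T` in the autonomous category `C` enriched over separated
`V`-categories: an interpretation that satisfies all axioms. -/
structure VTheory.Model (T : VTheory S B) (C : Type u₄) [Category.{v₄} C] [MonoidalCategory C]
    [SymmetricCategory C] [MonoidalClosed C] [VCatSepCategory V C] [VCatSepAutonomous V C] where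
  toInterpretation : Interpretation S C
  sat : ∀ e ∈ T.axioms, ∀ (d : Der e.ctx e.lhs e.ty) (d' : Der e.ctx e.rhs e.ty),
    e.label ≤ (VCatSepCategory.hom _ _).dist (d.interp toInterpretation)
      (d'.interp toInterpretation)

/-! ### The syntactic category -/

/-- The terms `v` with `x : A ▷ v : A'`. -/
def Val (S : Signature.{u₁, u₂} G) (A A' : Ty G) : Type (max u₁ u₂) :=
  {v : Tm S // Typed [(0, A)] v A'}

namespace Val

/-- The term `w[v/x]`. -/
def comp {A A' A'' : Ty G} (v : Val S A A') (w : Val S A' A'') : Val S A A'' :=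
  ⟨w.1.replace 0 v.1, w.2.subst (K := fun _ => [(0, A)])
    (by rintro p hp; obtain rfl := List.mem_singleton.1 hp; exact v.2)
    (by simp [Ctx.Distinct, Ctx.shift]) (.refl _)⟩

/-- The term `pm z to x ⊗ y. v[x/z] ⊗ w[y/z]`. -/
def tensor {A A' C C' : Ty G} (v : Val S A A') (w : Val S C C') :
    Val S (.tensor A C) (.tensor A' C') :=
  ⟨.pm (.var 0) (.ten (v.1.replace 0 (.var 1)) w.1),
    ⟨.pm (.var 0 _)
      (.ten (v.2.subst (K := fun _ => [(1, A)]) (σ := fun n => if n = 0 then .var 1 else .var n)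
        (by rintro p hp; obtain rfl := List.mem_singleton.1 hp; exact ⟨.var 1 A⟩)
        (by simp [Ctx.Distinct, Ctx.shift]) (.refl _)).some w.2.some
        (.right _ (.left _ .nil)) (by simp [Ctx.Distinct, Ctx.shift]))
      (Δ := []) (.left _ .nil) (by simp [Ctx.Distinct, Ctx.shift])⟩⟩

/-- The term `λ y. v[x ⊗ y/z]`. -/
def curry {A A' C : Ty G} (v : Val S (.tensor A A') C) : Val S A (.lolli A' C) :=
  ⟨.lam A' (v.1.replace 0 (.ten (.var 1) (.var 0))),
    ⟨.lam (v.2.subst (K := fun _ => [(0, A'), (1, A)])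
      (σ := fun n => if n = 0 then .ten (.var 1) (.var 0) else .var n)
        (by
          rintro p hp
          obtain rfl := List.mem_singleton.1 hp
          exact ⟨.ten (.var 1 _) (.var 0 _) (.right _ (.left _ .nil)) (by simp [Ctx.Distinct, Ctx.shift])⟩)
        (by simp [Ctx.Distinct, Ctx.shift]) (.refl _)).some⟩⟩

variable (S)

/-- The term `x`. -/
def id (A : Ty G) : Val S A A := ⟨.var 0, ⟨.var 0 A⟩⟩

/-- The term `pm z to t ⊗ c. pm t to a ⊗ b. a ⊗ (b ⊗ c)`. -/
def assocHom (A₁ A₂ A₃ : Ty G) :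
    Val S (.tensor (.tensor A₁ A₂) A₃) (.tensor A₁ (.tensor A₂ A₃)) :=
  ⟨.pm (.var 0) (.pm (.var 1) (.ten (.var 1) (.ten (.var 0) (.var 2)))),
    ⟨.pm (.var 0 _)
      (.pm (.var 1 _)
        (.ten (.var 1 _) (.ten (.var 0 _) (.var 2 _) (.left _ (.right _ .nil))
            (by simp [Ctx.Distinct, Ctx.shift]))
          (.right _ (.left _ (.right _ .nil))) (by simp [Ctx.Distinct, Ctx.shift]))
        (Δ := [(0, A₃)]) (.right _ (.left _ .nil)) (by simp [Ctx.Distinct, Ctx.shift]))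
      (Δ := []) (.left _ .nil) (by simp [Ctx.Distinct, Ctx.shift])⟩⟩

/-- The term `pm z to a ⊗ t. pm t to b ⊗ c. (a ⊗ b) ⊗ c`. -/
def assocInv (A₁ A₂ A₃ : Ty G) :
    Val S (.tensor A₁ (.tensor A₂ A₃)) (.tensor (.tensor A₁ A₂) A₃) :=
  ⟨.pm (.var 0) (.pm (.var 0) (.ten (.ten (.var 3) (.var 1)) (.var 0))),
    ⟨.pm (.var 0 _)
      (.pm (.var 0 _)
        (.ten (.ten (.var 3 _) (.var 1 _) (.right _ (.left _ .nil)) (by simp [Ctx.Distinct, Ctx.shift]))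
          (.var 0 _) (.right _ (.left _ (.left _ .nil))) (by simp [Ctx.Distinct, Ctx.shift]))
        (Δ := [(1, A₁)]) (.left _ (.right _ .nil)) (by simp [Ctx.Distinct, Ctx.shift]))
      (Δ := []) (.left _ .nil) (by simp [Ctx.Distinct, Ctx.shift])⟩⟩

/-- The term `pm z to i ⊗ a. i to ∗. a`. -/
def leftHom (A : Ty G) : Val S (.tensor .unit A) A :=
  ⟨.pm (.var 0) (.toStar (.var 1) (.var 0)),
    ⟨.pm (.var 0 _) (.toStar (.var 1 _) (.var 0 _) (.right _ (.left _ .nil))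
      (by simp [Ctx.Distinct, Ctx.shift])) (Δ := []) (.left _ .nil) (by simp [Ctx.Distinct, Ctx.shift])⟩⟩

/-- The term `∗ ⊗ z`. -/
def leftInv (A : Ty G) : Val S A (.tensor .unit A) :=
  ⟨.ten .star (.var 0), ⟨.ten .star (.var 0 _) (.right _ .nil) (by simp [Ctx.Distinct, Ctx.shift])⟩⟩

/-- The term `pm z to a ⊗ i. i to ∗. a`. -/
def rightHom (A : Ty G) : Val S (.tensor A .unit) A :=
  ⟨.pm (.var 0) (.toStar (.var 0) (.var 1)),
    ⟨.pm (.var 0 _) (.toStar (.var 0 _) (.var 1 _) (.left _ (.right _ .nil))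
      (by simp [Ctx.Distinct, Ctx.shift])) (Δ := []) (.left _ .nil) (by simp [Ctx.Distinct, Ctx.shift])⟩⟩

/-- The term `z ⊗ ∗`. -/
def rightInv (A : Ty G) : Val S A (.tensor A .unit) :=
  ⟨.ten (.var 0) .star, ⟨.ten (.var 0 _) .star (.left _ .nil) (by simp [Ctx.Distinct, Ctx.shift])⟩⟩

/-- The term `pm z to x ⊗ y. y ⊗ x`. -/
def braid (A A' : Ty G) : Val S (.tensor A A') (.tensor A' A) :=
  ⟨.pm (.var 0) (.ten (.var 0) (.var 1)),
    ⟨.pm (.var 0 _) (.ten (.var 0 _) (.var 1 _) (.left _ (.right _ .nil))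
      (by simp [Ctx.Distinct, Ctx.shift])) (Δ := []) (.left _ .nil) (by simp [Ctx.Distinct, Ctx.shift])⟩⟩

/-- The term `pm z to f ⊗ x. f x`. -/
def app (A A' : Ty G) : Val S (.tensor (.lolli A A') A) A' :=
  ⟨.pm (.var 0) (.app (.var 1) (.var 0)),
    ⟨.pm (.var 0 _) (.app (.var 1 _) (.var 0 _) (.right _ (.left _ .nil))
      (by simp [Ctx.Distinct, Ctx.shift])) (Δ := []) (.left _ .nil) (by simp [Ctx.Distinct, Ctx.shift])⟩⟩

end Val

theorem sSup_mul_sSup_le {s t : Set V} {c : V} (h : ∀ q ∈ s, ∀ r ∈ t, q * r ≤ c) :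
    sSup s * sSup t ≤ c := by
  rw [sSup_mul_distrib]
  refine iSup₂_le fun q hq => ?_
  rw [mul_sSup_distrib]
  exact iSup₂_le fun r hr => h q hq r hr

/-- The `V`-category of the terms `v` with `x : A ▷ v : A'`, with
`a(v, w) = ⋁ {q | v =_q w is a theorem}`. -/
def VTheory.val (T : VTheory S B) (A A' : Ty G) : VCategory V (Val S A A') where
  dist v w := sSup {q | T.Thm [(0, A)] v.1 q w.1 A'}
  one_le_dist v := le_top.trans (le_sSup (VTheory.Thm.refl v.2))
  dist_mul_dist_le _ _ _ := sSup_mul_sSup_le fun _ hq _ hr => le_sSup (hq.trans hr)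

theorem le_mul_top (q : V) : q ≤ q * ⊤ :=
  calc q = q * 1 := (mul_one q).symm
    _ ≤ q * ⊤ := mul_le_mul' le_rfl le_top

theorem VTheory.comp_isVFunctor (T : VTheory S B) (A A' A'' : Ty G) :
    IsVFunctor ((T.val A A').tensor (T.val A' A'')) (T.val A A'') fun p => p.1.comp p.2 := by
  rintro ⟨v, w⟩ ⟨v', w'⟩
  refine sSup_mul_sSup_le fun q hq r hr => ?_
  rw [mul_comm]
  exact le_sSup (VTheory.Thm.subst (Γ := []) hr hq (by simp [Ctx.Distinct, Ctx.shift]))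

theorem VTheory.tensor_isVFunctor (T : VTheory S B) (A A' C C' : Ty G) :
    IsVFunctor ((T.val A A').tensor (T.val C C')) (T.val (.tensor A C) (.tensor A' C'))
      fun p => p.1.tensor p.2 := by
  rintro ⟨v, w⟩ ⟨v', w'⟩
  refine sSup_mul_sSup_le fun q hq r hr => ?_
  have h₁ := VTheory.Thm.subst (Γ := []) hq (.refl (⟨.var 1 A⟩ : Typed [(1, A)] (.var 1) A))
    (by simp [Ctx.Distinct, Ctx.shift])
  have h₂ := VTheory.Thm.ten h₁ hr (.right _ (.left _ .nil)) (by simp [Ctx.Distinct, Ctx.shift])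
  have h₃ := VTheory.Thm.pm (T := T) (Δ := []) (.refl ⟨.var 0 (.tensor A C)⟩) h₂ (.left _ .nil)
    (by simp [Ctx.Distinct, Ctx.shift])
  refine le_trans ?_ (le_sSup h₃)
  rw [mul_comm ⊤]
  exact (mul_le_mul' (le_mul_top q) le_rfl).trans (le_mul_top _)

theorem VTheory.curry_isVFunctor (T : VTheory S B) (A A' C : Ty G) :
    IsVFunctor (T.val (.tensor A A') C) (T.val A (.lolli A' C)) Val.curry := by
  intro v w
  refine sSup_le fun q hq => ?_
  have h₁ := VTheory.Thm.subst (Γ := []) hq (.refl (⟨.ten (.var 1 _) (.var 0 _)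
    (.right _ (.left _ .nil)) (by simp [Ctx.Distinct, Ctx.shift])⟩ :
      Typed [(0, A'), (1, A)] (.ten (.var 1) (.var 0)) (.tensor A A')))
    (by simp [Ctx.Distinct, Ctx.shift])
  exact (le_mul_top q).trans (le_sSup (VTheory.Thm.lam (Γ := [(0, A)]) h₁))

/-! Raw identities of substitution. -/

theorem Tm.subst_congr (v : Tm S) {σ τ : ℕ → Tm S} (h : ∀ n, σ n = τ n) :
    v.subst σ = v.subst τ := by
  rw [funext h]

theorem up_var : up (fun n => (.var n : Tm S)) = fun n => .var n := by
  funext n; cases n <;> rfl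

theorem Tm.subst_var (v : Tm S) : v.subst (fun n => .var n) = v := by
  induction v with
  | var => rfl
  | op f v ih => simp only [Tm.subst, ih]
  | star => rfl
  | toStar v w hv hw => simp only [Tm.subst, hv, hw]
  | ten v w hv hw => simp only [Tm.subst, hv, hw]
  | pm v w hv hw => simp only [Tm.subst, up_var, hv, hw]
  | lam A v hv => simp only [Tm.subst, up_var, hv]
  | app v w hv hw => simp only [Tm.subst, hv, hw]

theorem upRen_comp (ρ ρ' : ℕ → ℕ) : (fun n => upRen ρ' (upRen ρ n)) = upRen fun n => ρ' (ρ n) := by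
  funext n; cases n <;> rfl

theorem Tm.rename_rename (v : Tm S) : ∀ ρ ρ' : ℕ → ℕ,
    (v.rename ρ).rename ρ' = v.rename fun n => ρ' (ρ n) := by
  induction v with
  | var => intros; rfl
  | op f v ih => intros; simp only [Tm.rename, ih]
  | star => intros; rfl
  | toStar v w hv hw => intros; simp only [Tm.rename, hv, hw]
  | ten v w hv hw => intros; simp only [Tm.rename, hv, hw]
  | pm v w hv hw => intros; simp only [Tm.rename, upRen_comp, hv, hw]
  | lam A v hv => intros; simp only [Tm.rename, upRen_comp, hv]
  | app v w hv hw => intros; simp only [Tm.rename, hv, hw]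

theorem up_upRen (ρ : ℕ → ℕ) (σ : ℕ → Tm S) :
    (fun n => up σ (upRen ρ n)) = up fun n => σ (ρ n) := by
  funext n; cases n <;> rfl

theorem Tm.rename_subst (v : Tm S) : ∀ (ρ : ℕ → ℕ) (σ : ℕ → Tm S),
    (v.rename ρ).subst σ = v.subst fun n => σ (ρ n) := by
  induction v with
  | var => intros; rfl
  | op f v ih => intros; simp only [Tm.rename, Tm.subst, ih]
  | star => intros; rfl
  | toStar v w hv hw => intros; simp only [Tm.rename, Tm.subst, hv, hw]
  | ten v w hv hw => intros; simp only [Tm.rename, Tm.subst, hv, hw]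
  | pm v w hv hw => intros; simp only [Tm.rename, Tm.subst, up_upRen, hv, hw]
  | lam A v hv => intros; simp only [Tm.rename, Tm.subst, up_upRen, hv]
  | app v w hv hw => intros; simp only [Tm.rename, Tm.subst, hv, hw]

theorem up_rename (σ : ℕ → Tm S) (ρ : ℕ → ℕ) :
    (fun n => (up σ n).rename (upRen ρ)) = up fun n => (σ n).rename ρ := by
  funext n
  cases n with
  | zero => rfl
  | succ n => simp only [up, Tm.shift, Tm.rename_rename, upRen]

theorem Tm.subst_rename (v : Tm S) : ∀ (σ : ℕ → Tm S) (ρ : ℕ → ℕ),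
    (v.subst σ).rename ρ = v.subst fun n => (σ n).rename ρ := by
  induction v with
  | var => intros; rfl
  | op f v ih => intros; simp only [Tm.rename, Tm.subst, ih]
  | star => intros; rfl
  | toStar v w hv hw => intros; simp only [Tm.rename, Tm.subst, hv, hw]
  | ten v w hv hw => intros; simp only [Tm.rename, Tm.subst, hv, hw]
  | pm v w hv hw => intros; simp only [Tm.rename, Tm.subst, up_rename, hv, hw]
  | lam A v hv => intros; simp only [Tm.rename, Tm.subst, up_rename, hv]
  | app v w hv hw => intros; simp only [Tm.rename, Tm.subst, hv, hw]

theorem up_subst (σ τ : ℕ → Tm S) :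
    (fun n => (up σ n).subst (up τ)) = up fun n => (σ n).subst τ := by
  funext n
  cases n with
  | zero => rfl
  | succ n => simp only [up, Tm.shift, Tm.rename_subst, Tm.subst_rename]

theorem Tm.subst_subst (v : Tm S) : ∀ σ τ : ℕ → Tm S,
    (v.subst σ).subst τ = v.subst fun n => (σ n).subst τ := by
  induction v with
  | var => intros; rfl
  | op f v ih => intros; simp only [Tm.subst, ih]
  | star => intros; rfl
  | toStar v w hv hw => intros; simp only [Tm.subst, hv, hw]
  | ten v w hv hw => intros; simp only [Tm.subst, hv, hw]
  | pm v w hv hw => intros; simp only [Tm.subst, up_subst, hv, hw]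
  | lam A v hv => intros; simp only [Tm.subst, up_subst, hv]
  | app v w hv hw => intros; simp only [Tm.subst, hv, hw]

theorem Val.id_comp {A A' : Ty G} (v : Val S A A') : (Val.id S A).comp v = v := by
  refine Subtype.ext ?_
  change v.1.subst _ = _
  rw [Tm.subst_congr v.1 (τ := fun n => .var n), Tm.subst_var]
  intro n
  by_cases h : n = 0
  · subst h; rfl
  · simp [h]

theorem Val.comp_id {A A' : Ty G} (v : Val S A A') : v.comp (Val.id S A') = v := rfl

theorem Val.comp_assoc {A A' C C' : Ty G} (u : Val S A A') (v : Val S A' C) (w : Val S C C') :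
    (u.comp v).comp w = u.comp (v.comp w) := by
  refine Subtype.ext ?_
  change w.1.subst _ = (w.1.subst _).subst _
  rw [Tm.subst_subst]
  refine Tm.subst_congr _ fun n => ?_
  by_cases h : n = 0
  · subst h; rfl
  · simp [h, Tm.subst]

/-- The objects of the syntactic category of `T`: the types. -/
def Syn (_T : VTheory S B) : Type u₁ := Ty G

namespace Syn

variable (T : VTheory S B)

/-- The syntactic category of `T`: morphisms are the classes of terms in the separated quotient,
and the composite of `[v]` and `[w]` is `[w[v/x]]`. -/
instance category : Category.{max u₁ u₂} (Syn T) where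
  Hom A A' := Quotient (T.val A A').setoid
  id A := Quotient.mk _ (Val.id S A)
  comp := VCategory.sepMap₂ Val.comp (T.comp_isVFunctor _ _ _)
  id_comp := by rintro A A' ⟨v⟩; exact congrArg (Quotient.mk _) v.id_comp
  comp_id := by rintro A A' ⟨v⟩; exact congrArg (Quotient.mk _) v.comp_id
  assoc := by rintro _ _ _ _ ⟨u⟩ ⟨v⟩ ⟨w⟩; exact congrArg (Quotient.mk _) (u.comp_assoc v w)

/-- The enrichment of the syntactic category. -/
instance vCatSepCategory : VCatSepCategory V (Syn T) where
  hom A A' := (T.val A A').separation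
  isSeparated A A' := (T.val A A').separation_isSeparated
  comp := by rintro A A' A'' ⟨⟨v⟩, ⟨w⟩⟩ ⟨⟨v'⟩, ⟨w'⟩⟩; exact T.comp_isVFunctor A A' A'' (v, w) (v', w')

variable {T}

/-- The object given by a type. -/
def of (A : Ty G) : Syn T := A

/-- The morphism `[v]` of a term `x : A ▷ v : A'`. -/
def mk {A A' : Ty G} (v : Val S A A') : (of A : Syn T) ⟶ of A' := Quotient.mk _ v

end Syn

/-! ### Autonomous structures given by explicit data -/

/-- The operations of an autonomous structure on a category. -/
structure AutonomousData (D : Type u₄) [Category.{v₄} D] where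
  unit : D
  tensorObj : D → D → D
  lolli : D → D → D
  tensorHom : ∀ {X X' Y Y' : D}, (X ⟶ Y) → (X' ⟶ Y') → (tensorObj X X' ⟶ tensorObj Y Y')
  assocHom : ∀ X Y Z : D, tensorObj (tensorObj X Y) Z ⟶ tensorObj X (tensorObj Y Z)
  assocInv : ∀ X Y Z : D, tensorObj X (tensorObj Y Z) ⟶ tensorObj (tensorObj X Y) Z
  leftHom : ∀ X : D, tensorObj unit X ⟶ X
  leftInv : ∀ X : D, X ⟶ tensorObj unit X
  rightHom : ∀ X : D, tensorObj X unit ⟶ X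
  rightInv : ∀ X : D, X ⟶ tensorObj X unit
  braid : ∀ X Y : D, tensorObj X Y ⟶ tensorObj Y X
  app : ∀ X Y : D, tensorObj (lolli X Y) X ⟶ Y
  curry : ∀ {X Y Z : D}, (tensorObj X Y ⟶ Z) → (X ⟶ lolli Y Z)

namespace AutonomousData

variable {D : Type u₄} [Category.{v₄} D]

/-- The laws of a symmetric monoidal closed category. -/
structure IsAutonomous (P : AutonomousData D) : Prop where
  id_tensor_id : ∀ X Y : D, P.tensorHom (𝟙 X) (𝟙 Y) = 𝟙 (P.tensorObj X Y)
  tensor_comp : ∀ {X Y Z X' Y' Z' : D} (f : X ⟶ Y) (f' : X' ⟶ Y') (g : Y ⟶ Z) (g' : Y' ⟶ Z'),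
    P.tensorHom f f' ≫ P.tensorHom g g' = P.tensorHom (f ≫ g) (f' ≫ g')
  assoc_hom_inv : ∀ X Y Z : D, P.assocHom X Y Z ≫ P.assocInv X Y Z = 𝟙 _
  assoc_inv_hom : ∀ X Y Z : D, P.assocInv X Y Z ≫ P.assocHom X Y Z = 𝟙 _
  left_hom_inv : ∀ X : D, P.leftHom X ≫ P.leftInv X = 𝟙 _
  left_inv_hom : ∀ X : D, P.leftInv X ≫ P.leftHom X = 𝟙 _
  right_hom_inv : ∀ X : D, P.rightHom X ≫ P.rightInv X = 𝟙 _
  right_inv_hom : ∀ X : D, P.rightInv X ≫ P.rightHom X = 𝟙 _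
  assoc_naturality : ∀ {X Y Z X' Y' Z' : D} (f : X ⟶ X') (g : Y ⟶ Y') (h : Z ⟶ Z'),
    P.tensorHom (P.tensorHom f g) h ≫ P.assocHom X' Y' Z' =
      P.assocHom X Y Z ≫ P.tensorHom f (P.tensorHom g h)
  left_naturality : ∀ {X Y : D} (f : X ⟶ Y),
    P.tensorHom (𝟙 P.unit) f ≫ P.leftHom Y = P.leftHom X ≫ f
  right_naturality : ∀ {X Y : D} (f : X ⟶ Y),
    P.tensorHom f (𝟙 P.unit) ≫ P.rightHom Y = P.rightHom X ≫ f
  pentagon : ∀ W X Y Z : D,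
    P.tensorHom (P.assocHom W X Y) (𝟙 Z) ≫ P.assocHom W (P.tensorObj X Y) Z ≫
        P.tensorHom (𝟙 W) (P.assocHom X Y Z) =
      P.assocHom (P.tensorObj W X) Y Z ≫ P.assocHom W X (P.tensorObj Y Z)
  triangle : ∀ X Y : D,
    P.assocHom X P.unit Y ≫ P.tensorHom (𝟙 X) (P.leftHom Y) = P.tensorHom (P.rightHom X) (𝟙 Y)
  braid_naturality : ∀ {X Y X' Y' : D} (f : X ⟶ X') (g : Y ⟶ Y'),
    P.tensorHom f g ≫ P.braid X' Y' = P.braid X Y ≫ P.tensorHom g f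
  braid_braid : ∀ X Y : D, P.braid X Y ≫ P.braid Y X = 𝟙 _
  hexagon : ∀ X Y Z : D,
    P.assocHom X Y Z ≫ P.braid X (P.tensorObj Y Z) ≫ P.assocHom Y Z X =
      P.tensorHom (P.braid X Y) (𝟙 Z) ≫ P.assocHom Y X Z ≫ P.tensorHom (𝟙 Y) (P.braid X Z)
  curry_app : ∀ {X Y Z : D} (f : P.tensorObj X Y ⟶ Z),
    P.tensorHom (P.curry f) (𝟙 Y) ≫ P.app Y Z = f
  curry_unique : ∀ {X Y Z : D} (g : X ⟶ P.lolli Y Z),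
    P.curry (P.tensorHom g (𝟙 Y) ≫ P.app Y Z) = g

variable {P : AutonomousData D} (h : P.IsAutonomous)

/-- The monoidal category with the operations `P`. -/
abbrev IsAutonomous.monoidalCategory : MonoidalCategory D :=
  letI : MonoidalCategoryStruct D :=
    { tensorObj := P.tensorObj
      whiskerLeft := fun X _ _ f => P.tensorHom (𝟙 X) f
      whiskerRight := fun f X => P.tensorHom f (𝟙 X)
      tensorHom := P.tensorHom
      tensorUnit := P.unit
      associator := fun X Y Z =>
        ⟨P.assocHom X Y Z, P.assocInv X Y Z, h.assoc_hom_inv X Y Z, h.assoc_inv_hom X Y Z⟩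
      leftUnitor := fun X => ⟨P.leftHom X, P.leftInv X, h.left_hom_inv X, h.left_inv_hom X⟩
      rightUnitor := fun X => ⟨P.rightHom X, P.rightInv X, h.right_hom_inv X, h.right_inv_hom X⟩ }
  MonoidalCategory.ofTensorHom
    (id_tensorHom_id := h.id_tensor_id)
    (id_tensorHom := fun _ _ _ _ => rfl)
    (tensorHom_id := fun _ _ => rfl)
    (tensorHom_comp_tensorHom := h.tensor_comp)
    (associator_naturality := h.assoc_naturality)
    (leftUnitor_naturality := h.left_naturality)
    (rightUnitor_naturality := h.right_naturality)
    (pentagon := h.pentagon)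
    (triangle := h.triangle)

/-- The symmetric monoidal category with the operations `P`. -/
abbrev IsAutonomous.symmetricCategory : letI := h.monoidalCategory; SymmetricCategory D :=
  letI := h.monoidalCategory
  have reverse : ∀ X Y Z : D,
      P.assocInv X Y Z ≫ P.braid (P.tensorObj X Y) Z ≫ P.assocInv Z X Y =
        P.tensorHom (𝟙 X) (P.braid Y Z) ≫ P.assocInv X Z Y ≫ P.tensorHom (P.braid X Z) (𝟙 Y) := by
    intro X Y Z
    have h₁ : (P.assocInv X Y Z ≫ P.braid (P.tensorObj X Y) Z ≫ P.assocInv Z X Y) ≫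
        (P.assocHom Z X Y ≫ P.braid Z (P.tensorObj X Y) ≫ P.assocHom X Y Z) = 𝟙 _ := by
      simp only [Category.assoc, reassoc_of% (h.assoc_inv_hom Z X Y),
        reassoc_of% (h.braid_braid (P.tensorObj X Y) Z), h.assoc_inv_hom]
    have h₂ : (P.tensorHom (P.braid Z X) (𝟙 Y) ≫ P.assocHom X Z Y ≫
        P.tensorHom (𝟙 X) (P.braid Z Y)) ≫ (P.tensorHom (𝟙 X) (P.braid Y Z) ≫
          P.assocInv X Z Y ≫ P.tensorHom (P.braid X Z) (𝟙 Y)) = 𝟙 _ := by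
      have e₁ := h.tensor_comp (𝟙 X) (P.braid Z Y) (𝟙 X) (P.braid Y Z)
      have e₂ := h.tensor_comp (P.braid Z X) (𝟙 Y) (P.braid X Z) (𝟙 Y)
      rw [h.braid_braid, Category.comp_id, h.id_tensor_id] at e₁ e₂
      simp only [Category.assoc, reassoc_of% e₁, reassoc_of% (h.assoc_hom_inv X Z Y), e₂]
    rw [h.hexagon] at h₁
    rw [← Category.comp_id (_ ≫ _ ≫ _), ← h₂, ← Category.assoc, h₁, Category.id_comp]
  { braiding := fun X Y => ⟨P.braid X Y, P.braid Y X, h.braid_braid X Y, h.braid_braid Y X⟩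
    braiding_naturality_right := fun X _ _ f => h.braid_naturality (𝟙 X) f
    braiding_naturality_left := fun f Z => h.braid_naturality f (𝟙 Z)
    hexagon_forward := h.hexagon
    hexagon_reverse := reverse
    symmetry := h.braid_braid }

/-- The closed structure with the operations `P`. -/
abbrev IsAutonomous.monoidalClosed : letI := h.monoidalCategory; MonoidalClosed D :=
  letI := h.monoidalCategory
  letI := h.symmetricCategory
  have key : ∀ {X X' Y Z : D} (f : X' ⟶ X) (g : P.tensorObj X Y ⟶ Z),
      P.curry (P.tensorHom f (𝟙 Y) ≫ g) = f ≫ P.curry g := by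
    intro X X' Y Z f g
    rw [← h.curry_unique (f ≫ P.curry g)]
    congr 1
    rw [← Category.comp_id (𝟙 Y), ← h.tensor_comp, Category.assoc, h.curry_app,
      Category.comp_id]
  let adj : ∀ Y : D, Σ R : D ⥤ D, (tensorRight Y ⊣ R) := fun Y =>
    ⟨Adjunction.rightAdjointOfEquiv (F := tensorRight Y) (G_obj := P.lolli Y)
      (fun X Z => { toFun := fun f => P.curry f
                    invFun := fun g => P.tensorHom g (𝟙 Y) ≫ P.app Y Z
                    left_inv := fun f => h.curry_app f
                    right_inv := fun g => h.curry_unique g })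
      (fun X' X Z f g => key f g), Adjunction.adjunctionOfEquivRight _ _⟩
  { closed := fun Y =>
      { rightAdj := (adj Y).1
        adj := (adj Y).2.ofNatIsoLeft (BraidedCategory.tensorLeftIsoTensorRight Y).symm } }

end AutonomousData

/-- The operations of the autonomous structure of the syntactic category. -/
def Syn.autonomousData (T : VTheory S B) : AutonomousData (Syn T) where
  unit := Syn.of .unit
  tensorObj A A' := Syn.of (.tensor A A')
  lolli A A' := Syn.of (.lolli A A')
  tensorHom := VCategory.sepMap₂ Val.tensor (T.tensor_isVFunctor _ _ _ _)
  assocHom A₁ A₂ A₃ := Syn.mk (Val.assocHom S A₁ A₂ A₃)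
  assocInv A₁ A₂ A₃ := Syn.mk (Val.assocInv S A₁ A₂ A₃)
  leftHom A := Syn.mk (Val.leftHom S A)
  leftInv A := Syn.mk (Val.leftInv S A)
  rightHom A := Syn.mk (Val.rightHom S A)
  rightInv A := Syn.mk (Val.rightInv S A)
  braid A A' := Syn.mk (Val.braid S A A')
  app A A' := Syn.mk (Val.app S A A')
  curry := VCategory.sepMap Val.curry (T.curry_isVFunctor _ _ _)

end VLambda

/-! ### Equational reasoning with typed linear terms -/

namespace VLambda

section Syntactic

set_option linter.unusedSectionVars false

variable {G : Type u₁} {S : Signature.{u₁, u₂} G}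

/-! ### Typing of substitutions that rename most variables -/

/-! The argument has a syntactic half, the laws of the category of terms, and a semantic half, the
soundness of the interpretation.

Syntactic half. By the η-rule for pattern matching, two terms with a free variable of a tensor type
are equal as soon as they are equal after a pair of variables is substituted for it; the unit type
behaves in the same way with `∗` (`VTheory.Eqv.ext`, `VTheory.Eqv.ext_unit`). Once the source
variable has been split far enough, the two sides of each monoidal law have a common β-reduct.
Reduction is defined on raw terms and is sound on typed ones (`Red.typed_eqv`), so comparing reducts
is a computation. Only the uniqueness of transposes also needs the η-rule for functions. The
enrichment comes from the compatibility rules: tensoring, transposing and composing do not decrease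
the supremum of the provable labels, and the remaining operations of the adjunction are composites
of these.

Semantic half. The interpretation is defined on derivations, whereas the theorems speak about terms,
so three facts are needed: it does not depend on the derivation, it turns substitution into
composition, and it is compatible with exchange. To have one clause for every nonempty context, the
tensor product of a context is taken to start with the unit object (`Ctx.ten`), and the
interpretation is recast as a relation `Sem` between judgements and morphisms. Linearity makes the
relation functional: the context of a subterm consists of exactly its free variables, and so the
shuffles are determined (`Sem.unique`). Substitutions are interpreted by the relation `Env`. A
substitution can be split along a shuffle because shuffles can be rebracketed and permuted
(`Shuffle.ten_assoc`, `Shuffle.ten_rightComm`, `Env.split`), and this gives the substitution lemma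
`Sem.subst`, of which exchange is the case of variables substituted for themselves.

With these facts the eight families of equations become identities in symmetric monoidal closed
categories (`BaseEq.sem`), and soundness follows by induction on theorems (`VTheory.Thm.sem`).
Integrality turns the label `⊤` into reflexivity, and the basis property validates the rule that
infers an equation from its approximations. Soundness bounds distances of terms by distances of
their interpretations; since the homs of the target are separated, the interpretation descends to
the quotient. Strict preservation is then a calculation of the interpretations of the structural
terms. -/

theorem Ctx.Distinct.filter_eq {Γ : Ctx G} (h : Γ.Distinct) {p : ℕ × Ty G} (hp : p ∈ Γ) :
    Γ.filter (fun q => q.1 = p.1) = [p] := by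
  induction Γ with
  | nil => cases hp
  | cons q Γ ih =>
    have h' := List.nodup_cons.1 (show (q.1 :: Γ.map Prod.fst).Nodup from h)
    rcases List.mem_cons.1 hp with rfl | hp
    · rw [List.filter_cons_of_pos (by simp), List.filter_eq_nil_iff.2]
      intro a ha hap
      exact h'.1 (List.mem_map.2 ⟨a, ha, by simpa using hap⟩)
    · rw [List.filter_cons_of_neg, ih h'.2 hp]
      intro hqp
      exact h'.1 (List.mem_map.2 ⟨p, hp, by simpa using Eq.symm (of_decide_eq_true hqp)⟩)

/-- `Typed.subst` wants the context of each substituted term as a function of the variable name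
alone. For a variable that is kept, looking its name up in `Γ` by filtering is such a function, and
these lookups reassemble `Γ`. -/
theorem Ctx.Distinct.flatMap_filter {Γ : Ctx G} (h : Γ.Distinct) :
    (Γ.flatMap fun p => Γ.filter fun q => q.1 = p.1) = Γ := by
  rw [List.flatMap_congr fun p hp => h.filter_eq hp]
  exact List.flatMap_singleton' Γ

theorem Ctx.Distinct.left {Γ Δ : Ctx G} (h : Ctx.Distinct (Γ ++ Δ)) : Γ.Distinct := by
  unfold Ctx.Distinct at *
  rw [List.map_append] at h
  exact h.of_append_left

theorem Ctx.Distinct.right {Γ Δ : Ctx G} (h : Ctx.Distinct (Γ ++ Δ)) : Δ.Distinct := by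
  unfold Ctx.Distinct at *
  rw [List.map_append] at h
  exact h.of_append_right

theorem Typed.inst {Γ Δ E : Ctx G} {v w : Tm S} {A C : Ty G}
    (hv : Typed ((0, A) :: Γ.shift 1) v C) (hw : Typed Δ w A) (p : E.Perm (Δ ++ Γ))
    (hE : E.Distinct) : Typed E (v.inst w) C := by
  have hΓ : Γ.Distinct := (hE.perm p).right
  refine hv.subst (K := fun n => match n with
    | 0 => Δ
    | n + 1 => Γ.filter fun q => q.1 = n) ?_ hE ?_
  · intro q hq
    rcases List.mem_cons.1 hq with rfl | hq
    · exact hw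
    · obtain ⟨r, hr, rfl⟩ := List.mem_map.1 hq
      simp only [hΓ.filter_eq hr]
      exact ⟨.var _ _⟩
  · rw [List.flatMap_cons]
    simp only [Ctx.shift, List.flatMap_map, hΓ.flatMap_filter]
    exact p

theorem Typed.inst₂ {Γ Δ Θ E : Ctx G} {v w u : Tm S} {A B C : Ty G}
    (hv : Typed Γ v A) (hw : Typed Δ w B) (hu : Typed ((0, B) :: (1, A) :: Θ.shift 2) u C)
    (p : E.Perm (Θ ++ Δ ++ Γ)) (hE : E.Distinct) : Typed E (u.inst₂ v w) C := by
  have hΘ : Θ.Distinct := (hE.perm p).left.left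
  refine hu.subst (K := fun n => match n with
    | 0 => Δ
    | 1 => Γ
    | n + 2 => Θ.filter fun q => q.1 = n) ?_ hE ?_
  · intro q hq
    rcases List.mem_cons.1 hq with rfl | hq
    · exact hw
    rcases List.mem_cons.1 hq with rfl | hq
    · exact hv
    · obtain ⟨r, hr, rfl⟩ := List.mem_map.1 hq
      simp only [hΘ.filter_eq hr]
      exact ⟨.var _ _⟩
  · simp only [Ctx.shift, List.flatMap_cons, List.flatMap_map, hΘ.flatMap_filter]
    refine p.trans ?_
    rw [List.append_assoc]
    refine List.perm_append_comm.trans ?_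
    rw [List.append_assoc]

/-- The free variables of a typed term all occur in its context, so the values of a substitution
elsewhere are irrelevant. -/
theorem Typed.subst_congr {Γ : Ctx G} {v : Tm S} {A : Ty G} (h : Typed Γ v A)
    {σ τ : ℕ → Tm S} (hστ : ∀ p ∈ Γ, σ p.1 = τ p.1) : v.subst σ = v.subst τ := by
  obtain ⟨d⟩ := h
  induction d generalizing σ τ with
  | op f d s _ ih =>
    simp only [Tm.subst]
    congr 1
    funext i
    exact ih i fun p hp => hστ p (s.perm.mem_iff.2 (mem_flat i hp))
  | var x A => exact hστ _ (List.mem_singleton.2 rfl)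
  | star => rfl
  | toStar _ _ s _ hd he | ten _ _ s _ hd he | app _ _ s _ hd he =>
    simp only [Tm.subst]
    rw [hd fun p hp => hστ p (s.perm.mem_iff.2 (List.mem_append_left _ hp)),
      he fun p hp => hστ p (s.perm.mem_iff.2 (List.mem_append_right _ hp))]
  | pm _ _ s _ hd he =>
    simp only [Tm.subst]
    rw [hd fun p hp => hστ p (s.perm.mem_iff.2 (List.mem_append_left _ hp)),
      he (σ := up (up σ)) (τ := up (up τ))]
    intro p hp
    rcases List.mem_cons.1 hp with rfl | hp
    · rfl
    rcases List.mem_cons.1 hp with rfl | hp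
    · rfl
    obtain ⟨r, hr, rfl⟩ := List.mem_map.1 hp
    simp only [up, hστ r (s.perm.mem_iff.2 (List.mem_append_right _ hr))]
  | lam _ ih =>
    simp only [Tm.subst]
    rw [ih (σ := up σ) (τ := up τ)]
    intro p hp
    rcases List.mem_cons.1 hp with rfl | hp
    · rfl
    obtain ⟨r, hr, rfl⟩ := List.mem_map.1 hp
    simp only [up, hστ r hr]

/-! ### Equations with label `⊤` -/

variable {V : Type u₃} [CommMonoid V] [CompleteLattice V] [IsQuantale V] {B : Set V}

/-- Every compatibility rule multiplies labels. Idempotence of `⊤` keeps equational reasoning at the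
label `⊤`; it follows from `1 ≤ ⊤` and does not need integrality. -/
theorem top_mul_top : (⊤ : V) * ⊤ = ⊤ := le_antisymm le_top (le_mul_top ⊤)

/-- `Γ ▷ v = w : A` is a theorem with label `⊤`, in both directions. -/
def VTheory.Eqv (T : VTheory S B) (Γ : Ctx G) (v w : Tm S) (A : Ty G) : Prop :=
  T.Thm Γ v ⊤ w A ∧ T.Thm Γ w ⊤ v A

namespace VTheory.Eqv

variable {T : VTheory S B} {Γ Δ E : Ctx G} {v v' w w' u : Tm S} {A A' C : Ty G}

theorem refl (h : Typed Γ v A) : T.Eqv Γ v v A := ⟨.refl h, .refl h⟩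

theorem symm (h : T.Eqv Γ v w A) : T.Eqv Γ w v A := ⟨h.2, h.1⟩

theorem trans (h : T.Eqv Γ v w A) (h' : T.Eqv Γ w u A) : T.Eqv Γ v u A :=
  ⟨top_mul_top (V := V) ▸ h.1.trans h'.1, top_mul_top (V := V) ▸ h'.2.trans h.2⟩

theorem base (h : BaseEq Γ v w A) : T.Eqv Γ v w A := ⟨.base h, .base_symm h⟩

theorem perm (h : T.Eqv Γ v w A) (p : Δ.Perm Γ) : T.Eqv Δ v w A := ⟨h.1.perm p, h.2.perm p⟩

theorem ten (h : T.Eqv Γ v w A) (h' : T.Eqv Δ v' w' A') (s : Shuffle Γ Δ E) (hE : E.Distinct) :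
    T.Eqv E (.ten v v') (.ten w w') (.tensor A A') :=
  ⟨top_mul_top (V := V) ▸ .ten h.1 h'.1 s hE, top_mul_top (V := V) ▸ .ten h.2 h'.2 s hE⟩

theorem pm (h : T.Eqv Γ v w (.tensor A A'))
    (h' : T.Eqv ((0, A') :: (1, A) :: Δ.shift 2) v' w' C) (s : Shuffle Γ Δ E)
    (hE : E.Distinct) : T.Eqv E (.pm v v') (.pm w w') C :=
  ⟨top_mul_top (V := V) ▸ .pm h.1 h'.1 s hE, top_mul_top (V := V) ▸ .pm h.2 h'.2 s hE⟩

theorem toStar (h : T.Eqv Γ v w .unit) (h' : T.Eqv Δ v' w' A) (s : Shuffle Γ Δ E)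
    (hE : E.Distinct) : T.Eqv E (.toStar v v') (.toStar w w') A :=
  ⟨top_mul_top (V := V) ▸ .toStar h.1 h'.1 s hE, top_mul_top (V := V) ▸ .toStar h.2 h'.2 s hE⟩

theorem app (h : T.Eqv Γ v w (.lolli A C)) (h' : T.Eqv Δ v' w' A) (s : Shuffle Γ Δ E)
    (hE : E.Distinct) : T.Eqv E (.app v v') (.app w w') C :=
  ⟨top_mul_top (V := V) ▸ .app h.1 h'.1 s hE, top_mul_top (V := V) ▸ .app h.2 h'.2 s hE⟩

theorem lam (h : T.Eqv ((0, A) :: Γ.shift 1) v w C) :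
    T.Eqv Γ (.lam A v) (.lam A w) (.lolli A C) := ⟨.lam h.1, .lam h.2⟩

/-- Two terms that agree after `x ⊗ y` is substituted for `z` are equal. -/
theorem ext {z : ℕ} (hv : Typed ((z, .tensor A A') :: Γ) v C)
    (hw : Typed ((z, .tensor A A') :: Γ) w C)
    (h : T.Eqv ((0, A') :: (1, A) :: Γ.shift 2) (v.replaceUnder 2 z (.ten (.var 1) (.var 0)))
      (w.replaceUnder 2 z (.ten (.var 1) (.var 0))) C) :
    T.Eqv ((z, .tensor A A') :: Γ) v w C := by
  have hE : Ctx.Distinct ((z, .tensor A A') :: Γ) := hv.elim Der.distinct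
  obtain ⟨s⟩ := Shuffle.nil_left Γ
  -- The η-rule is applied with the variable `z` itself as the matched term: its right side is then
  -- `u[z/z]`, which is `u`. Compatibility with `pm` transports the assumed equation between the two
  -- expansions.
  have key : ∀ {u : Tm S}, Typed ((z, .tensor A A') :: Γ) u C →
      T.Eqv ((z, .tensor A A') :: Γ)
        (.pm (.var z) (u.replaceUnder 2 z (.ten (.var 1) (.var 0)))) u C := by
    intro u hu
    have := Eqv.base (T := T) (.pm_eta ⟨.var z (.tensor A A')⟩ hu
      (List.perm_append_comm (l₁ := [(z, .tensor A A')]) (l₂ := Γ)) hE)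
    rwa [Tm.replace, Tm.subst_congr u (τ := fun n => .var n), Tm.subst_var] at this
    intro n
    by_cases h : n = z <;> simp [h]
  exact (key hv).symm.trans ((Eqv.pm (.refl ⟨.var z _⟩) h (.left _ s) hE).trans (key hw))

/-- Two terms that agree after `∗` is substituted for `z` are equal. -/
theorem ext_unit {z : ℕ} (hv : Typed ((z, .unit) :: Γ) v C) (hw : Typed ((z, .unit) :: Γ) w C)
    (h : T.Eqv Γ (v.replace z .star) (w.replace z .star) C) :
    T.Eqv ((z, .unit) :: Γ) v w C := by
  have hE : Ctx.Distinct ((z, .unit) :: Γ) := hv.elim Der.distinct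
  obtain ⟨s⟩ := Shuffle.nil_left Γ
  have key : ∀ {u : Tm S}, Typed ((z, .unit) :: Γ) u C →
      T.Eqv ((z, .unit) :: Γ) (.toStar (.var z) (u.replace z .star)) u C := by
    intro u hu
    have := Eqv.base (T := T) (.toStar_eta ⟨.var z .unit⟩ hu
      (List.perm_append_comm (l₁ := [(z, .unit)]) (l₂ := Γ)) hE)
    rwa [show u.replace z (.var z) = u.subst fun n => if n = z then .var z else .var n from rfl,
      Tm.subst_congr u (τ := fun n => .var n), Tm.subst_var] at this
    intro n
    by_cases h : n = z <;> simp [h]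
  exact (key hv).symm.trans ((Eqv.toStar (.refl ⟨.var z _⟩) h (.left _ s) hE).trans (key hw))

end VTheory.Eqv

/-! ### Untyped reduction -/

/-- The reduction relation of raw terms that is generated by the `β`-rules. -/
inductive Red : Tm S → Tm S → Prop
  | refl (v : Tm S) : Red v v
  | trans {v w u : Tm S} : Red v w → Red w u → Red v u
  | pm_ten (v w u : Tm S) : Red (.pm (.ten v w) u) (u.inst₂ v w)
  | toStar_star (v : Tm S) : Red (.toStar .star v) v
  | lam_app (A : Ty G) (v w : Tm S) : Red (.app (.lam A v) w) (v.inst w)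
  | ten {v v' w w' : Tm S} : Red v v' → Red w w' → Red (.ten v w) (.ten v' w')
  | pm {v v' w w' : Tm S} : Red v v' → Red w w' → Red (.pm v w) (.pm v' w')
  | toStar {v v' w w' : Tm S} : Red v v' → Red w w' → Red (.toStar v w) (.toStar v' w')
  | app {v v' w w' : Tm S} : Red v v' → Red w w' → Red (.app v w) (.app v' w')
  | lam {A : Ty G} {v v' : Tm S} : Red v v' → Red (.lam A v) (.lam A v')

/-- Preservation of typing and soundness are proved together, because in a chain of reductions the
intermediate term must be typed before the next equation can be stated. In each β-case, inverting
the derivation of the redex yields exactly the premises of the corresponding equation. -/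
theorem Red.typed_eqv (T : VTheory S B) {v w : Tm S} (h : Red v w) :
    ∀ {E : Ctx G} {A : Ty G}, Typed E v A → Typed E w A ∧ T.Eqv E v w A := by
  induction h with
  | refl v => exact fun h => ⟨h, .refl h⟩
  | trans _ _ ih ih' =>
    intro E A h
    obtain ⟨h₁, e₁⟩ := ih h
    obtain ⟨h₂, e₂⟩ := ih' h₁
    exact ⟨h₂, e₁.trans e₂⟩
  | pm_ten v w u =>
    rintro E A ⟨d⟩
    rcases d with _ | _ | _ | _ | _ | ⟨d, e, s, hE⟩ | _ | _
    rename_i Γ Δ _ _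
    rcases d with _ | _ | _ | _ | ⟨d, d', s', hE'⟩ | _ | _ | _
    have p := s.perm.trans (s'.perm.append_right _)
    -- The two shuffles give the order first component, second component, body; the β-equation lists
    -- these contexts in reverse.
    have q := p.trans (List.perm_append_comm.trans (List.perm_append_comm.append_left _))
    rw [← List.append_assoc] at q
    exact ⟨Typed.inst₂ ⟨d⟩ ⟨d'⟩ ⟨e⟩ q hE, .base (.pm_ten ⟨d⟩ ⟨d'⟩ ⟨e⟩ q hE)⟩
  | toStar_star v =>
    rintro E A ⟨d⟩
    rcases d with _ | _ | _ | ⟨d, e, s, hE⟩ | _ | _ | _ | _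
    rcases d with _ | _ | _ | _ | _ | _ | _ | _
    have h : Typed E v A := Typed.exch ⟨e⟩ s.perm.symm
    exact ⟨h, .base (.star_toStar h)⟩
  | lam_app A v w =>
    rintro E A ⟨d⟩
    rcases d with _ | _ | _ | _ | _ | _ | _ | ⟨d, e, s, hE⟩
    rcases d with _ | _ | _ | _ | _ | _ | d | _
    have q := s.perm.trans List.perm_append_comm
    exact ⟨Typed.inst ⟨d⟩ ⟨e⟩ q hE, .base (.lam_beta ⟨d⟩ ⟨e⟩ q hE)⟩
  | ten _ _ ih ih' =>
    rintro E A ⟨d⟩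
    rcases d with _ | _ | _ | _ | ⟨d, e, s, hE⟩ | _ | _ | _
    obtain ⟨⟨d₁⟩, h₁⟩ := ih ⟨d⟩
    obtain ⟨⟨d₂⟩, h₂⟩ := ih' ⟨e⟩
    exact ⟨⟨.ten d₁ d₂ s hE⟩, h₁.ten h₂ s hE⟩
  | pm _ _ ih ih' =>
    rintro E A ⟨d⟩
    rcases d with _ | _ | _ | _ | _ | ⟨d, e, s, hE⟩ | _ | _
    obtain ⟨⟨d₁⟩, h₁⟩ := ih ⟨d⟩
    obtain ⟨⟨d₂⟩, h₂⟩ := ih' ⟨e⟩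
    exact ⟨⟨.pm d₁ d₂ s hE⟩, h₁.pm h₂ s hE⟩
  | toStar _ _ ih ih' =>
    rintro E A ⟨d⟩
    rcases d with _ | _ | _ | ⟨d, e, s, hE⟩ | _ | _ | _ | _
    obtain ⟨⟨d₁⟩, h₁⟩ := ih ⟨d⟩
    obtain ⟨⟨d₂⟩, h₂⟩ := ih' ⟨e⟩
    exact ⟨⟨.toStar d₁ d₂ s hE⟩, h₁.toStar h₂ s hE⟩
  | app _ _ ih ih' =>
    rintro E A ⟨d⟩
    rcases d with _ | _ | _ | _ | _ | _ | _ | ⟨d, e, s, hE⟩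
    obtain ⟨⟨d₁⟩, h₁⟩ := ih ⟨d⟩
    obtain ⟨⟨d₂⟩, h₂⟩ := ih' ⟨e⟩
    exact ⟨⟨.app d₁ d₂ s hE⟩, h₁.app h₂ s hE⟩
  | lam _ ih =>
    rintro E A ⟨d⟩
    rcases d with _ | _ | _ | _ | _ | _ | d | _
    obtain ⟨⟨d₁⟩, h₁⟩ := ih ⟨d⟩
    exact ⟨⟨.lam d₁⟩, h₁.lam⟩

/-- Typed terms with a common reduct are equal. -/
theorem Red.eqv (T : VTheory S B) {v v' w : Tm S} {E : Ctx G} {A : Ty G} (h : Red v w)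
    (h' : Red v' w) (hv : Typed E v A) (hv' : Typed E v' A) : T.Eqv E v v' A :=
  (h.typed_eqv T hv).2.trans (h'.typed_eqv T hv').2.symm

end Syntactic

end VLambda

/-! ### The laws of an autonomous category, verified on terms -/

namespace VLambda

section SyntacticLaws

set_option linter.unusedSectionVars false
set_option linter.unusedSimpArgs false

variable {G : Type u₁} {S : Signature.{u₁, u₂} G}
variable {V : Type u₃} [CommMonoid V] [CompleteLattice V] [IsQuantale V] {B : Set V}

/-- This supplies the typing of the split terms, so that variables can be split repeatedly without
writing derivations. The variable `z` contributes the two new variables, and every other variable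
contributes itself moved up by two. -/
theorem Typed.replaceUnder_pair {Γ : Ctx G} {u : Tm S} {z : ℕ} {A A' C : Ty G}
    (hu : Typed ((z, .tensor A A') :: Γ) u C) :
    Typed ((0, A') :: (1, A) :: Γ.shift 2) (u.replaceUnder 2 z (.ten (.var 1) (.var 0))) C := by
  have hE : Ctx.Distinct ((z, .tensor A A') :: Γ) := hu.elim Der.distinct
  have hE' := List.nodup_cons.1 (show (z :: Γ.map Prod.fst).Nodup from hE)
  have hΓ : Γ.Distinct := hE'.2
  have hne : ∀ p ∈ Γ, p.1 ≠ z := fun p hp h => hE'.1 (List.mem_map.2 ⟨p, hp, h⟩)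
  have hK : ∀ p ∈ Γ, (if p.1 = z then [(0, A'), (1, A)] else
      Ctx.shift 2 (Γ.filter fun q => q.1 = p.1)) = [(p.1 + 2, p.2)] := by
    intro p hp
    rw [if_neg (hne p hp), hΓ.filter_eq hp]
    rfl
  refine hu.subst (K := fun n => if n = z then [(0, A'), (1, A)] else
    Ctx.shift 2 (Γ.filter fun q => q.1 = n)) ?_ (cons₂_distinct hΓ) ?_
  · intro q hq
    rcases List.mem_cons.1 hq with rfl | hq
    · simp only [if_true]
      exact ⟨.ten (.var 1 _) (.var 0 _) (.right _ (.left _ .nil)) (by simp [Ctx.Distinct])⟩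
    · simp only [hK q hq, if_neg (hne q hq)]
      exact ⟨.var _ _⟩
  · rw [List.flatMap_cons, List.flatMap_congr hK]
    simp [Ctx.shift]
    rw [← List.map_eq_flatMap]

theorem Typed.replace_star {Γ : Ctx G} {u : Tm S} {z : ℕ} {C : Ty G}
    (hu : Typed ((z, .unit) :: Γ) u C) : Typed Γ (u.replace z .star) C := by
  have hE : Ctx.Distinct ((z, .unit) :: Γ) := hu.elim Der.distinct
  have hE' := List.nodup_cons.1 (show (z :: Γ.map Prod.fst).Nodup from hE)
  have hΓ : Γ.Distinct := hE'.2
  have hne : ∀ p ∈ Γ, p.1 ≠ z := fun p hp h => hE'.1 (List.mem_map.2 ⟨p, hp, h⟩)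
  have hK : ∀ p ∈ Γ, (if p.1 = z then [] else Γ.filter fun q => q.1 = p.1) = [p] := by
    intro p hp
    rw [if_neg (hne p hp), hΓ.filter_eq hp]
  refine hu.subst (K := fun n => if n = z then [] else Γ.filter fun q => q.1 = n) ?_ hΓ ?_
  · intro q hq
    rcases List.mem_cons.1 hq with rfl | hq
    · simp only [if_true]
      exact ⟨.star⟩
    · simp only [hK q hq, if_neg (hne q hq)]
      exact ⟨.var _ _⟩
  · rw [List.flatMap_cons, List.flatMap_congr hK, List.flatMap_singleton']
    simp

namespace VTheory.Eqv

variable {T : VTheory S B} {Γ E : Ctx G} {v w : Tm S} {A A' C : Ty G}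

/-- Two terms that agree after `x ⊗ y` is substituted for `z` are equal. -/
theorem ext_perm (z : ℕ) (A A' : Ty G) (Γ : Ctx G) (hv : Typed E v C) (hw : Typed E w C)
    (p : E.Perm ((z, .tensor A A') :: Γ))
    (h : Typed ((0, A') :: (1, A) :: Γ.shift 2) (v.replaceUnder 2 z (.ten (.var 1) (.var 0))) C →
      Typed ((0, A') :: (1, A) :: Γ.shift 2) (w.replaceUnder 2 z (.ten (.var 1) (.var 0))) C →
      T.Eqv ((0, A') :: (1, A) :: Γ.shift 2) (v.replaceUnder 2 z (.ten (.var 1) (.var 0)))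
        (w.replaceUnder 2 z (.ten (.var 1) (.var 0))) C) :
    T.Eqv E v w C :=
  (ext (hv.exch p) (hw.exch p)
    (h (hv.exch p).replaceUnder_pair (hw.exch p).replaceUnder_pair)).perm p

/-- Two terms that agree after `∗` is substituted for `z` are equal. -/
theorem ext_unit_perm (z : ℕ) (Γ : Ctx G) (hv : Typed E v C) (hw : Typed E w C)
    (p : E.Perm ((z, .unit) :: Γ))
    (h : Typed Γ (v.replace z .star) C → Typed Γ (w.replace z .star) C →
      T.Eqv Γ (v.replace z .star) (w.replace z .star) C) :
    T.Eqv E v w C :=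
  (ext_unit (hv.exch p) (hw.exch p)
    (h (hv.exch p).replace_star (hw.exch p).replace_star)).perm p

end VTheory.Eqv

theorem Red.eqv_of_eq (T : VTheory S B) {v v' w w' : Tm S} {E : Ctx G} {A : Ty G} (h : Red v w)
    (h' : Red v' w') (e : w = w') (hv : Typed E v A) (hv' : Typed E v' A) : T.Eqv E v v' A :=
  h.eqv T (e ▸ h') hv hv'

/-! ### Complete developments -/

/-- The reduct of `pm v to x ⊗ y. w`. -/
def Tm.pmDev : Tm S → Tm S → Tm S
  | .ten v v', w => w.inst₂ v v'
  | v, w => .pm v w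

/-- The reduct of `v to ∗. w`. -/
def Tm.toStarDev : Tm S → Tm S → Tm S
  | .star, w => w
  | v, w => .toStar v w

/-- The reduct of `v w`. -/
def Tm.appDev : Tm S → Tm S → Tm S
  | .lam _ v, w => v.inst w
  | v, w => .app v w

/-- The term in which all redexes are contracted, from the inside to the outside. -/
def Tm.dev : Tm S → Tm S
  | .var n => .var n
  | .op f v => .op f v
  | .star => .star
  | .toStar v w => v.dev.toStarDev w.dev
  | .ten v w => .ten v.dev w.dev
  | .pm v w => v.dev.pmDev w.dev
  | .lam A v => .lam A v.dev
  | .app v w => v.dev.appDev w.dev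

theorem Red.pmDev (v w : Tm S) : Red (.pm v w) (v.pmDev w) := by
  cases v <;> first | exact .refl _ | exact .pm_ten _ _ _

theorem Red.toStarDev (v w : Tm S) : Red (.toStar v w) (v.toStarDev w) := by
  cases v <;> first | exact .refl _ | exact .toStar_star _

theorem Red.appDev (v w : Tm S) : Red (.app v w) (v.appDev w) := by
  cases v <;> first | exact .refl _ | exact .lam_app _ _ _

theorem Red.dev (v : Tm S) : Red v v.dev := by
  induction v with
  -- Arguments of operation symbols are left alone, since the structural terms to be compared
  -- contain none.
  | var | op | star => exact .refl _
  | toStar v w hv hw => exact (hv.toStar hw).trans (.toStarDev _ _)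
  | ten v w hv hw => exact hv.ten hw
  | pm v w hv hw => exact (hv.pm hw).trans (.pmDev _ _)
  | lam A v hv => exact hv.lam
  | app v w hv hw => exact (hv.app hw).trans (.appDev _ _)

/-- One development need not give a normal form, as the substitutions it performs can create
redexes. Five rounds suffice for all the structural terms compared below. -/
theorem VTheory.Eqv.of_dev (T : VTheory S B) {v v' : Tm S} {E : Ctx G} {A : Ty G}
    (hv : Typed E v A) (hv' : Typed E v' A) (h : v.dev.dev.dev.dev.dev = v'.dev.dev.dev.dev.dev) :
    T.Eqv E v v' A :=
  Red.eqv_of_eq T (((((Red.dev v).trans (.dev _)).trans (.dev _)).trans (.dev _)).trans (.dev _))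
    (((((Red.dev v').trans (.dev _)).trans (.dev _)).trans (.dev _)).trans (.dev _)) h hv hv'

/-! ### The laws of the syntactic category -/

/-- The term `v[t/x]`. -/
def Val.at {A A' : Ty G} (v : Val S A A') (t : Tm S) : Tm S := v.1.subst fun _ => t

/-- An unspecified term blocks the computation of substitutions. As `0` is its only free variable,
it can be written as `v.at (.var 0)`, after which `Val.at_subst` and `Val.at_rename` push every
substitution and renaming into the inserted term. -/
theorem Val.eq_at {A A' : Ty G} (v : Val S A A') : v.1 = v.at (.var 0) := by
  rw [Val.at, ← v.2.subst_congr (σ := fun n => .var n), Tm.subst_var]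
  rintro p hp
  obtain rfl := List.mem_singleton.1 hp
  rfl

theorem Val.at_subst {A A' : Ty G} (v : Val S A A') (t : Tm S) (σ : ℕ → Tm S) :
    (v.at t).subst σ = v.at (t.subst σ) := by
  rw [Val.at, Tm.subst_subst, Val.at]

theorem Val.at_rename {A A' : Ty G} (v : Val S A A') (t : Tm S) (ρ : ℕ → ℕ) :
    (v.at t).rename ρ = v.at (t.rename ρ) := by
  rw [Val.at, Tm.subst_rename, Val.at]

/-- `Red` provides no reduction inside a term that has been substituted into an unspecified `f`. The
substitution rule for theorems, applied to reflexivity of `f`, takes its place. -/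
theorem VTheory.Eqv.at {T : VTheory S B} {Δ : Ctx G} {v w : Tm S} {A C : Ty G} (f : Val S A C)
    (hΔ : Δ.Distinct) (h : T.Eqv Δ v w A) : T.Eqv Δ (f.at v) (f.at w) C := by
  have hΔ' : Ctx.Distinct (Δ ++ []) := by simpa using hΔ
  have h₁ := VTheory.Thm.subst (VTheory.Thm.refl f.2) h.1 hΔ'
  have h₂ := VTheory.Thm.subst (VTheory.Thm.refl f.2) h.2 hΔ'
  have e : ∀ t : Tm S, f.1.replace 0 t = f.at t := by
    intro t
    rw [f.eq_at, Tm.replace, f.at_subst]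
    rfl
  rw [top_mul_top, List.append_nil, e, e] at h₁ h₂
  exact ⟨h₁, h₂⟩

/-- A theorem with label `⊤` makes the distance at least `⊤`, hence at least the unit; both
directions together are the identification in the separated quotient. -/
theorem Syn.sound {T : VTheory S B} {A A' : Ty G} {v w : Val S A A'}
    (h : T.Eqv [(0, A)] v.1 w.1 A') : (Syn.mk v : (Syn.of A : Syn T) ⟶ Syn.of A') = Syn.mk w :=
  Quotient.sound ⟨le_top.trans (le_sSup h.1), le_top.trans (le_sSup h.2)⟩


namespace Syn

attribute [local simp] Tm.replace Tm.replaceUnder Tm.subst up Tm.shift Tm.rename Tm.dev Tm.pmDev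
  Tm.toStarDev Tm.inst Tm.inst₂ Val.comp Val.tensor Val.id Val.assocHom Val.assocInv Val.leftHom
  Val.leftInv Val.rightHom Val.rightInv Val.braid Val.at_subst Val.at_rename

variable (T : VTheory S B)

theorem mk_ext {A A' C : Ty G} {v w : Val S (.tensor A A') C}
    (h : Typed [(0, A'), (1, A)] (v.1.replaceUnder 2 0 (.ten (.var 1) (.var 0))) C →
      Typed [(0, A'), (1, A)] (w.1.replaceUnder 2 0 (.ten (.var 1) (.var 0))) C →
      T.Eqv [(0, A'), (1, A)] (v.1.replaceUnder 2 0 (.ten (.var 1) (.var 0)))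
        (w.1.replaceUnder 2 0 (.ten (.var 1) (.var 0))) C) :
    (Syn.mk v : (Syn.of _ : Syn T) ⟶ Syn.of C) = Syn.mk w :=
  Syn.sound (.ext_perm 0 A A' [] v.2 w.2 (.refl _) h)

theorem mk_dev {A C : Ty G} {v w : Val S A C} (h : v.1.dev.dev.dev.dev.dev = w.1.dev.dev.dev.dev.dev) :
    (Syn.mk v : (Syn.of _ : Syn T) ⟶ Syn.of C) = Syn.mk w :=
  Syn.sound (.of_dev T v.2 w.2 h)


/-- In the laws that involve arbitrary terms, `Tm.dev` would get stuck on or enter these terms. The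
reductions are therefore spelled out, and only the comparison of the reducts is left to computation.
-/
theorem mk_tensor_comp {X Y Z X' Y' Z' : Ty G} (f : Val S X Y) (f' : Val S X' Y')
    (g : Val S Y Z) (g' : Val S Y' Z') :
    (Syn.mk ((f.tensor f').comp (g.tensor g')) : (Syn.of _ : Syn T) ⟶ Syn.of _) =
      Syn.mk ((f.comp g).tensor (f'.comp g')) := by
  refine mk_ext T fun h h' => ?_
  refine Red.eqv_of_eq T (.trans (.pm (.pm_ten _ _ _) (.refl _)) (.pm_ten _ _ _))
    (.pm_ten _ _ _) ?_ h h'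
  simp [f.eq_at, g.eq_at, f'.eq_at, g'.eq_at]

theorem mk_assoc_naturality {X Y Z X' Y' Z' : Ty G} (f : Val S X X') (g : Val S Y Y')
    (h : Val S Z Z') :
    (Syn.mk (((f.tensor g).tensor h).comp (Val.assocHom S X' Y' Z')) :
      (Syn.of _ : Syn T) ⟶ Syn.of _) =
      Syn.mk ((Val.assocHom S X Y Z).comp (f.tensor (g.tensor h))) := by
  refine mk_ext T fun h₁ h₂ => ?_
  refine .ext_perm 1 X Y [(0, Z)] h₁ h₂ (.swap _ _ _) fun h₁ h₂ => ?_
  refine Red.eqv_of_eq T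
    (.trans (.pm (.trans (.pm_ten _ _ _) (.ten (.pm_ten _ _ _) (.refl _))) (.refl _))
      (.trans (.pm_ten _ _ _) (.pm_ten _ _ _)))
    (.trans (.pm (.trans (.pm_ten _ _ _) (.pm_ten _ _ _)) (.refl _))
      (.trans (.pm_ten _ _ _) (.ten (.refl _) (.pm_ten _ _ _)))) ?_ h₁ h₂
  simp [f.eq_at, g.eq_at, h.eq_at]

theorem mk_left_naturality {X Y : Ty G} (f : Val S X Y) :
    (Syn.mk (((Val.id S .unit).tensor f).comp (Val.leftHom S Y)) :
      (Syn.of _ : Syn T) ⟶ Syn.of _) = Syn.mk ((Val.leftHom S X).comp f) := by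
  refine mk_ext T fun h h' => ?_
  refine .ext_unit_perm 1 [(0, X)] h h' (.swap _ _ _) fun h h' => ?_
  -- Only the left side is handled by outermost reductions. On the right the redexes sit inside the
  -- term substituted into `f`, whence the use of `VTheory.Eqv.at`.
  refine .trans (w := f.at (.var 0)) ?_ (.symm ?_)
  · refine ((?_ : Red _ _).typed_eqv T h).2
    refine .trans (.pm (.pm_ten _ _ _) (.refl _)) (.trans (.pm_ten _ _ _) ?_)
    convert Red.toStar_star _ using 1
    simp [f.eq_at]
  · have e : (Tm.replaceUnder 2 ((Val.leftHom S X).comp f).1 0 (.ten (.var 1) (.var 0))).replace 1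
        .star = f.at (.pm (.ten .star (.var 0)) (.toStar (.var 1) (.var 0))) := by
      simp [f.eq_at]
    rw [e]
    exact .at f (by simp [Ctx.Distinct]) (.of_dev T ⟨.pm (.ten .star (.var 0 _) (.right _ .nil)
        (by simp [Ctx.Distinct])) (.toStar (.var 1 _) (.var 0 _) (.right _ (.left _ .nil))
          (by simp [Ctx.Distinct, Ctx.shift])) (Δ := []) (.left _ .nil)
            (by simp [Ctx.Distinct])⟩ ⟨.var 0 X⟩ rfl)

theorem mk_right_naturality {X Y : Ty G} (f : Val S X Y) :
    (Syn.mk ((f.tensor (Val.id S .unit)).comp (Val.rightHom S Y)) :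
      (Syn.of _ : Syn T) ⟶ Syn.of _) = Syn.mk ((Val.rightHom S X).comp f) := by
  refine mk_ext T fun h h' => ?_
  refine .ext_unit_perm 0 [(1, X)] h h' (.refl _) fun h h' => ?_
  refine .trans (w := f.at (.var 1)) ?_ (.symm ?_)
  · refine ((?_ : Red _ _).typed_eqv T h).2
    refine .trans (.pm (.pm_ten _ _ _) (.refl _)) (.trans (.pm_ten _ _ _) ?_)
    convert Red.toStar_star _ using 1
    simp [f.eq_at]
  · have e : (Tm.replaceUnder 2 ((Val.rightHom S X).comp f).1 0 (.ten (.var 1) (.var 0))).replace 0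
        .star = f.at (.pm (.ten (.var 1) .star) (.toStar (.var 0) (.var 1))) := by
      simp [f.eq_at]
    rw [e]
    exact .at f (by simp [Ctx.Distinct]) (.of_dev T ⟨.pm (.ten (.var 1 _) .star (.left _ .nil)
        (by simp [Ctx.Distinct])) (.toStar (.var 0 _) (.var 1 _) (.left _ (.right _ .nil))
          (by simp [Ctx.Distinct, Ctx.shift])) (Δ := []) (.left _ .nil)
            (by simp [Ctx.Distinct])⟩ ⟨.var 1 X⟩ rfl)

theorem mk_braid_naturality {X Y X' Y' : Ty G} (f : Val S X X') (g : Val S Y Y') :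
    (Syn.mk ((f.tensor g).comp (Val.braid S X' Y')) : (Syn.of _ : Syn T) ⟶ Syn.of _) =
      Syn.mk ((Val.braid S X Y).comp (g.tensor f)) := by
  refine mk_ext T fun h h' => ?_
  refine Red.eqv_of_eq T
    (.trans (.pm (.pm_ten _ _ _) (.refl _)) (.pm_ten _ _ _))
    (.trans (.pm (.pm_ten _ _ _) (.refl _)) (.pm_ten _ _ _)) ?_ h h'
  simp [f.eq_at, g.eq_at]

theorem mk_curry_app {X Y Z : Ty G} (f : Val S (.tensor X Y) Z) :
    (Syn.mk ((f.curry.tensor (Val.id S Y)).comp (Val.app S Y Z)) :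
      (Syn.of _ : Syn T) ⟶ Syn.of _) = Syn.mk f := by
  refine mk_ext T fun h h' => ?_
  refine Red.eqv_of_eq T
    (.trans (.pm (.pm_ten _ _ _) (.refl _)) (.trans (.pm_ten _ _ _) (.lam_app _ _ _)))
    (.refl _) ?_ h h'
  simp [f.eq_at]

/-- Under the abstraction, both pattern matches act on explicit pairs. Contracting them leaves `λ y.
g y`, the left side of the η-rule for functions. -/
theorem mk_curry_unique {X Y Z : Ty G} (g : Val S X (.lolli Y Z)) :
    (Syn.mk ((g.tensor (Val.id S Y)).comp (Val.app S Y Z)).curry :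
      (Syn.of _ : Syn T) ⟶ Syn.of _) = Syn.mk g := by
  refine Syn.sound (.trans (w := .lam Y (.app (g.1.shift 1) (.var 0))) ?_ (.base (.lam_eta g.2)))
  have h := ((g.tensor (Val.id S Y)).comp (Val.app S Y Z)).curry.2
  refine ((?_ : Red _ _).typed_eqv T h).2
  have e : .app (g.1.shift 1) (.var 0) = (.app (.var 1) (.var 0) : Tm S).inst₂ (g.at (.var 1))
      (.var 0) := by
    simp [g.eq_at]
  rw [e]
  refine .lam (.trans (.pm (.pm_ten _ _ _) (.refl _)) ?_)
  convert Red.pm_ten (g.at (.var 1)) (.var 0) (.app (.var 1) (.var 0)) using 2 <;>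
    simp [g.eq_at, Val.app]

/-- This law and the following ones involve only structural terms. After every relevant variable of
tensor or unit type has been split, both sides develop to the same term. -/
theorem mk_id_tensor_id (X Y : Ty G) :
    (Syn.mk ((Val.id S X).tensor (Val.id S Y)) :
      (Syn.of _ : Syn T) ⟶ Syn.of _) =
      Syn.mk (Val.id S (.tensor X Y)) := by
  refine mk_ext T fun h h' => ?_
  exact .of_dev T h h' (by simp)

theorem mk_assoc_hom_inv (X Y Z : Ty G) :
    (Syn.mk ((Val.assocHom S X Y Z).comp (Val.assocInv S X Y Z)) :
      (Syn.of _ : Syn T) ⟶ Syn.of _) =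
      Syn.mk (Val.id S (_ : Ty G)) := by
  refine mk_ext T fun h h' => ?_
  refine .ext_perm 1 X Y [(0, Z)] h h' (.swap _ _ _) fun h h' => ?_
  exact .of_dev T h h' (by simp)

theorem mk_assoc_inv_hom (X Y Z : Ty G) :
    (Syn.mk ((Val.assocInv S X Y Z).comp (Val.assocHom S X Y Z)) :
      (Syn.of _ : Syn T) ⟶ Syn.of _) =
      Syn.mk (Val.id S (_ : Ty G)) := by
  refine mk_ext T fun h h' => ?_
  refine .ext_perm 0 Y Z [(1, X)] h h' (.refl _) fun h h' => ?_
  exact .of_dev T h h' (by simp)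

theorem mk_left_hom_inv (X : Ty G) :
    (Syn.mk ((Val.leftHom S X).comp (Val.leftInv S X)) :
      (Syn.of _ : Syn T) ⟶ Syn.of _) =
      Syn.mk (Val.id S (_ : Ty G)) := by
  refine mk_ext T fun h h' => ?_
  refine .ext_unit_perm 1 [(0, X)] h h' (.swap _ _ _) fun h h' => ?_
  exact .of_dev T h h' (by simp)

theorem mk_right_hom_inv (X : Ty G) :
    (Syn.mk ((Val.rightHom S X).comp (Val.rightInv S X)) :
      (Syn.of _ : Syn T) ⟶ Syn.of _) =
      Syn.mk (Val.id S (_ : Ty G)) := by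
  refine mk_ext T fun h h' => ?_
  refine .ext_unit_perm 0 [(1, X)] h h' (.refl _) fun h h' => ?_
  exact .of_dev T h h' (by simp)

theorem mk_pentagon (W X Y Z : Ty G) :
    (Syn.mk (((Val.assocHom S W X Y).tensor (Val.id S Z)).comp ((Val.assocHom S W (.tensor X Y) Z).comp ((Val.id S W).tensor (Val.assocHom S X Y Z)))) :
      (Syn.of _ : Syn T) ⟶ Syn.of _) =
      Syn.mk ((Val.assocHom S (.tensor W X) Y Z).comp (Val.assocHom S W X (.tensor Y Z))) := by
  refine mk_ext T fun h h' => ?_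
  -- Splitting names the left component `1`, the right one `0`, and moves older variables up by two.
  -- The nested left factor is therefore called `1` again in the next split.
  refine .ext_perm 1 (.tensor W X) Y [(0, Z)] h h' (.swap _ _ _) fun h h' => ?_
  refine .ext_perm 1 W X _ h h' (.swap _ _ _) fun h h' => ?_
  exact .of_dev T h h' (by simp)

theorem mk_triangle (X Y : Ty G) :
    (Syn.mk ((Val.assocHom S X .unit Y).comp ((Val.id S X).tensor (Val.leftHom S Y))) :
      (Syn.of _ : Syn T) ⟶ Syn.of _) =
      Syn.mk ((Val.rightHom S X).tensor (Val.id S Y)) := by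
  refine mk_ext T fun h h' => ?_
  refine .ext_perm 1 X .unit [(0, Y)] h h' (.swap _ _ _) fun h h' => ?_
  refine .ext_unit_perm 0 _ h h' (.refl _) fun h h' => ?_
  exact .of_dev T h h' (by simp)

theorem mk_braid_braid (X Y : Ty G) :
    (Syn.mk ((Val.braid S X Y).comp (Val.braid S Y X)) :
      (Syn.of _ : Syn T) ⟶ Syn.of _) =
      Syn.mk (Val.id S (_ : Ty G)) := by
  refine mk_ext T fun h h' => ?_
  exact .of_dev T h h' (by simp)

theorem mk_hexagon (X Y Z : Ty G) :
    (Syn.mk ((Val.assocHom S X Y Z).comp ((Val.braid S X (.tensor Y Z)).comp (Val.assocHom S Y Z X))) :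
      (Syn.of _ : Syn T) ⟶ Syn.of _) =
      Syn.mk (((Val.braid S X Y).tensor (Val.id S Z)).comp ((Val.assocHom S Y X Z).comp ((Val.id S Y).tensor (Val.braid S X Z)))) := by
  refine mk_ext T fun h h' => ?_
  refine .ext_perm 1 X Y [(0, Z)] h h' (.swap _ _ _) fun h h' => ?_
  exact .of_dev T h h' (by simp)

/-- The laws of an autonomous category hold in the syntactic category. -/
theorem isAutonomous : (Syn.autonomousData T).IsAutonomous where
  id_tensor_id := mk_id_tensor_id T
  tensor_comp := by
    rintro X Y Z X' Y' Z' ⟨f⟩ ⟨f'⟩ ⟨g⟩ ⟨g'⟩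
    exact mk_tensor_comp T f f' g g'
  assoc_hom_inv := mk_assoc_hom_inv T
  assoc_inv_hom := mk_assoc_inv_hom T
  left_hom_inv := mk_left_hom_inv T
  left_inv_hom X := mk_dev T (v := (Val.leftInv S X).comp (Val.leftHom S X)) (w := Val.id S X) (by simp)
  right_hom_inv := mk_right_hom_inv T
  right_inv_hom X :=
    mk_dev T (v := (Val.rightInv S X).comp (Val.rightHom S X)) (w := Val.id S X) (by simp)
  assoc_naturality := by
    rintro X Y Z X' Y' Z' ⟨f⟩ ⟨g⟩ ⟨h⟩
    exact mk_assoc_naturality T f g h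
  left_naturality := by
    rintro X Y ⟨f⟩
    exact mk_left_naturality T f
  right_naturality := by
    rintro X Y ⟨f⟩
    exact mk_right_naturality T f
  pentagon := mk_pentagon T
  triangle := mk_triangle T
  braid_naturality := by
    rintro X Y X' Y' ⟨f⟩ ⟨g⟩
    exact mk_braid_naturality T f g
  braid_braid := mk_braid_braid T
  hexagon := mk_hexagon T
  curry_app := by
    rintro X Y Z ⟨f⟩
    exact mk_curry_app T f
  curry_unique := by
    rintro X Y Z ⟨g⟩
    exact mk_curry_unique T g

end Syn

end SyntacticLaws

end VLambda

/-! ### Transposition in closed categories and the enrichment of the syntactic category -/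

namespace VLambda

section Autonomous

variable {C : Type u₄} [Category.{v₄} C] [MonoidalCategory C] [SymmetricCategory C]
  [MonoidalClosed C]

/-- The universal property of application. With it, later calculations with transposes need not
unfold `lolliAdjunction`. -/
theorem curryHom_eq_iff {X Y Z : C} (f : X ⊗ Y ⟶ Z) (g : X ⟶ (ihom Y).obj Z) :
    curryHom f = g ↔ f = g ▷ Y ≫ appHom Y Z := by
  rw [curryHom, Adjunction.homEquiv_apply_eq, Adjunction.homEquiv_counit]
  rfl

/-- Reduces the functor `X ⊸ -` to application and transposition, both for its enrichment and for
its preservation. -/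
theorem ihom_map_eq_curryHom (X : C) {Y Y' : C} (f : Y ⟶ Y') :
    (ihom X).map f = curryHom (appHom X Y ≫ f) := by
  rw [eq_comm, curryHom_eq_iff]
  exact ((lolliAdjunction X).counit.naturality f).symm

theorem curryHom_appHom {X Y Z : C} (f : X ⊗ Y ⟶ Z) : curryHom f ▷ Y ≫ appHom Y Z = f :=
  ((curryHom_eq_iff f _).1 rfl).symm

theorem whiskerRight_appHom_curryHom {X Y Z : C} (g : X ⟶ (ihom Y).obj Z) :
    curryHom (g ▷ Y ≫ appHom Y Z) = g :=
  (curryHom_eq_iff _ g).2 rfl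

theorem curryHom_comp_left {X X' Y Z : C} (g : X' ⟶ X) (f : X ⊗ Y ⟶ Z) :
    g ≫ curryHom f = curryHom (g ▷ Y ≫ f) := by
  rw [eq_comm, curryHom_eq_iff, comp_whiskerRight, Category.assoc, curryHom_appHom]

end Autonomous

namespace AutonomousData.IsAutonomous

variable {D : Type u₄} [Category.{v₄} D] {P : AutonomousData D} (h : P.IsAutonomous)

/-- The closed structure is obtained by moving the given adjunction from right to left tensoring
along the braiding, and `lolliAdjunction` moves it back. The counit thus acquires two braidings that
cancel. -/
theorem appHom_eq (X Y : D) :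
    letI := h.monoidalCategory
    letI := h.symmetricCategory
    letI := h.monoidalClosed
    appHom X Y = P.app X Y := by
  let := h.monoidalCategory
  let := h.symmetricCategory
  let := h.monoidalClosed
  have : appHom X Y = P.braid (P.lolli X Y) X ≫ P.braid X (P.lolli X Y) ≫ P.tensorHom (𝟙 _) (𝟙 X) ≫
     P.app X Y := by rfl
  rw [this, h.id_tensor_id, Category.id_comp, reassoc_of% (h.braid_braid (P.lolli X Y) X)]

theorem curryHom_eq {X Y Z : D} (f : P.tensorObj X Y ⟶ Z) :
    letI := h.monoidalCategory
    letI := h.symmetricCategory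
    letI := h.monoidalClosed
    curryHom (X := X) (Y := Y) (Z := Z) f = P.curry f := by
  let := h.monoidalCategory
  let := h.symmetricCategory
  let := h.monoidalClosed
  refine (curryHom_eq_iff (X := X) (Y := Y) (Z := Z) f _).2 ?_
  rw [h.appHom_eq]
  exact (h.curry_app f).symm

end AutonomousData.IsAutonomous

section Enriched

variable {V : Type u₃} [CommMonoid V] [CompleteLattice V] [IsQuantale V]
variable {C : Type u₄} [Category.{v₄} C] [VCatSepCategory V C]

theorem le_mul_dist_self {X : Type*} (a : VCategory V X) (x : X) (q : V) : q ≤ q * a.dist x x :=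
  calc q = q * 1 := (mul_one q).symm
    _ ≤ q * a.dist x x := mul_le_mul' le_rfl (a.one_le_dist x)

theorem le_dist_comp {X Y Z : C} {f f' : X ⟶ Y} {g g' : Y ⟶ Z} {q r : V}
    (hq : q ≤ (VCatSepCategory.hom X Y).dist f f') (hr : r ≤ (VCatSepCategory.hom Y Z).dist g g') :
    q * r ≤ (VCatSepCategory.hom X Z).dist (f ≫ g) (f' ≫ g') :=
  (mul_le_mul' hq hr).trans (VCatSepCategory.comp _ _ _ (f, g) (f', g'))

theorem le_dist_comp_right {X Y Z : C} {f f' : X ⟶ Y} (g : Y ⟶ Z) {q : V}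
    (hq : q ≤ (VCatSepCategory.hom X Y).dist f f') :
    q ≤ (VCatSepCategory.hom X Z).dist (f ≫ g) (f' ≫ g) :=
  (le_mul_dist_self _ g q).trans (le_dist_comp hq le_rfl)

theorem le_dist_comp_left {X Y Z : C} (f : X ⟶ Y) {g g' : Y ⟶ Z} {q : V}
    (hq : q ≤ (VCatSepCategory.hom Y Z).dist g g') :
    q ≤ (VCatSepCategory.hom X Z).dist (f ≫ g) (f ≫ g') := by
  have := le_dist_comp (V := V) (f := f) (f' := f) le_rfl hq
  rw [mul_comm] at this
  exact (le_mul_dist_self _ f q).trans this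

end Enriched

namespace Syn

variable {G : Type u₁} {S : Signature.{u₁, u₂} G}
variable {V : Type u₃} [CommMonoid V] [CompleteLattice V] [IsQuantale V] {B : Set V}

/-- The syntactic category is enriched as an autonomous category. -/
theorem vCatSepAutonomous (T : VTheory S B) (h : (Syn.autonomousData T).IsAutonomous) :
    letI := h.monoidalCategory
    letI := h.symmetricCategory
    letI := h.monoidalClosed
    VCatSepAutonomous V (Syn T) := by
  let := h.monoidalCategory
  let := h.symmetricCategory
  let := h.monoidalClosed
  have ht : ∀ X X' Y Y' : Syn T, IsVFunctor
      ((VCatSepCategory.hom (V := V) X Y).tensor (VCatSepCategory.hom (V := V) X' Y'))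
      (VCatSepCategory.hom (V := V) (X ⊗ X') (Y ⊗ Y')) fun p => p.1 ⊗ₘ p.2 := by
    rintro X X' Y Y' ⟨⟨v⟩, ⟨w⟩⟩ ⟨⟨v'⟩, ⟨w'⟩⟩
    exact T.tensor_isVFunctor X Y X' Y' (v, w) (v', w')
  have hc : ∀ X Y Z : Syn T, IsVFunctor (VCatSepCategory.hom (V := V) (X ⊗ Y) Z)
      (VCatSepCategory.hom (V := V) X ((ihom Y).obj Z)) curryHom := by
    intro X Y Z f g
    rw [h.curryHom_eq, h.curryHom_eq]
    revert f g
    rintro ⟨v⟩ ⟨w⟩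
    exact T.curry_isVFunctor X Y Z v w
  -- Tensoring with `X` is tensoring with its identity, whose self-distance is at least the unit.
  have hl : ∀ X : Syn T, IsVCatFunctor V (tensorRight X) := fun X Y Z f g =>
    (le_mul_dist_self _ (𝟙 X) _).trans (ht Y X Z X (f, 𝟙 X) (g, 𝟙 X))
  -- The two remaining maps are composites: `X ⊸ f` is the transpose of application followed by `f`,
  -- and the inverse transposition tensors with `X` and then applies.
  refine ⟨ht, fun X => ⟨hl X, fun Y Z f g => ?_, fun Y Z => hc Y X Z, fun Y Z f g => ?_⟩⟩
  · dsimp only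
    rw [ihom_map_eq_curryHom, ihom_map_eq_curryHom]
    exact (le_dist_comp_left (appHom X Y) le_rfl).trans (hc _ _ _ _ _)
  · rw [Adjunction.homEquiv_counit, Adjunction.homEquiv_counit]
    exact le_dist_comp_right _ (hl X _ _ _ _)

end Syn

end VLambda

/-! ### Contexts and shuffles in an autonomous category -/

namespace VLambda

/-! ### Tensor products of contexts -/

section Tensor

theorem eqToHom_whiskerRight_eq {C : Type u₄} [Category.{v₄} C] [MonoidalCategory C] {X Y : C} (Z : C) (h : X = Y) (h' : X ⊗ Z = Y ⊗ Z) :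
    eqToHom h' = eqToHom h ▷ Z := by
  subst h
  simp

variable {G : Type u₁} {C : Type u₄} [Category.{v₄} C] [MonoidalCategory C] [MonoidalClosed C]

/-- The tensor product of the types of a context, starting with the unit object. -/
def Ctx.ten (I : G → C) : Ctx G → C
  | [] => 𝟙_ C
  | p :: Γ => Ctx.ten I Γ ⊗ p.2.interp I

/-- The comparison between the tensor product that starts with the unit object and the
interpretation of the context. -/
def Ctx.tenIso (I : G → C) : (Γ : Ctx G) → (Ctx.ten I Γ ≅ Ctx.interp I Γ)
  | [] => Iso.refl _
  | p :: Γ => whiskerRightIso (Ctx.tenIso I Γ) _ ≪≫ Ctx.joinIso I p Γ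

/-- The contexts consist of variables of the same types. -/
def Ctx.SameTypes (Γ Δ : Ctx G) : Prop := Γ.map Prod.snd = Δ.map Prod.snd

theorem Ctx.SameTypes.symm {Γ Δ : Ctx G} (h : Γ.SameTypes Δ) : Δ.SameTypes Γ := Eq.symm h

theorem Ctx.SameTypes.trans {Γ Δ Θ : Ctx G} (h : Γ.SameTypes Δ) (h' : Δ.SameTypes Θ) :
    Γ.SameTypes Θ := Eq.trans h h'

theorem Ctx.SameTypes.cons {Γ Δ : Ctx G} (h : Γ.SameTypes Δ) (x y : ℕ) (A : Ty G) :
    Ctx.SameTypes ((x, A) :: Γ) ((y, A) :: Δ) := congrArg (A :: ·) h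

theorem Ctx.SameTypes.tail {p q : ℕ × Ty G} {Γ Δ : Ctx G}
    (h : Ctx.SameTypes (p :: Γ) (q :: Δ)) : Γ.SameTypes Δ := (List.cons.inj h).2

theorem Ctx.sameTypes_shift (k : ℕ) (Γ : Ctx G) : Γ.SameTypes (Γ.shift k) := by
  simp [Ctx.SameTypes, Ctx.shift, Function.comp_def]

theorem Ctx.sameTypes_ren {Γ : Ctx G} (ρ : ℕ → ℕ) :
    Ctx.SameTypes (Γ.map fun p => (ρ p.1, p.2)) Γ := by
  simp [Ctx.SameTypes, Function.comp_def]

theorem Ctx.ten_congr (I : G → C) : ∀ {Γ Δ : Ctx G}, Γ.SameTypes Δ → Ctx.ten I Γ = Ctx.ten I Δ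
  | [], [], _ => rfl
  | p :: Γ, q :: Δ, h => by
      rw [Ctx.ten, Ctx.ten, Ctx.ten_congr I h.tail, (List.cons.inj h).1]
  | [], _ :: _, h => nomatch h
  | _ :: _, [], h => nomatch h

/-- The tensor product of a context depends on the types only. -/
def Ctx.tenCast (I : G → C) {Γ Δ : Ctx G} (h : Γ.SameTypes Δ) : Ctx.ten I Γ ⟶ Ctx.ten I Δ :=
  eqToHom (Ctx.ten_congr I h)

@[simp]
theorem Ctx.tenCast_refl (I : G → C) {Γ : Ctx G} (h : Γ.SameTypes Γ) :
    Ctx.tenCast I h = 𝟙 _ := rfl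

@[simp]
theorem Ctx.tenCast_comp (I : G → C) {Γ Δ Θ : Ctx G} (h : Γ.SameTypes Δ) (h' : Δ.SameTypes Θ) :
    Ctx.tenCast I h ≫ Ctx.tenCast I h' = Ctx.tenCast I (h.trans h') := eqToHom_trans _ _

@[simp]
theorem Ctx.tenCast_comp_assoc (I : G → C) {Γ Δ Θ : Ctx G} (h : Γ.SameTypes Δ)
    (h' : Δ.SameTypes Θ) {X : C} (f : Ctx.ten I Θ ⟶ X) :
    Ctx.tenCast I h ≫ Ctx.tenCast I h' ≫ f = Ctx.tenCast I (h.trans h') ≫ f :=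
  eqToHom_trans_assoc _ _ _

/-- Names do not matter for the tensor product of a context. This rule and the composition of casts
are how casts are moved through tensor products below. -/
theorem Ctx.tenCast_cons (I : G → C) {Γ Δ : Ctx G} (x y : ℕ) (A : Ty G) (h : Γ.SameTypes Δ)
    (h' : Ctx.SameTypes ((x, A) :: Γ) ((y, A) :: Δ)) :
    Ctx.tenCast I h' = Ctx.tenCast I h ▷ A.interp I := eqToHom_whiskerRight_eq _ _ _

theorem Ctx.eqToHom_interp_shift_cons (I : G → C) (k : ℕ) (p : ℕ × Ty G) : ∀ Γ : Ctx G,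
    eqToHom (Ctx.interp_shift I k (p :: Γ)) = (Ctx.joinIso I p Γ).inv ≫
      eqToHom (Ctx.interp_shift I k Γ) ▷ p.2.interp I ≫
        (Ctx.joinIso I (p.1 + k, p.2) (Γ.shift k)).hom
  | [] => by
      change 𝟙 _ = (λ_ _).inv ≫ 𝟙 _ ▷ _ ≫ (λ_ _).hom
      simp
  | q :: Γ => by
      refine (eqToHom_whiskerRight_eq _ (Ctx.interp_shift I k (q :: Γ)) _).trans ?_
      refine (Category.comp_id _).symm.trans ?_
      exact (Category.id_comp _).symm

/-- Relates the cast that the interpretation inserts under binders to `Ctx.tenCast`, so that the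
former need not appear in `Sem`. -/
theorem Ctx.tenIso_shift (I : G → C) (k : ℕ) : ∀ Γ : Ctx G,
    (Ctx.tenIso I Γ).hom ≫ eqToHom (Ctx.interp_shift I k Γ) =
      Ctx.tenCast I (Ctx.sameTypes_shift k Γ) ≫ (Ctx.tenIso I (Γ.shift k)).hom
  | [] => rfl
  | p :: Γ => by
      -- The interpretation of a context is a tensor product only after unfolding, which obstructs
      -- rewriting. The calculation is therefore done for arbitrary objects and then applied up to
      -- definitional equality; later facts called `key` serve the same purpose.
      have key : ∀ {X X' Y Y' Z J J' : C} (t : X ⟶ Y) (j : Y ⊗ Z ≅ J) (e : Y ⟶ Y')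
          (j' : Y' ⊗ Z ≅ J') (c : X ⟶ X') (t' : X' ⟶ Y'), t ≫ e = c ≫ t' →
          (t ▷ Z ≫ j.hom) ≫ j.inv ≫ e ▷ Z ≫ j'.hom = c ▷ Z ≫ t' ▷ Z ≫ j'.hom := by
        intro X X' Y Y' Z J J' t j e j' c t' h
        rw [← comp_whiskerRight_assoc c, ← h]
        simp
      rw [Ctx.eqToHom_interp_shift_cons]
      refine (key _ _ _ _ _ _ (Ctx.tenIso_shift I k Γ)).trans ?_
      rw [← Ctx.tenCast_cons I p.1 (p.1 + k) p.2 (Ctx.sameTypes_shift k Γ)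
        (Ctx.sameTypes_shift k (p :: Γ))]
      rfl

end Tensor

/-! ### Shuffling morphisms -/

section Shuffles

/-- The interchange `(X ⊗ Y) ⊗ Z ⟶ (X ⊗ Z) ⊗ Y`. -/
def tensorSwap {C : Type u₄} [Category.{v₄} C] [MonoidalCategory C] [SymmetricCategory C]
    (X Y Z : C) : (X ⊗ Y) ⊗ Z ⟶ (X ⊗ Z) ⊗ Y :=
  (α_ _ _ _).hom ≫ X ◁ (β_ Y Z).hom ≫ (α_ _ _ _).inv

variable {G : Type u₁} {C : Type u₄} [Category.{v₄} C] [MonoidalCategory C] [SymmetricCategory C]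

theorem tensorSwap_naturality {X Y X' Y' : C} (Z : C) (f : X ⟶ X') (g : Y ⟶ Y') :
    (f ⊗ₘ g) ▷ Z ≫ tensorSwap X' Y' Z = tensorSwap X Y Z ≫ (f ▷ Z ⊗ₘ g) := by
  simp only [tensorSwap, MonoidalCategory.tensorHom_def', comp_whiskerRight, Category.assoc]
  rw [associator_naturality_left_assoc, ← whisker_exchange_assoc, associator_naturality_middle_assoc,
    associator_inv_naturality_left, ← whiskerLeft_comp_assoc,
    BraidedCategory.braiding_naturality_left, whiskerLeft_comp_assoc,
    associator_inv_naturality_right_assoc]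

/-- Moving `W` past `Z` and then past `Y` is moving it past `Y ⊗ Z`, by the hexagon. -/
theorem associator_tensorSwap_left (X Y Z W : C) :
    tensorSwap (X ⊗ Y) Z W ≫ tensorSwap X Y W ▷ Z ≫ (α_ _ _ _).hom =
      (α_ X Y Z).hom ▷ W ≫ tensorSwap X (Y ⊗ Z) W := by
  simp only [tensorSwap, BraidedCategory.braiding_tensor_left_hom]
  monoidal

theorem associator_tensorSwap_right (X Y Z W : C) :
    tensorSwap (X ⊗ Y) Z W ≫ (α_ X Y W).hom ▷ Z ≫ (α_ _ _ _).hom =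
      (α_ X Y Z).hom ▷ W ≫ (α_ _ _ _).hom ≫ X ◁ tensorSwap Y Z W := by
  simp only [tensorSwap]
  monoidal

/-- The braiding of `X ⊗ Z` with `Y` first undoes the interchange of `Y` and `Z`; this is where
symmetry is used. -/
theorem tensorSwap_braiding (X Y Z : C) :
    tensorSwap X Y Z ≫ (β_ (X ⊗ Z) Y).hom = (β_ X Y).hom ▷ Z ≫ (α_ _ _ _).hom := by
  simp only [tensorSwap, BraidedCategory.braiding_tensor_left_hom, Category.assoc,
    Iso.inv_hom_id_assoc]
  rw [← whiskerLeft_comp_assoc, SymmetricCategory.symmetry]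
  simp

theorem associator_braiding (X Y Z : C) :
    (α_ X Y Z).hom ≫ (β_ X (Y ⊗ Z)).hom = (β_ X Y).hom ▷ Z ≫ tensorSwap Y X Z := by
  simp only [tensorSwap, BraidedCategory.braiding_tensor_right_hom, Iso.hom_inv_id_assoc]

variable [MonoidalClosed C]

/-- The morphism of a shuffle between the tensor products that start with the unit object. -/
def Shuffle.ten (I : G → C) : {Γ Δ E : Ctx G} → Shuffle Γ Δ E →
    (Ctx.ten I E ⟶ Ctx.ten I Γ ⊗ Ctx.ten I Δ)
  | _, _, _, .nil => (λ_ (𝟙_ C)).inv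
  | _, _, _, .left p s => s.ten I ▷ p.2.interp I ≫ tensorSwap _ _ _
  | _, _, _, .right p s => s.ten I ▷ p.2.interp I ≫ (α_ _ _ _).hom

/-- By induction: the joining isomorphism that ends the comparison of `E` cancels against the
splitting that starts `mor`, and naturality of the remaining interchange or associator finishes the
case. -/
theorem Shuffle.tenIso_mor (I : G → C) {Γ Δ E : Ctx G} (s : Shuffle Γ Δ E) :
    (Ctx.tenIso I E).hom ≫ s.mor I =
      s.ten I ≫ ((Ctx.tenIso I Γ).hom ⊗ₘ (Ctx.tenIso I Δ).hom) := by
  induction s with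
  | nil =>
    refine (Category.id_comp _).trans ((Category.comp_id _).symm.trans ?_)
    exact congrArg _ (id_tensorHom_id _ _).symm
  | left p s ih =>
    have key : ∀ {X X' Y Y' Z Z' W J K : C} (a : X ⟶ X') (m : X' ⟶ Y' ⊗ Z') (s : X ⟶ Y ⊗ Z)
        (b : Y ⟶ Y') (c : Z ⟶ Z') (j : X' ⊗ W ≅ J) (k : Y' ⊗ W ⟶ K), a ≫ m = s ≫ (b ⊗ₘ c) →
        (a ▷ W ≫ j.hom) ≫ j.inv ≫ m ▷ W ≫ (α_ _ _ _).hom ≫ _ ◁ (β_ _ _).hom ≫ (α_ _ _ _).inv ≫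
          k ▷ _ = (s ▷ W ≫ tensorSwap _ _ _) ≫ (b ▷ W ≫ k ⊗ₘ c) := by
      intro X X' Y Y' Z Z' W J K a m s b c j k h
      have e := congrArg (fun f => f ▷ W ≫ tensorSwap _ _ _ ≫ k ▷ _) h
      simp only [comp_whiskerRight, Category.assoc] at e
      rw [reassoc_of% tensorSwap_naturality] at e
      simp only [Category.assoc, Iso.hom_inv_id_assoc]
      simp only [tensorSwap, Category.assoc] at e ⊢
      rw [e, ← tensorHom_id k, tensorHom_comp_tensorHom, Category.comp_id]
    exact key _ _ _ _ _ _ _ ih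
  | right p s ih =>
    have key : ∀ {X X' Y Y' Z Z' W J K : C} (a : X ⟶ X') (m : X' ⟶ Y' ⊗ Z') (s : X ⟶ Y ⊗ Z)
        (b : Y ⟶ Y') (c : Z ⟶ Z') (j : X' ⊗ W ≅ J) (k : Z' ⊗ W ⟶ K), a ≫ m = s ≫ (b ⊗ₘ c) →
        (a ▷ W ≫ j.hom) ≫ j.inv ≫ m ▷ W ≫ (α_ _ _ _).hom ≫ _ ◁ k =
          (s ▷ W ≫ (α_ _ _ _).hom) ≫ (b ⊗ₘ c ▷ W ≫ k) := by
      intro X X' Y Y' Z Z' W J K a m s b c j k h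
      have e := congrArg (fun f => f ▷ W ≫ (α_ _ _ _).hom ≫ _ ◁ k) h
      simp only [comp_whiskerRight, Category.assoc] at e
      simp only [Category.assoc, Iso.hom_inv_id_assoc]
      rw [e]
      simp [MonoidalCategory.tensorHom_def]
    exact key _ _ _ _ _ _ _ ih

/-- The head of `E` comes from `Γ`, `Δ` or `Θ`, and its origin dictates the first step of both new
shuffles. In the three cases the induction hypothesis is extended by one variable, using naturality
and the coherence of interchange and associator. -/
theorem Shuffle.ten_assoc (I : G → C) {Γ Δ Θ F E : Ctx G} (s : Shuffle F Θ E)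
    (t : Shuffle Γ Δ F) : ∃ (F' : Ctx G) (t' : Shuffle Γ F' E) (s' : Shuffle Δ Θ F'),
      s.ten I ≫ t.ten I ▷ _ ≫ (α_ _ _ _).hom = t'.ten I ≫ _ ◁ s'.ten I := by
  induction s generalizing Γ Δ with
  | nil =>
    cases t
    refine ⟨_, .nil, .nil, ?_⟩
    change (λ_ (𝟙_ C)).inv ≫ (λ_ (𝟙_ C)).inv ▷ _ ≫ _ = (λ_ (𝟙_ C)).inv ≫ _ ◁ (λ_ (𝟙_ C)).inv
    monoidal
  | right p s ih =>
    obtain ⟨F', t', s', e⟩ := ih t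
    refine ⟨_, .right p t', .right p s', ?_⟩
    have key : ∀ {E F X Y Z F' W : C} (s : E ⟶ F ⊗ Z) (t : F ⟶ X ⊗ Y) (t' : E ⟶ X ⊗ F')
        (s' : F' ⟶ Y ⊗ Z), s ≫ t ▷ _ ≫ (α_ _ _ _).hom = t' ≫ _ ◁ s' →
        (s ▷ W ≫ (α_ _ _ _).hom) ≫ t ▷ _ ≫ (α_ _ _ _).hom =
          (t' ▷ W ≫ (α_ _ _ _).hom) ≫ _ ◁ (s' ▷ W ≫ (α_ _ _ _).hom) := by
      intro E F X Y Z F' W s t t' s' h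
      have e := congrArg (fun f => f ▷ W ≫ (α_ _ _ _).hom ≫ _ ◁ (α_ _ _ _).hom) h
      simp only [comp_whiskerRight, Category.assoc] at e
      simpa using e
    exact key _ _ _ _ e
  | left p s ih =>
    cases t with
    | left _ t =>
      obtain ⟨F', t', s', e⟩ := ih t
      refine ⟨_, .left p t', s', ?_⟩
      have key : ∀ {E F X Y Z F' W : C} (s : E ⟶ F ⊗ Z) (t : F ⟶ X ⊗ Y) (t' : E ⟶ X ⊗ F')
          (s' : F' ⟶ Y ⊗ Z), s ≫ t ▷ _ ≫ (α_ _ _ _).hom = t' ≫ _ ◁ s' →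
          (s ▷ W ≫ tensorSwap _ _ _) ≫ (t ▷ W ≫ tensorSwap _ _ _) ▷ _ ≫ (α_ _ _ _).hom =
            (t' ▷ W ≫ tensorSwap _ _ _) ≫ _ ◁ s' := by
        intro E F X Y Z F' W s t t' s' h
        have e := congrArg (fun f => f ▷ W ≫ tensorSwap _ _ _) h
        simp only [comp_whiskerRight, Category.assoc] at e ⊢
        have n₁ := tensorSwap_naturality W t (𝟙 Z)
        have n₂ := tensorSwap_naturality W (𝟙 X) s'
        simp only [tensorHom_id, id_tensorHom, id_whiskerRight] at n₁ n₂
        rw [n₂] at e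
        rw [← reassoc_of% n₁, associator_tensorSwap_left, e]
      exact key _ _ _ _ e
    | right _ t =>
      obtain ⟨F', t', s', e⟩ := ih t
      refine ⟨_, .right p t', .left p s', ?_⟩
      have key : ∀ {E F X Y Z F' W : C} (s : E ⟶ F ⊗ Z) (t : F ⟶ X ⊗ Y) (t' : E ⟶ X ⊗ F')
          (s' : F' ⟶ Y ⊗ Z), s ≫ t ▷ _ ≫ (α_ _ _ _).hom = t' ≫ _ ◁ s' →
          (s ▷ W ≫ tensorSwap _ _ _) ≫ (t ▷ W ≫ (α_ _ _ _).hom) ▷ _ ≫ (α_ _ _ _).hom =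
            (t' ▷ W ≫ (α_ _ _ _).hom) ≫ _ ◁ (s' ▷ W ≫ tensorSwap _ _ _) := by
        intro E F X Y Z F' W s t t' s' h
        have e := congrArg (fun f => f ▷ W ≫ (α_ _ _ _).hom ≫ _ ◁ tensorSwap _ _ _) h
        simp only [comp_whiskerRight, Category.assoc] at e ⊢
        have n₁ := tensorSwap_naturality W t (𝟙 Z)
        simp only [tensorHom_id] at n₁
        rw [← reassoc_of% n₁, associator_tensorSwap_right, e]
        simp
      exact key _ _ _ _ e

/-- The shuffle with the two sides interchanged. -/
def Shuffle.symm : {Γ Δ E : Ctx G} → Shuffle Γ Δ E → Shuffle Δ Γ E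
  | _, _, _, .nil => .nil
  | _, _, _, .left p s => .right p s.symm
  | _, _, _, .right p s => .left p s.symm

/-- The inductive cases are `tensorSwap_braiding` and `associator_braiding`; for the empty context
both unitors of the unit object agree. -/
theorem Shuffle.ten_symm (I : G → C) {Γ Δ E : Ctx G} (s : Shuffle Γ Δ E) :
    s.symm.ten I = s.ten I ≫ (β_ _ _).hom := by
  induction s with
  | nil =>
    change (λ_ (𝟙_ C)).inv = (λ_ (𝟙_ C)).inv ≫ (β_ (𝟙_ C) (𝟙_ C)).hom
    rw [braiding_tensorUnit_left, Iso.inv_hom_id_assoc, unitors_inv_equal]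
  | left p s ih =>
    have key : ∀ {E X Y W : C} (s : E ⟶ X ⊗ Y) (s' : E ⟶ Y ⊗ X), s' = s ≫ (β_ _ _).hom →
        s' ▷ W ≫ (α_ _ _ _).hom = (s ▷ W ≫ tensorSwap _ _ _) ≫ (β_ _ _).hom := by
      rintro E X Y W s _ rfl
      rw [Category.assoc, tensorSwap_braiding, comp_whiskerRight, Category.assoc]
    exact key _ _ ih
  | right p s ih =>
    have key : ∀ {E X Y W : C} (s : E ⟶ X ⊗ Y) (s' : E ⟶ Y ⊗ X), s' = s ≫ (β_ _ _).hom →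
        s' ▷ W ≫ tensorSwap _ _ _ = (s ▷ W ≫ (α_ _ _ _).hom) ≫ (β_ _ _).hom := by
      rintro E X Y W s _ rfl
      rw [Category.assoc, associator_braiding, comp_whiskerRight, Category.assoc]
    exact key _ _ ih

/-- Rebracketing in the other direction is the mirror image of `Shuffle.ten_assoc`: interchange both
sides, rebracket, and interchange back, the braidings cancelling by symmetry. -/
theorem Shuffle.ten_assoc_symm (I : G → C) {Γ Δ Θ F E : Ctx G} (s : Shuffle Γ F E)
    (t : Shuffle Δ Θ F) : ∃ (F' : Ctx G) (t' : Shuffle F' Θ E) (s' : Shuffle Γ Δ F'),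
      s.ten I ≫ _ ◁ t.ten I ≫ (α_ _ _ _).inv = t'.ten I ≫ s'.ten I ▷ _ := by
  obtain ⟨F', t', s', e⟩ := Shuffle.ten_assoc I s.symm t.symm
  refine ⟨F', t'.symm, s'.symm, ?_⟩
  rw [Shuffle.ten_symm, Shuffle.ten_symm] at e
  rw [Shuffle.ten_symm, Shuffle.ten_symm]
  have key : ∀ {E X Y Z F F' : C} (s : E ⟶ X ⊗ F) (t : F ⟶ Y ⊗ Z) (t' : E ⟶ Z ⊗ F')
      (s' : F' ⟶ Y ⊗ X), (s ≫ (β_ _ _).hom) ≫ (t ≫ (β_ _ _).hom) ▷ _ ≫ (α_ _ _ _).hom =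
        t' ≫ _ ◁ s' → s ≫ _ ◁ t ≫ (α_ _ _ _).inv =
          (t' ≫ (β_ _ _).hom) ≫ (s' ≫ (β_ _ _).hom) ▷ _ := by
    intro E X Y Z F F' s t t' s' h
    have e := congrArg (fun f => f ≫ (β_ _ _).hom ≫ (β_ _ _).hom ▷ _) h
    simp only [comp_whiskerRight, Category.assoc] at e ⊢
    rw [BraidedCategory.braiding_naturality_right_assoc] at e
    have w₁ : ∀ A B D : C, (β_ A B).hom ▷ D ≫ (β_ B A).hom ▷ D = 𝟙 _ := by
      intro A B D
      rw [← comp_whiskerRight, SymmetricCategory.symmetry, id_whiskerRight]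
    have w₂ : ∀ A B D : C, D ◁ (β_ A B).hom ≫ D ◁ (β_ B A).hom = 𝟙 _ := by
      intro A B D
      rw [← whiskerLeft_comp, SymmetricCategory.symmetry, whiskerLeft_id]
    rw [← e, ← BraidedCategory.braiding_naturality_right_assoc]
    simp [w₁, reassoc_of% w₁, reassoc_of% w₂]
  exact key _ _ _ _ e

/-- Bracket `Δ` and `Θ` together, interchange them, and bracket to the left again; the resulting
composite is `tensorSwap`. -/
theorem Shuffle.ten_rightComm (I : G → C) {Γ Δ Θ F E : Ctx G} (s : Shuffle F Θ E)
    (t : Shuffle Γ Δ F) : ∃ (F' : Ctx G) (t' : Shuffle F' Δ E) (s' : Shuffle Γ Θ F'),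
      s.ten I ≫ t.ten I ▷ _ ≫ tensorSwap _ _ _ = t'.ten I ≫ s'.ten I ▷ _ := by
  obtain ⟨F', t', s', e⟩ := Shuffle.ten_assoc I s t
  obtain ⟨F₂, t₂, s₂, e₂⟩ := Shuffle.ten_assoc_symm I t' s'.symm
  refine ⟨F₂, t₂, s₂, ?_⟩
  rw [← e₂, Shuffle.ten_symm, whiskerLeft_comp, Category.assoc, ← reassoc_of% e]
  rfl

/-- The shuffle with an empty left side. -/
def Shuffle.nilLeft : (Γ : Ctx G) → Shuffle [] Γ Γ
  | [] => .nil
  | p :: Γ => .right p (Shuffle.nilLeft Γ)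

/-- The shuffle with an empty right side. -/
def Shuffle.nilRight : (Γ : Ctx G) → Shuffle Γ [] Γ
  | [] => .nil
  | p :: Γ => .left p (Shuffle.nilRight Γ)

/-- The shuffle of `Γ` and one further variable. -/
def Shuffle.snocVar (p : ℕ × Ty G) (Γ : Ctx G) : Shuffle Γ [p] (p :: Γ) :=
  .right p (Shuffle.nilRight Γ)

theorem Shuffle.ten_nilLeft (I : G → C) : ∀ Γ : Ctx G,
    (Shuffle.nilLeft Γ).ten I = (λ_ (Ctx.ten I Γ)).inv
  | [] => rfl
  | p :: Γ => by
      have key : ∀ {X Z : C} (s : X ⟶ 𝟙_ C ⊗ X), s = (λ_ X).inv →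
          s ▷ Z ≫ (α_ _ _ _).hom = (λ_ (X ⊗ Z)).inv := by
        rintro X Z _ rfl
        simp
      exact key _ (Shuffle.ten_nilLeft I Γ)

theorem Shuffle.ten_nilRight (I : G → C) (Γ : Ctx G) :
    (Shuffle.nilRight Γ).ten I = (ρ_ (Ctx.ten I Γ)).inv := by
  have e : ∀ Γ : Ctx G, Shuffle.nilRight Γ = (Shuffle.nilLeft Γ).symm := by
    intro Γ
    induction Γ with
    | nil => rfl
    | cons p Γ ih => rw [Shuffle.nilRight, ih]; rfl
  rw [e, Shuffle.ten_symm, Shuffle.ten_nilLeft]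
  exact leftUnitor_inv_braiding _

theorem Shuffle.ten_snocVar (I : G → C) (p : ℕ × Ty G) (Γ : Ctx G) :
    (Shuffle.snocVar p Γ).ten I = Ctx.ten I Γ ◁ (λ_ (p.2.interp I)).inv := by
  change (Shuffle.nilRight Γ).ten I ▷ _ ≫ (α_ _ (𝟙_ C) _).hom = _
  rw [Shuffle.ten_nilRight]
  exact triangle_assoc_comp_right_inv _ _

theorem Shuffle.eq_of_nil : ∀ {Γ E : Ctx G} (s : Shuffle [] Γ E),
    E = Γ ∧ s ≍ Shuffle.nilLeft Γ
  | _, _, .nil => ⟨rfl, HEq.rfl⟩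
  | _, _, .right p s => by
      obtain ⟨rfl, h⟩ := Shuffle.eq_of_nil s
      exact ⟨rfl, heq_of_eq (congrArg (Shuffle.right p) (eq_of_heq h))⟩

/-- Renaming of the variables of a shuffle. -/
def Shuffle.ren (ρ : ℕ → ℕ) : {Γ Δ E : Ctx G} → Shuffle Γ Δ E →
    Shuffle (Γ.map fun p => (ρ p.1, p.2)) (Δ.map fun p => (ρ p.1, p.2))
      (E.map fun p => (ρ p.1, p.2))
  | _, _, _, .nil => .nil
  | _, _, _, .left p s => .left _ (s.ren ρ)
  | _, _, _, .right p s => .right _ (s.ren ρ)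

theorem Shuffle.ten_ren (I : G → C) (ρ : ℕ → ℕ) {Γ Δ E : Ctx G} (s : Shuffle Γ Δ E) :
    (s.ren ρ).ten I ≫ (Ctx.tenCast I (Ctx.sameTypes_ren ρ) ⊗ₘ Ctx.tenCast I (Ctx.sameTypes_ren ρ)) =
      Ctx.tenCast I (Ctx.sameTypes_ren ρ) ≫ s.ten I := by
  induction s with
  | nil =>
    refine (congrArg _ (id_tensorHom_id _ _)).trans ((Category.comp_id _).trans ?_)
    exact (Category.id_comp _).symm
  | @left Γ Δ E p s ih =>
    have key : ∀ {E E' X X' Y Y' W : C} (s : E ⟶ X ⊗ Y) (s' : E' ⟶ X' ⊗ Y') (e : E' ⟶ E)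
        (x : X' ⟶ X) (y : Y' ⟶ Y) (e' : E' ⊗ W ⟶ E ⊗ W) (x' : X' ⊗ W ⟶ X ⊗ W),
        s' ≫ (x ⊗ₘ y) = e ≫ s → e' = e ▷ W → x' = x ▷ W →
        (s' ▷ W ≫ tensorSwap _ _ _) ≫ (x' ⊗ₘ y) = e' ≫ s ▷ W ≫ tensorSwap _ _ _ := by
      rintro E E' X X' Y Y' W s s' e x y _ _ h rfl rfl
      rw [Category.assoc, ← tensorSwap_naturality, ← comp_whiskerRight_assoc, h,
        comp_whiskerRight_assoc]
    exact key _ _ _ _ _ _ _ ih (Ctx.tenCast_cons I (ρ p.1) p.1 p.2 (Ctx.sameTypes_ren ρ) _)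
      (Ctx.tenCast_cons I (ρ p.1) p.1 p.2 (Ctx.sameTypes_ren ρ) _)
  | @right Γ Δ E p s ih =>
    have key : ∀ {E E' X X' Y Y' W : C} (s : E ⟶ X ⊗ Y) (s' : E' ⟶ X' ⊗ Y') (e : E' ⟶ E)
        (x : X' ⟶ X) (y : Y' ⟶ Y) (e' : E' ⊗ W ⟶ E ⊗ W) (y' : Y' ⊗ W ⟶ Y ⊗ W),
        s' ≫ (x ⊗ₘ y) = e ≫ s → e' = e ▷ W → y' = y ▷ W →
        (s' ▷ W ≫ (α_ _ _ _).hom) ≫ (x ⊗ₘ y') = e' ≫ s ▷ W ≫ (α_ _ _ _).hom := by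
      rintro E E' X X' Y Y' W s s' e x y _ _ h rfl rfl
      rw [Category.assoc, ← tensorHom_id y, ← associator_naturality, tensorHom_id,
        ← comp_whiskerRight_assoc, h, comp_whiskerRight_assoc]
    exact key _ _ _ _ _ _ _ ih (Ctx.tenCast_cons I (ρ p.1) p.1 p.2 (Ctx.sameTypes_ren ρ) _)
      (Ctx.tenCast_cons I (ρ p.1) p.1 p.2 (Ctx.sameTypes_ren ρ) _)

/-! ### Multiple shuffles -/

/-- The morphism of a multiple shuffle between the tensor products that start with the unit
object. -/
def MultiShuffle.ten (I : G → C) : {n : ℕ} → {Γ : Fin (n + 1) → Ctx G} → {E : Ctx G} →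
    MultiShuffle n Γ E → (Ctx.ten I E ⟶ famTensor n fun i => Ctx.ten I (Γ i))
  | _, _, _, .one _ => 𝟙 _
  | _, _, _, .snoc t s => s.ten I ≫ t.ten I ▷ _

theorem MultiShuffle.tenIso_mor (I : G → C) {n : ℕ} {Γ : Fin (n + 1) → Ctx G} {E : Ctx G}
    (s : MultiShuffle n Γ E) : (Ctx.tenIso I E).hom ≫ s.mor I =
      s.ten I ≫ famTensorMap n fun i => (Ctx.tenIso I (Γ i)).hom := by
  induction s with
  | one Γ => exact (Category.comp_id _).trans (Category.id_comp _).symm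
  | snoc t s ih =>
    have key : ∀ {E E' X X' Y Y' F F' : C} (e : E ⟶ E') (s' : E' ⟶ F' ⊗ Y') (s : E ⟶ F ⊗ Y)
        (f : F ⟶ F') (y : Y ⟶ Y') (t' : F' ⟶ X') (t : F ⟶ X) (x : X ⟶ X'),
        e ≫ s' = s ≫ (f ⊗ₘ y) → f ≫ t' = t ≫ x →
        e ≫ s' ≫ t' ▷ _ = (s ≫ t ▷ _) ≫ (x ⊗ₘ y) := by
      intro E E' X X' Y Y' F F' e s' s f y t' t x h h'
      rw [reassoc_of% h, Category.assoc, ← tensorHom_id, ← tensorHom_id, tensorHom_comp_tensorHom,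
        tensorHom_comp_tensorHom, h', Category.comp_id, Category.id_comp]
    exact key _ _ _ _ _ _ _ _ (s.tenIso_mor I) ih

/-- Renaming of the variables of a multiple shuffle. -/
def MultiShuffle.ren (ρ : ℕ → ℕ) : {n : ℕ} → {Γ : Fin (n + 1) → Ctx G} → {E : Ctx G} →
    MultiShuffle n Γ E →
      MultiShuffle n (fun i => (Γ i).map fun p => (ρ p.1, p.2)) (E.map fun p => (ρ p.1, p.2))
  | _, _, _, .one Γ => .one fun i => (Γ i).map fun p => (ρ p.1, p.2)
  | _, _, _, .snoc t s => .snoc (t.ren ρ) (s.ren ρ)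

theorem MultiShuffle.ten_ren (I : G → C) (ρ : ℕ → ℕ) {n : ℕ} {Γ : Fin (n + 1) → Ctx G}
    {E : Ctx G} (s : MultiShuffle n Γ E) :
    (s.ren ρ).ten I ≫ famTensorMap n (fun _ => Ctx.tenCast I (Ctx.sameTypes_ren ρ)) =
      Ctx.tenCast I (Ctx.sameTypes_ren ρ) ≫ s.ten I := by
  induction s with
  | one Γ => exact (Category.id_comp _).trans (Category.comp_id _).symm
  | snoc t s ih =>
    have key : ∀ {E E' X X' Y Y' F F' : C} (e : E ⟶ E') (s' : E' ⟶ F' ⊗ Y') (s : E ⟶ F ⊗ Y)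
        (f : F ⟶ F') (y : Y ⟶ Y') (t' : F' ⟶ X') (t : F ⟶ X) (x : X ⟶ X'),
        s ≫ (f ⊗ₘ y) = e ≫ s' → t ≫ x = f ≫ t' →
        (s ≫ t ▷ _) ≫ (x ⊗ₘ y) = e ≫ s' ≫ t' ▷ _ := by
      intro E E' X X' Y Y' F F' e s' s f y t' t x h h'
      rw [← reassoc_of% h, Category.assoc, ← tensorHom_id, ← tensorHom_id,
        tensorHom_comp_tensorHom, tensorHom_comp_tensorHom, h', Category.comp_id,
        Category.id_comp]
    exact key _ _ _ _ _ _ _ _ (s.ten_ren I ρ) ih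

end Shuffles

end VLambda

/-! ### The interpretation as a functional relation on judgements -/

namespace VLambda

set_option linter.unusedSectionVars false

/-! ### Semantics relative to the tensor products that start with the unit object -/

section Combinators

variable {C : Type u₄} [Category.{v₄} C] [MonoidalCategory C] [SymmetricCategory C]

/-- The interpretation of `v to ∗. w`. -/
def toStarHom {E X Y Z : C} (s : E ⟶ X ⊗ Y) (f : X ⟶ 𝟙_ C) (g : Y ⟶ Z) : E ⟶ Z :=
  s ≫ f ▷ _ ≫ (λ_ _).hom ≫ g

/-- The interpretation of `v ⊗ w`. -/
def tenHom {E X Y Z W : C} (s : E ⟶ X ⊗ Y) (f : X ⟶ Z) (g : Y ⟶ W) : E ⟶ Z ⊗ W := s ≫ (f ⊗ₘ g)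

/-- The interpretation of `pm v to x ⊗ y. w`. -/
def pmHom {E X Y A B Z : C} (s : E ⟶ X ⊗ Y) (f : X ⟶ A ⊗ B) (g : (Y ⊗ A) ⊗ B ⟶ Z) : E ⟶ Z :=
  s ≫ f ▷ _ ≫ (β_ _ _).hom ≫ (α_ _ _ _).inv ≫ g

/-- Naturality of a term former with respect to a square of splittings. The same form serves three
times, with `e` the comparison `Ctx.tenIso`, the cast of a renaming, and the interpretation of a
substitution. -/
theorem toStarHom_comp {E E' X X' Y Y' Z : C} {e : E ⟶ E'} {m : E' ⟶ X' ⊗ Y'} {s : E ⟶ X ⊗ Y}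
    {a : X ⟶ X'} {b : Y ⟶ Y'} (h : e ≫ m = s ≫ (a ⊗ₘ b)) (f : X' ⟶ 𝟙_ C) (g : Y' ⟶ Z) :
    toStarHom s (a ≫ f) (b ≫ g) = e ≫ toStarHom m f g := by
  rw [toStarHom, toStarHom, reassoc_of% h, MonoidalCategory.tensorHom_def]
  simp only [comp_whiskerRight, Category.assoc, ← leftUnitor_naturality_assoc,
    whisker_exchange_assoc]

theorem tenHom_comp {E E' X X' Y Y' Z W : C} {e : E ⟶ E'} {m : E' ⟶ X' ⊗ Y'} {s : E ⟶ X ⊗ Y}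
    {a : X ⟶ X'} {b : Y ⟶ Y'} (h : e ≫ m = s ≫ (a ⊗ₘ b)) (f : X' ⟶ Z) (g : Y' ⟶ W) :
    tenHom s (a ≫ f) (b ≫ g) = e ≫ tenHom m f g := by
  rw [tenHom, tenHom, reassoc_of% h, tensorHom_comp_tensorHom]

theorem pmHom_comp {E E' X X' Y Y' A B Z : C} {e : E ⟶ E'} {m : E' ⟶ X' ⊗ Y'} {s : E ⟶ X ⊗ Y}
    {a : X ⟶ X'} {b : Y ⟶ Y'} (h : e ≫ m = s ≫ (a ⊗ₘ b)) (f : X' ⟶ A ⊗ B)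
    (g : (Y' ⊗ A) ⊗ B ⟶ Z) :
    pmHom s (a ≫ f) (b ▷ A ▷ B ≫ g) = e ≫ pmHom m f g := by
  rw [pmHom, pmHom, reassoc_of% h, MonoidalCategory.tensorHom_def]
  simp only [comp_whiskerRight, Category.assoc, ← associator_inv_naturality_left_assoc,
    ← BraidedCategory.braiding_naturality_right_assoc, whisker_exchange_assoc]

variable [MonoidalClosed C]

/-- The interpretation of `v w`. -/
def appliedHom {E X Y Z W : C} (s : E ⟶ X ⊗ Y) (f : X ⟶ (ihom Z).obj W) (g : Y ⟶ Z) : E ⟶ W :=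
  s ≫ (f ⊗ₘ g) ≫ appHom Z W

theorem appliedHom_comp {E E' X X' Y Y' Z W : C} {e : E ⟶ E'} {m : E' ⟶ X' ⊗ Y'}
    {s : E ⟶ X ⊗ Y} {a : X ⟶ X'} {b : Y ⟶ Y'} (h : e ≫ m = s ≫ (a ⊗ₘ b))
    (f : X' ⟶ (ihom Z).obj W) (g : Y' ⟶ Z) :
    appliedHom s (a ≫ f) (b ≫ g) = e ≫ appliedHom m f g := by
  rw [appliedHom, appliedHom, reassoc_of% h, tensorHom_comp_tensorHom_assoc]

theorem famTensorMap_comp : ∀ (n : ℕ) {X Y Z : Fin (n + 1) → C} (f : ∀ i, X i ⟶ Y i)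
    (g : ∀ i, Y i ⟶ Z i),
    famTensorMap n (fun i => f i ≫ g i) = famTensorMap n f ≫ famTensorMap n g
  | 0, _, _, _, _, _ => rfl
  | n + 1, _, _, _, f, g => by
      rw [famTensorMap, famTensorMap_comp n, ← tensorHom_comp_tensorHom]
      rfl

end Combinators

section Semantics

variable {G : Type u₁} {S : Signature.{u₁, u₂} G}
variable {C : Type u₄} [Category.{v₄} C] [MonoidalCategory C] [SymmetricCategory C]
  [MonoidalClosed C]

theorem Ctx.sameTypes_binder₂ (A B : Ty G) (Γ : Ctx G) :
    Ctx.SameTypes ((0, B) :: (1, A) :: Γ) ((0, B) :: (1, A) :: Γ.shift 2) :=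
  ((Ctx.sameTypes_shift 2 Γ).cons 1 1 A).cons 0 0 B

theorem Ctx.sameTypes_binder (A : Ty G) (Γ : Ctx G) :
    Ctx.SameTypes ((0, A) :: Γ) ((0, A) :: Γ.shift 1) :=
  (Ctx.sameTypes_shift 1 Γ).cons 0 0 A

/-- `Sem M Γ v A f` means that `f` is the interpretation of `Γ ▷ v : A`, precomposed with the
comparison `Ctx.tenIso`. -/
inductive Sem (M : Interpretation S C) : (Γ : Ctx G) → Tm S → (A : Ty G) →
    (Γ.ten M.ground ⟶ A.interp M.ground) → Prop
  | op {E : Ctx G} (f : S.Op) {v : Fin (S.pred f + 1) → Tm S} {Γ : Fin (S.pred f + 1) → Ctx G}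
      {g : ∀ i, (Γ i).ten M.ground ⟶ (S.dom f i).interp M.ground}
      (d : ∀ i, Sem M (Γ i) (v i) (S.dom f i) (g i)) (s : MultiShuffle (S.pred f) Γ E)
      (hE : E.Distinct) :
      Sem M E (.op f v) (S.cod f) (s.ten M.ground ≫ famTensorMap (S.pred f) g ≫ M.op f)
  | var (x : ℕ) (A : Ty G) : Sem M [(x, A)] (.var x) A (λ_ (A.interp M.ground)).hom
  | star : Sem M [] .star .unit (𝟙 (𝟙_ C))
  | toStar {Γ Δ E : Ctx G} {v w : Tm S} {A : Ty G} {f : Γ.ten M.ground ⟶ 𝟙_ C}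
      {g : Δ.ten M.ground ⟶ A.interp M.ground} (d : Sem M Γ v .unit f) (e : Sem M Δ w A g)
      (s : Shuffle Γ Δ E) (hE : E.Distinct) :
      Sem M E (.toStar v w) A (toStarHom (s.ten M.ground) f g)
  | ten {Γ Δ E : Ctx G} {v w : Tm S} {A B : Ty G} {f : Γ.ten M.ground ⟶ A.interp M.ground}
      {g : Δ.ten M.ground ⟶ B.interp M.ground} (d : Sem M Γ v A f) (e : Sem M Δ w B g)
      (s : Shuffle Γ Δ E) (hE : E.Distinct) :
      Sem M E (.ten v w) (.tensor A B) (tenHom (s.ten M.ground) f g)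
  | pm {Γ Δ E : Ctx G} {v w : Tm S} {A B D : Ty G}
      {f : Γ.ten M.ground ⟶ A.interp M.ground ⊗ B.interp M.ground}
      {g : Ctx.ten M.ground ((0, B) :: (1, A) :: Δ.shift 2) ⟶ D.interp M.ground}
      (d : Sem M Γ v (.tensor A B) f) (e : Sem M ((0, B) :: (1, A) :: Δ.shift 2) w D g)
      (s : Shuffle Γ Δ E) (hE : E.Distinct) :
      Sem M E (.pm v w) D (pmHom (s.ten M.ground) f
        (Ctx.tenCast M.ground (Ctx.sameTypes_binder₂ A B Δ) ≫ g))
  | lam {Γ : Ctx G} {v : Tm S} {A B : Ty G}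
      {f : Ctx.ten M.ground ((0, A) :: Γ.shift 1) ⟶ B.interp M.ground}
      (d : Sem M ((0, A) :: Γ.shift 1) v B f) :
      Sem M Γ (.lam A v) (.lolli A B)
        (curryHom (Ctx.tenCast M.ground (Ctx.sameTypes_binder A Γ) ≫ f))
  | app {Γ Δ E : Ctx G} {v w : Tm S} {A B : Ty G}
      {f : Γ.ten M.ground ⟶ (ihom (A.interp M.ground)).obj (B.interp M.ground)}
      {g : Δ.ten M.ground ⟶ A.interp M.ground} (d : Sem M Γ v (.lolli A B) f)
      (e : Sem M Δ w A g) (s : Shuffle Γ Δ E) (hE : E.Distinct) :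
      Sem M E (.app v w) B (appliedHom (s.ten M.ground) f g)

variable {M : Interpretation S C}

theorem Sem.of_eq {Γ : Ctx G} {v : Tm S} {A : Ty G}
    {f g : Γ.ten M.ground ⟶ A.interp M.ground} (h : Sem M Γ v A f) (e : f = g) :
    Sem M Γ v A g := e ▸ h

theorem Sem.distinct {Γ : Ctx G} {v : Tm S} {A : Ty G}
    {f : Γ.ten M.ground ⟶ A.interp M.ground} (h : Sem M Γ v A f) : Γ.Distinct := by
  induction h with
  | op _ _ _ hE => exact hE
  | var => simp [Ctx.Distinct]
  | star => simp [Ctx.Distinct]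
  | toStar _ _ _ hE => exact hE
  | ten _ _ _ hE => exact hE
  | pm _ _ _ hE => exact hE
  | lam _ ih => exact distinct_of_cons ih
  | app _ _ _ hE => exact hE

theorem Ctx.tenIso_joinBinder (I : G → C) (Γ : Ctx G) (A : Ty G) :
    (Ctx.tenIso I Γ).hom ▷ A.interp I ≫ joinBinder I Γ A =
      Ctx.tenCast I (Ctx.sameTypes_binder A Γ) ≫ (Ctx.tenIso I ((0, A) :: Γ.shift 1)).hom := by
  have key : ∀ {X X' Y Y' Z J : C} (t : X ⟶ Y) (e : Y ⟶ Y') (j' : Y' ⊗ Z ⟶ J) (c : X ⟶ X')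
      (t' : X' ⟶ Y') (c' : X ⊗ Z ⟶ X' ⊗ Z), t ≫ e = c ≫ t' → c' = c ▷ Z →
      t ▷ Z ≫ e ▷ Z ≫ j' = c' ≫ t' ▷ Z ≫ j' := by
    rintro X X' Y Y' Z J t e j' c t' _ h rfl
    rw [← comp_whiskerRight_assoc c, ← h]
    simp
  exact key _ _ _ _ _ _ (Ctx.tenIso_shift I 1 Γ) (Ctx.tenCast_cons I 0 0 A _ _)

theorem Ctx.tenIso_joinBinder₂ (I : G → C) (Γ : Ctx G) (A B : Ty G) :
    (Ctx.tenIso I Γ).hom ▷ A.interp I ▷ B.interp I ≫ joinBinder₂ I Γ A B =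
      Ctx.tenCast I (Ctx.sameTypes_binder₂ A B Γ) ≫
        (Ctx.tenIso I ((0, B) :: (1, A) :: Γ.shift 2)).hom := by
  have key : ∀ {X X' Y Y' Z W J J' : C} (t : X ⟶ Y) (e : Y ⟶ Y') (j : Y' ⊗ Z ⟶ J)
      (j' : J ⊗ W ⟶ J') (c : X ⟶ X') (t' : X' ⟶ Y') (c' : X ⊗ Z ⟶ X' ⊗ Z)
      (c'' : (X ⊗ Z) ⊗ W ⟶ (X' ⊗ Z) ⊗ W), t ≫ e = c ≫ t' → c' = c ▷ Z → c'' = c' ▷ W →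
      t ▷ Z ▷ W ≫ (e ▷ Z ≫ j) ▷ W ≫ j' = c'' ≫ (t' ▷ Z ≫ j) ▷ W ≫ j' := by
    rintro X X' Y Y' Z W J J' t e j j' c t' _ _ h rfl rfl
    rw [← comp_whiskerRight_assoc, ← comp_whiskerRight_assoc, ← comp_whiskerRight_assoc,
      ← comp_whiskerRight_assoc, h]
  exact key _ _ _ _ _ _ _ _ (Ctx.tenIso_shift I 2 Γ)
    (Ctx.tenCast_cons I 1 1 A (Ctx.sameTypes_shift 2 Γ)
      ((Ctx.sameTypes_shift 2 Γ).cons 1 1 A)) (Ctx.tenCast_cons I 0 0 B _ _)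

/-- The interpretation of derivations satisfies the relation `Sem`. -/
theorem Der.sem (M : Interpretation S C) {Γ : Ctx G} {v : Tm S} {A : Ty G} (d : Der Γ v A) :
    Sem M Γ v A ((Ctx.tenIso M.ground Γ).hom ≫ d.interp M) := by
  induction d with
  | op f d s hE ih =>
    refine (Sem.op f ih s hE).of_eq ?_
    rw [famTensorMap_comp, Category.assoc, ← Category.assoc, ← s.tenIso_mor, Category.assoc]
    rfl
  | var x A =>
    refine (Sem.var x A).of_eq ?_
    have key : ∀ X : C, (λ_ X).hom = (𝟙 (𝟙_ C) ▷ X ≫ (λ_ X).hom) ≫ 𝟙 X := by simp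
    exact key _
  | star => exact Sem.star.of_eq (Category.comp_id _).symm
  | toStar d e s hE ihd ihe =>
    exact (Sem.toStar ihd ihe s hE).of_eq (toStarHom_comp (s.tenIso_mor _) _ _)
  | ten d e s hE ihd ihe =>
    exact (Sem.ten ihd ihe s hE).of_eq (tenHom_comp (s.tenIso_mor _) _ _)
  | app d e s hE ihd ihe =>
    exact (Sem.app ihd ihe s hE).of_eq (appliedHom_comp (s.tenIso_mor _) _ _)
  | @pm Γ Δ E v w A B D d e s hE ihd ihe =>
    refine (Sem.pm ihd ihe s hE).of_eq ?_
    refine Eq.trans ?_ (pmHom_comp (s.tenIso_mor _) _ (joinBinder₂ M.ground _ _ _ ≫ e.interp M))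
    rw [reassoc_of% Ctx.tenIso_joinBinder₂]
    exact congrArg _ (Category.assoc _ _ _).symm
  | @lam Γ v A B d ih =>
    refine (Sem.lam ih).of_eq ?_
    refine Eq.trans ?_ (curryHom_comp_left _ _).symm
    rw [reassoc_of% Ctx.tenIso_joinBinder]
    exact congrArg _ (Category.assoc _ _ _).symm

/-! ### Uniqueness of the interpretation -/

/-- The variable `x` is free in the term. -/
def Tm.Free : Tm S → ℕ → Prop
  | .var n, x => x = n
  | .op _ v, x => ∃ i, (v i).Free x
  | .star, _ => False
  | .toStar v w, x => v.Free x ∨ w.Free x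
  | .ten v w, x => v.Free x ∨ w.Free x
  | .pm v w, x => v.Free x ∨ w.Free (x + 2)
  | .lam _ v, x => v.Free (x + 1)
  | .app v w, x => v.Free x ∨ w.Free x

theorem Shuffle.mem_names {Γ Δ E : Ctx G} (s : Shuffle Γ Δ E) (x : ℕ) :
    x ∈ E.map Prod.fst ↔ x ∈ Γ.map Prod.fst ∨ x ∈ Δ.map Prod.fst := by
  rw [(s.perm.map Prod.fst).mem_iff, List.map_append, List.mem_append]

theorem mem_names_flat (x : ℕ) : ∀ {n : ℕ} {Γ : Fin (n + 1) → Ctx G},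
    x ∈ (flat n Γ).map Prod.fst ↔ ∃ i, x ∈ (Γ i).map Prod.fst
  | 0, Γ => ⟨fun h => ⟨0, h⟩, fun ⟨i, h⟩ => by obtain rfl := Fin.fin_one_eq_zero i; exact h⟩
  | n + 1, Γ => by
      rw [flat, List.map_append, List.mem_append, mem_names_flat x]
      exact (Fin.exists_fin_succ' (P := fun i => x ∈ (Γ i).map Prod.fst)).symm

theorem Ctx.mem_names_shift (k x : ℕ) (Γ : Ctx G) :
    x + k ∈ (Γ.shift k).map Prod.fst ↔ x ∈ Γ.map Prod.fst := by
  simp [Ctx.shift]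

/-- Linearity: no weakening and no contraction. The term thus determines which variables of a
context go to which subterm. -/
theorem Sem.mem_names {Γ : Ctx G} {v : Tm S} {A : Ty G}
    {f : Γ.ten M.ground ⟶ A.interp M.ground} (h : Sem M Γ v A f) :
    ∀ x, x ∈ Γ.map Prod.fst ↔ v.Free x := by
  induction h with
  | op f d s hE ih =>
    intro x
    rw [(s.perm.map Prod.fst).mem_iff, mem_names_flat]
    exact exists_congr fun i => ih i x
  | var => simp [Tm.Free]
  | star => simp [Tm.Free]
  | toStar _ _ s _ hd he | ten _ _ s _ hd he | app _ _ s _ hd he =>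
    intro x
    rw [s.mem_names, hd, he]
    rfl
  | pm _ _ s _ hd he =>
    intro x
    have := he (x + 2)
    rw [List.map_cons, List.map_cons, List.mem_cons, List.mem_cons, Ctx.mem_names_shift] at this
    simp only [Nat.add_eq_zero_iff, OfNat.ofNat_ne_zero, and_false, false_or] at this
    rw [s.mem_names, hd, Tm.Free, ← this]
    simp
  | lam _ ih =>
    intro x
    have := ih (x + 1)
    rw [List.map_cons, List.mem_cons, Ctx.mem_names_shift] at this
    rw [Tm.Free, ← this]
    simp

/-- As names are distinct, the side to which each head belongs can be read off from the set of names
on the left. -/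
theorem Shuffle.unique {Γ Δ E : Ctx G} (s : Shuffle Γ Δ E) : ∀ {Γ' Δ' : Ctx G}
    (s' : Shuffle Γ' Δ' E), E.Distinct →
    (∀ x, x ∈ Γ.map Prod.fst ↔ x ∈ Γ'.map Prod.fst) →
      Γ = Γ' ∧ Δ = Δ' ∧ s ≍ s' := by
  induction s with
  | nil =>
    intro Γ' Δ' s' _ _
    cases s'
    exact ⟨rfl, rfl, HEq.rfl⟩
  | @left Γ Δ E p s ih =>
    intro Γ' Δ' s' hE h
    have hE' := List.nodup_cons.1 (show (p.1 :: E.map Prod.fst).Nodup from hE)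
    cases s' with
    | @left Γ' _ _ _ s' =>
      obtain ⟨rfl, rfl, hs⟩ := ih s' hE'.2 (by
        intro x
        have := h x
        simp only [List.map_cons, List.mem_cons] at this
        by_cases hx : x = p.1
        · subst hx
          exact ⟨fun h => absurd ((s.mem_names _).2 (.inl h)) hE'.1,
            fun h => absurd ((s'.mem_names _).2 (.inl h)) hE'.1⟩
        · simpa [hx] using this)
      obtain rfl := eq_of_heq hs
      exact ⟨rfl, rfl, HEq.rfl⟩
    | right _ s' =>
      exact absurd ((s'.mem_names _).2 (.inl ((h p.1).1 List.mem_cons_self))) hE'.1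
  | @right Γ Δ E p s ih =>
    intro Γ' Δ' s' hE h
    have hE' := List.nodup_cons.1 (show (p.1 :: E.map Prod.fst).Nodup from hE)
    cases s' with
    | left _ s' =>
      exact absurd ((s.mem_names _).2 (.inl ((h p.1).2 List.mem_cons_self))) hE'.1
    | right _ s' =>
      obtain ⟨rfl, rfl, hs⟩ := ih s' hE'.2 h
      obtain rfl := eq_of_heq hs
      exact ⟨rfl, rfl, HEq.rfl⟩

theorem MultiShuffle.eq_one : ∀ {Γ : Fin 1 → Ctx G} {E : Ctx G} (s : MultiShuffle 0 Γ E),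
    E = Γ 0 ∧ s ≍ MultiShuffle.one Γ
  | _, _, .one _ => ⟨rfl, HEq.rfl⟩

theorem MultiShuffle.unique {n : ℕ} {Γ : Fin (n + 1) → Ctx G} {E : Ctx G}
    (s : MultiShuffle n Γ E) : ∀ {Γ' : Fin (n + 1) → Ctx G} (s' : MultiShuffle n Γ' E),
    E.Distinct → (∀ i x, x ∈ (Γ i).map Prod.fst ↔ x ∈ (Γ' i).map Prod.fst) →
      Γ = Γ' ∧ s ≍ s' := by
  induction s with
  | one Γ =>
    intro Γ' s' _ _
    obtain ⟨h, hs⟩ := s'.eq_one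
    have : Γ = Γ' := by
      funext i
      obtain rfl := Fin.fin_one_eq_zero i
      exact h
    subst this
    exact ⟨rfl, hs.symm⟩
  | @snoc n Γ F E t s ih =>
    intro Γ' s' hE h
    cases s' with
    | @snoc _ _ F' _ t' s' =>
      have hF : ∀ x, x ∈ F.map Prod.fst ↔ x ∈ F'.map Prod.fst := by
        intro x
        rw [(t.perm.map Prod.fst).mem_iff, (t'.perm.map Prod.fst).mem_iff, mem_names_flat,
          mem_names_flat]
        exact exists_congr fun i => h _ x
      obtain ⟨rfl, hl, hs⟩ := s.unique s' hE hF
      obtain ⟨hi, ht⟩ := ih t' (s.distinct hE).1 fun i => h _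
      have : Γ = Γ' := by
        funext i
        exact Fin.lastCases hl (fun j => congrFun hi j) i
      subst this
      obtain rfl := eq_of_heq ht
      obtain rfl := eq_of_heq hs
      exact ⟨rfl, HEq.rfl⟩

/-- Coherence: the morphism depends on the judgement only. Uniqueness of the type has to be part of
the induction, because the type of a matched pair or of an argument is not visible in the term; the
annotation of `λ` makes it inferable. -/
theorem Sem.unique {Γ : Ctx G} {v : Tm S} {A : Ty G} {f : Γ.ten M.ground ⟶ A.interp M.ground}
    (h : Sem M Γ v A f) : ∀ {A' : Ty G} {f' : Γ.ten M.ground ⟶ A'.interp M.ground},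
      Sem M Γ v A' f' → A = A' ∧ f ≍ f' := by
  induction h with
  | op f d s hE ih =>
    intro A' f' h'
    cases h' with
    | op _ d' s' _ =>
      obtain ⟨rfl, hs⟩ := s.unique s' hE fun i x => by rw [(d i).mem_names, (d' i).mem_names]
      obtain rfl := eq_of_heq hs
      refine ⟨rfl, heq_of_eq ?_⟩
      congr 3
      funext i
      exact eq_of_heq (ih i (d' i)).2
  | var x A => intro A' f' h'; cases h'; exact ⟨rfl, HEq.rfl⟩
  | star => intro A' f' h'; cases h'; exact ⟨rfl, HEq.rfl⟩
  | toStar d e s hE ihd ihe =>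
    intro A' f' h'
    cases h' with
    | toStar d' e' s' _ =>
      obtain ⟨rfl, rfl, hs⟩ := s.unique s' hE fun x => by rw [d.mem_names, d'.mem_names]
      obtain rfl := eq_of_heq hs
      obtain ⟨-, h₁⟩ := ihd d'
      obtain ⟨rfl, h₂⟩ := ihe e'
      obtain rfl := eq_of_heq h₁
      obtain rfl := eq_of_heq h₂
      exact ⟨rfl, HEq.rfl⟩
  | ten d e s hE ihd ihe =>
    intro A' f' h'
    cases h' with
    | ten d' e' s' _ =>
      obtain ⟨rfl, rfl, hs⟩ := s.unique s' hE fun x => by rw [d.mem_names, d'.mem_names]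
      obtain rfl := eq_of_heq hs
      obtain ⟨rfl, h₁⟩ := ihd d'
      obtain ⟨rfl, h₂⟩ := ihe e'
      obtain rfl := eq_of_heq h₁
      obtain rfl := eq_of_heq h₂
      exact ⟨rfl, HEq.rfl⟩
  | pm d e s hE ihd ihe =>
    intro A' f' h'
    cases h' with
    | pm d' e' s' _ =>
      obtain ⟨rfl, rfl, hs⟩ := s.unique s' hE fun x => by rw [d.mem_names, d'.mem_names]
      obtain rfl := eq_of_heq hs
      obtain ⟨h₀, h₁⟩ := ihd d'
      cases h₀
      obtain ⟨rfl, h₂⟩ := ihe e'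
      obtain rfl := eq_of_heq h₁
      obtain rfl := eq_of_heq h₂
      exact ⟨rfl, HEq.rfl⟩
  | lam d ih =>
    intro A' f' h'
    cases h' with
    | lam d' =>
      obtain ⟨rfl, h⟩ := ih d'
      obtain rfl := eq_of_heq h
      exact ⟨rfl, HEq.rfl⟩
  | app d e s hE ihd ihe =>
    intro A' f' h'
    cases h' with
    | app d' e' s' _ =>
      obtain ⟨rfl, rfl, hs⟩ := s.unique s' hE fun x => by rw [d.mem_names, d'.mem_names]
      obtain rfl := eq_of_heq hs
      obtain ⟨h₀, h₁⟩ := ihd d'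
      cases h₀
      obtain ⟨-, h₂⟩ := ihe e'
      obtain rfl := eq_of_heq h₁
      obtain rfl := eq_of_heq h₂
      exact ⟨rfl, HEq.rfl⟩

theorem Sem.eq {Γ : Ctx G} {v : Tm S} {A : Ty G} {f f' : Γ.ten M.ground ⟶ A.interp M.ground}
    (h : Sem M Γ v A f) (h' : Sem M Γ v A f') : f = f' := eq_of_heq (h.unique h').2

theorem Typed.exists_sem (M : Interpretation S C) {Γ : Ctx G} {v : Tm S} {A : Ty G}
    (h : Typed Γ v A) : ∃ f, Sem M Γ v A f := h.elim fun d => ⟨_, d.sem M⟩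

end Semantics

end VLambda

/-! ### Renaming, substitution and exchange in the interpretation -/

namespace VLambda

set_option linter.unusedSectionVars false

variable {G : Type u₁} {S : Signature.{u₁, u₂} G}
variable {C : Type u₄} [Category.{v₄} C] [MonoidalCategory C] [SymmetricCategory C]
  [MonoidalClosed C] {M : Interpretation S C}

/-! ### Renaming -/

/-- Renaming of the variables of a context. -/
abbrev Ctx.ren (ρ : ℕ → ℕ) (Γ : Ctx G) : Ctx G := Γ.map fun p => (ρ p.1, p.2)

theorem Sem.cast {Γ Γ' : Ctx G} {v : Tm S} {A : Ty G} {f : Γ.ten M.ground ⟶ A.interp M.ground}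
    (h : Sem M Γ v A f) (e : Γ' = Γ) (t : Γ'.SameTypes Γ) :
    Sem M Γ' v A (Ctx.tenCast M.ground t ≫ f) := by
  subst e
  exact h.of_eq (Category.id_comp f).symm

theorem Ctx.ren_binder (ρ : ℕ → ℕ) (A : Ty G) (Γ : Ctx G) :
    ((0, A) :: Ctx.shift 1 (Γ.ren ρ)) = Ctx.ren (upRen ρ) ((0, A) :: Γ.shift 1) := by
  simp [Ctx.ren, Ctx.shift, upRen, Function.comp_def]

theorem Ctx.ren_binder₂ (ρ : ℕ → ℕ) (A B : Ty G) (Γ : Ctx G) :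
    ((0, B) :: (1, A) :: Ctx.shift 2 (Γ.ren ρ)) =
      Ctx.ren (upRen (upRen ρ)) ((0, B) :: (1, A) :: Γ.shift 2) := by
  simp [Ctx.ren, Ctx.shift, upRen, Function.comp_def]

theorem Ctx.tenCast_whisker_binder (I : G → C) {Γ Δ : Ctx G} (A : Ty G) (h : Γ.SameTypes Δ)
    (h' : Ctx.SameTypes ((0, A) :: Γ.shift 1) ((0, A) :: Δ.shift 1)) {X : C}
    (f : Ctx.ten I ((0, A) :: Δ.shift 1) ⟶ X) :
    Ctx.tenCast I (Ctx.sameTypes_binder A Γ) ≫ Ctx.tenCast I h' ≫ f =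
      (Ctx.tenCast I h ▷ A.interp I ≫ Ctx.tenCast I (Ctx.sameTypes_binder A Δ) ≫ f :
        Ctx.ten I Γ ⊗ A.interp I ⟶ X) := by
  rw [Ctx.tenCast_comp_assoc]
  refine Eq.trans ?_ (congrArg (· ≫ _) (Ctx.tenCast_cons I 0 0 A h (h.cons 0 0 A)))
  exact (Ctx.tenCast_comp_assoc I _ _ f).symm

theorem Ctx.tenCast_whisker_binder₂ (I : G → C) {Γ Δ : Ctx G} (A B : Ty G) (h : Γ.SameTypes Δ)
    (h' : Ctx.SameTypes ((0, B) :: (1, A) :: Γ.shift 2) ((0, B) :: (1, A) :: Δ.shift 2)) {X : C}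
    (f : Ctx.ten I ((0, B) :: (1, A) :: Δ.shift 2) ⟶ X) :
    Ctx.tenCast I (Ctx.sameTypes_binder₂ A B Γ) ≫ Ctx.tenCast I h' ≫ f =
      (Ctx.tenCast I h ▷ A.interp I ▷ B.interp I ≫
        Ctx.tenCast I (Ctx.sameTypes_binder₂ A B Δ) ≫ f :
          (Ctx.ten I Γ ⊗ A.interp I) ⊗ B.interp I ⟶ X) := by
  rw [Ctx.tenCast_comp_assoc]
  refine Eq.trans ?_ (congrArg (· ≫ _) ((Ctx.tenCast_cons I 0 0 B (h.cons 1 1 A)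
    ((h.cons 1 1 A).cons 0 0 B)).trans
      (congrArg (· ▷ B.interp I) (Ctx.tenCast_cons I 1 1 A h (h.cons 1 1 A)))))
  exact (Ctx.tenCast_comp_assoc I _ _ f).symm

/-- Renaming precedes substitution because a substitution that is pushed under a binder shifts its
terms. Injectivity keeps the names distinct. -/
theorem Sem.rename {Γ : Ctx G} {v : Tm S} {A : Ty G} {f : Γ.ten M.ground ⟶ A.interp M.ground}
    (h : Sem M Γ v A f) : ∀ {ρ : ℕ → ℕ}, ρ.Injective →
      Sem M (Γ.ren ρ) (v.rename ρ) A (Ctx.tenCast M.ground (Ctx.sameTypes_ren ρ) ≫ f) := by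
  induction h with
  | op f d s hE ih =>
    intro ρ hρ
    refine (Sem.op f (fun i => ih i hρ) (s.ren ρ) (map_distinct hρ hE)).of_eq ?_
    rw [famTensorMap_comp, Category.assoc, ← Category.assoc, s.ten_ren, Category.assoc]
  | var x A => intro ρ _; exact (Sem.var (ρ x) A).of_eq (Category.id_comp _).symm
  | star => intro ρ _; exact Sem.star.of_eq (Category.id_comp _).symm
  | toStar d e s hE ihd ihe =>
    intro ρ hρ
    exact (Sem.toStar (ihd hρ) (ihe hρ) (s.ren ρ) (map_distinct hρ hE)).of_eq
      (toStarHom_comp (s.ten_ren _ ρ).symm _ _)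
  | ten d e s hE ihd ihe =>
    intro ρ hρ
    exact (Sem.ten (ihd hρ) (ihe hρ) (s.ren ρ) (map_distinct hρ hE)).of_eq
      (tenHom_comp (s.ten_ren _ ρ).symm _ _)
  | app d e s hE ihd ihe =>
    intro ρ hρ
    exact (Sem.app (ihd hρ) (ihe hρ) (s.ren ρ) (map_distinct hρ hE)).of_eq
      (appliedHom_comp (s.ten_ren _ ρ).symm _ _)
  | @pm Γ Δ E v w A B D f g d e s hE ihd ihe =>
    intro ρ hρ
    have hb := Ctx.ren_binder₂ ρ A B Δ
    have ht : Ctx.SameTypes ((0, B) :: (1, A) :: Ctx.shift 2 (Δ.ren ρ)) _ :=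
      (congrArg (List.map Prod.snd) hb : _)
    refine (Sem.pm (ihd hρ) ((ihe (upRen_injective (upRen_injective hρ))).cast hb ht)
      (s.ren ρ) (map_distinct hρ hE)).of_eq ?_
    refine Eq.trans ?_ (pmHom_comp (s.ten_ren _ ρ).symm _ _)
    rw [Ctx.tenCast_comp_assoc M.ground ht]
    exact congrArg _ (Ctx.tenCast_whisker_binder₂ M.ground A B (Ctx.sameTypes_ren ρ) _ g)
  | @lam Γ v A B f d ih =>
    intro ρ hρ
    have hb := Ctx.ren_binder ρ A Γ
    have ht : Ctx.SameTypes ((0, A) :: Ctx.shift 1 (Γ.ren ρ)) _ :=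
      (congrArg (List.map Prod.snd) hb : _)
    refine (Sem.lam ((ih (upRen_injective hρ)).cast hb ht)).of_eq ?_
    refine Eq.trans ?_ (curryHom_comp_left _ _).symm
    rw [Ctx.tenCast_comp_assoc M.ground ht]
    exact congrArg _ (Ctx.tenCast_whisker_binder M.ground A (Ctx.sameTypes_ren ρ) _ f)

/-! ### Interpretation of substitutions -/

/-- `Env M σ E Γ m` means that `m` is the interpretation of the substitution that replaces each
variable `x` of `Γ` by `σ x`, where `E` is a shuffle of the contexts of these terms. -/
inductive Env (M : Interpretation S C) (σ : ℕ → Tm S) : (E Γ : Ctx G) →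
    (E.ten M.ground ⟶ Γ.ten M.ground) → Prop
  | nil : Env M σ [] [] (𝟙 (𝟙_ C))
  | cons {E Γ Δ E' : Ctx G} {p : ℕ × Ty G} {m : E.ten M.ground ⟶ Γ.ten M.ground}
      {g : Δ.ten M.ground ⟶ p.2.interp M.ground} (e : Env M σ E Γ m)
      (d : Sem M Δ (σ p.1) p.2 g) (s : Shuffle E Δ E') :
      Env M σ E' (p :: Γ) (tenHom (s.ten M.ground) m g)

variable {σ : ℕ → Tm S}

theorem Env.of_eq {E Γ : Ctx G} {m m' : E.ten M.ground ⟶ Γ.ten M.ground} (h : Env M σ E Γ m)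
    (e : m = m') : Env M σ E Γ m' := e ▸ h

theorem tensorHom_tensorSwap {X X' Y Y' Z Z' : C} (f : X ⟶ X') (g : Y ⟶ Y') (h : Z ⟶ Z') :
    ((f ⊗ₘ g) ⊗ₘ h) ≫ tensorSwap X' Y' Z' = tensorSwap X Y Z ≫ ((f ⊗ₘ h) ⊗ₘ g) := by
  rw [tensorSwap, tensorSwap, associator_naturality_assoc, ← id_tensorHom, ← id_tensorHom,
    tensorHom_comp_tensorHom_assoc, BraidedCategory.braiding_naturality, Category.comp_id,
    ← Category.id_comp f, ← tensorHom_comp_tensorHom_assoc, associator_inv_naturality,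
    Category.id_comp, Category.assoc, Category.assoc]

theorem MultiShuffle.distinct {n : ℕ} {Γ : Fin (n + 1) → Ctx G} {E : Ctx G}
    (s : MultiShuffle n Γ E) (h : E.Distinct) (i : Fin (n + 1)) : (Γ i).Distinct := by
  induction s with
  | one Γ =>
    obtain rfl := Fin.fin_one_eq_zero i
    exact h
  | snoc t s ih => exact Fin.lastCases (s.distinct h).2 (fun j => ih (s.distinct h).1 j) i

/-- The induction step of the substitution lemma: each subterm receives the part of the substitution
that concerns its own variables. The context of the newest substituted term joins the left part by
`Shuffle.ten_rightComm` or the right part by `Shuffle.ten_assoc`. -/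
theorem Env.split {Γ₁ Γ₂ Γ : Ctx G} (s : Shuffle Γ₁ Γ₂ Γ) : ∀ {E : Ctx G}
    {m : E.ten M.ground ⟶ Γ.ten M.ground}, Env M σ E Γ m →
      ∃ (E₁ E₂ : Ctx G) (t : Shuffle E₁ E₂ E) (m₁ : E₁.ten M.ground ⟶ Γ₁.ten M.ground)
        (m₂ : E₂.ten M.ground ⟶ Γ₂.ten M.ground), Env M σ E₁ Γ₁ m₁ ∧ Env M σ E₂ Γ₂ m₂ ∧
          m ≫ s.ten M.ground = t.ten M.ground ≫ (m₁ ⊗ₘ m₂) := by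
  induction s with
  | nil =>
    intro E m h
    cases h
    refine ⟨[], [], .nil, 𝟙 _, 𝟙 _, .nil, .nil, (Category.id_comp _).trans ?_⟩
    exact ((congrArg _ (id_tensorHom_id _ _)).trans (Category.comp_id _)).symm
  | left p s ih =>
    intro E m h
    cases h with
    | @cons E₀ _ _ _ _ m g e d sh =>
      obtain ⟨E₁, E₂, t, m₁, m₂, h₁, h₂, hm⟩ := ih e
      obtain ⟨F, t', s', ht⟩ := Shuffle.ten_rightComm M.ground sh t
      refine ⟨F, E₂, t', _, m₂, .cons h₁ d s', h₂, ?_⟩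
      have key : ∀ {E E₀ Γ Γ₁ Γ₂ E₁ E₂ F D P : C} (sh : E ⟶ E₀ ⊗ D) (m : E₀ ⟶ Γ) (g : D ⟶ P)
          (s : Γ ⟶ Γ₁ ⊗ Γ₂) (t : E₀ ⟶ E₁ ⊗ E₂) (t' : E ⟶ F ⊗ E₂) (s' : F ⟶ E₁ ⊗ D)
          (m₁ : E₁ ⟶ Γ₁) (m₂ : E₂ ⟶ Γ₂), m ≫ s = t ≫ (m₁ ⊗ₘ m₂) →
          sh ≫ t ▷ _ ≫ tensorSwap _ _ _ = t' ≫ s' ▷ _ →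
          tenHom sh m g ≫ s ▷ P ≫ tensorSwap _ _ _ = t' ≫ (tenHom s' m₁ g ⊗ₘ m₂) := by
        intro E E₀ Γ Γ₁ Γ₂ E₁ E₂ F D P sh m g s t t' s' m₁ m₂ h h'
        rw [tenHom, tenHom, Category.assoc, ← tensorHom_id s, tensorHom_comp_tensorHom_assoc, h,
          Category.comp_id, ← Category.id_comp g, ← tensorHom_comp_tensorHom_assoc, tensorHom_id,
          tensorHom_tensorSwap, reassoc_of% h', Category.id_comp g, ← tensorHom_id s',
          tensorHom_comp_tensorHom, Category.id_comp]
      exact key _ _ _ _ _ _ _ _ _ hm ht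
  | right p s ih =>
    intro E m h
    cases h with
    | @cons E₀ _ _ _ _ m g e d sh =>
      obtain ⟨E₁, E₂, t, m₁, m₂, h₁, h₂, hm⟩ := ih e
      obtain ⟨F, t', s', ht⟩ := Shuffle.ten_assoc M.ground sh t
      refine ⟨E₁, F, t', m₁, _, h₁, .cons h₂ d s', ?_⟩
      have key : ∀ {E E₀ Γ Γ₁ Γ₂ E₁ E₂ F D P : C} (sh : E ⟶ E₀ ⊗ D) (m : E₀ ⟶ Γ) (g : D ⟶ P)
          (s : Γ ⟶ Γ₁ ⊗ Γ₂) (t : E₀ ⟶ E₁ ⊗ E₂) (t' : E ⟶ E₁ ⊗ F) (s' : F ⟶ E₂ ⊗ D)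
          (m₁ : E₁ ⟶ Γ₁) (m₂ : E₂ ⟶ Γ₂), m ≫ s = t ≫ (m₁ ⊗ₘ m₂) →
          sh ≫ t ▷ _ ≫ (α_ _ _ _).hom = t' ≫ _ ◁ s' →
          tenHom sh m g ≫ s ▷ P ≫ (α_ _ _ _).hom = t' ≫ (m₁ ⊗ₘ tenHom s' m₂ g) := by
        intro E E₀ Γ Γ₁ Γ₂ E₁ E₂ F D P sh m g s t t' s' m₁ m₂ h h'
        rw [tenHom, tenHom, Category.assoc, ← tensorHom_id s, tensorHom_comp_tensorHom_assoc, h,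
          Category.comp_id, ← Category.id_comp g, ← tensorHom_comp_tensorHom_assoc, tensorHom_id,
          associator_naturality, reassoc_of% h', Category.id_comp g]
        rw [← id_tensorHom, tensorHom_comp_tensorHom, Category.id_comp]
      exact key _ _ _ _ _ _ _ _ _ hm ht

theorem Fin.exists_castSucc_last {n : ℕ} {α : Fin (n + 1) → Type*}
    (d : ∀ i : Fin n, α i.castSucc) (d' : α (Fin.last n)) :
    ∃ e : ∀ i, α i, (fun i : Fin n => e i.castSucc) = d ∧ e (Fin.last n) = d' :=
  ⟨Fin.snoc d d', funext fun _ => Fin.snoc_castSucc .., Fin.snoc_last ..⟩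

theorem Env.splitMulti {n : ℕ} {Γs : Fin (n + 1) → Ctx G} {Γ : Ctx G}
    (s : MultiShuffle n Γs Γ) : ∀ {E : Ctx G} {m : E.ten M.ground ⟶ Γ.ten M.ground},
      Env M σ E Γ m → ∃ (d : ∀ i, Σ E : Ctx G, (E.ten M.ground ⟶ (Γs i).ten M.ground))
        (t : MultiShuffle n (fun i => (d i).1) E), (∀ i, Env M σ (d i).1 (Γs i) (d i).2) ∧
          m ≫ s.ten M.ground = t.ten M.ground ≫ famTensorMap n fun i => (d i).2 := by
  induction s with
  | one Γ =>
    intro E m h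
    -- Context and morphism are packed into one pair, so that a family over `Fin 1` with this value
    -- can replace them without transport between contexts.
    suffices H : ∀ x : Σ E : Ctx G, (E.ten M.ground ⟶ (Γ 0).ten M.ground),
        Env M σ x.1 (Γ 0) x.2 →
          ∃ (d : ∀ i, Σ E : Ctx G, (E.ten M.ground ⟶ (Γ i).ten M.ground))
            (t : MultiShuffle 0 (fun i => (d i).1) x.1), (∀ i, Env M σ (d i).1 (Γ i) (d i).2) ∧
              x.2 ≫ (MultiShuffle.one Γ).ten M.ground =
                t.ten M.ground ≫ famTensorMap 0 fun i => (d i).2 from H ⟨E, m⟩ h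
    intro x hx
    obtain ⟨d, rfl⟩ : ∃ d : ∀ i, Σ E : Ctx G, (E.ten M.ground ⟶ (Γ i).ten M.ground), d 0 = x :=
      ⟨Fin.cases x fun i => (Fin.elim0 i : _), rfl⟩
    refine ⟨d, .one fun i => (d i).1, fun i => ?_, ?_⟩
    · obtain rfl := Fin.fin_one_eq_zero i
      exact hx
    · exact (Category.comp_id _).trans (Category.id_comp _).symm
  | @snoc n Γ F E' t s ih =>
    intro E m h
    obtain ⟨E₁, E₂, t', m₁, m₂, h₁, h₂, hm⟩ := Env.split s h
    obtain ⟨d, u, hd, hu⟩ := ih h₁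
    obtain ⟨x, hx⟩ : ∃ x : Σ E : Ctx G, (E.ten M.ground ⟶ Ctx.ten M.ground _), x = ⟨E₂, m₂⟩ :=
      ⟨_, rfl⟩
    obtain ⟨e, rfl, he⟩ := Fin.exists_castSucc_last
      (α := fun i => Σ E : Ctx G, (E.ten M.ground ⟶ (Γ i).ten M.ground)) d x
    rw [← he] at hx
    obtain ⟨rfl, hm₂⟩ : ∃ h : E₂ = (e (Fin.last _)).1, h ▸ m₂ = (e (Fin.last _)).2 := by
      rw [hx]; exact ⟨rfl, rfl⟩
    subst hm₂
    refine ⟨e, .snoc u t', fun i => Fin.lastCases h₂ hd i, ?_⟩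
    have key : ∀ {E E₁ E₂ Γ Γ₁ Γ₂ X Y : C} (m : E ⟶ Γ) (s : Γ ⟶ Γ₁ ⊗ Γ₂) (t : Γ₁ ⟶ X)
        (t' : E ⟶ E₁ ⊗ E₂) (m₁ : E₁ ⟶ Γ₁) (m₂ : E₂ ⟶ Γ₂) (u : E₁ ⟶ Y) (f : Y ⟶ X),
        m ≫ s = t' ≫ (m₁ ⊗ₘ m₂) → m₁ ≫ t = u ≫ f →
          m ≫ s ≫ t ▷ _ = (t' ≫ u ▷ _) ≫ (f ⊗ₘ m₂) := by
      intro E E₁ E₂ Γ Γ₁ Γ₂ X Y m s t t' m₁ m₂ u f h h'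
      rw [reassoc_of% h, ← tensorHom_id, tensorHom_comp_tensorHom, h', Category.comp_id,
        Category.assoc, ← tensorHom_id, tensorHom_comp_tensorHom, Category.id_comp]
    exact key _ _ _ _ _ _ _ _ hm hu

/-- Here `ρ` renames inside the substituted terms and `ρ'` renames the variables that are replaced.
Both are shifts when a binder is crossed. -/
theorem Env.rename {E Γ : Ctx G} {m : E.ten M.ground ⟶ Γ.ten M.ground} (h : Env M σ E Γ m)
    {ρ ρ' : ℕ → ℕ} (hρ : ρ.Injective) {τ : ℕ → Tm S} :
    (∀ p ∈ Γ, τ (ρ' p.1) = (σ p.1).rename ρ) → Env M τ (E.ren ρ) (Γ.ren ρ')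
      (Ctx.tenCast M.ground (Ctx.sameTypes_ren ρ) ≫ m ≫
        Ctx.tenCast M.ground (Ctx.sameTypes_ren ρ').symm) := by
  induction h with
  | nil =>
    intro _
    exact Env.nil.of_eq ((Category.id_comp _).trans (Category.id_comp _)).symm
  | @cons E Γ Δ E' p m g e d s ih =>
    intro H
    have hd := d.rename hρ
    rw [← H p List.mem_cons_self] at hd
    refine (Env.cons (p := (ρ' p.1, p.2)) (ih fun q hq => H q (List.mem_cons_of_mem _ hq)) hd
      (s.ren ρ)).of_eq ?_
    have key : ∀ {E E' X X' Y Y' Z Z' P : C} (s : E ⟶ X ⊗ Y) (s' : E' ⟶ X' ⊗ Y') (e : E' ⟶ E)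
        (x : X' ⟶ X) (y : Y' ⟶ Y) (m : X ⟶ Z) (z : Z ⟶ Z') (z' : Z ⊗ P ⟶ Z' ⊗ P) (g : Y ⟶ P),
        s' ≫ (x ⊗ₘ y) = e ≫ s → z' = z ▷ P →
        tenHom s' (x ≫ m ≫ z) (y ≫ g) = e ≫ tenHom s m g ≫ z' := by
      rintro E E' X X' Y Y' Z Z' P s s' e x y m z _ g h rfl
      rw [tenHom_comp h.symm, tenHom, tenHom, Category.assoc, ← tensorHom_id,
        tensorHom_comp_tensorHom, Category.comp_id]
    exact key _ _ _ _ _ _ _ _ _ (s.ten_ren M.ground ρ)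
      (Ctx.tenCast_cons M.ground p.1 (ρ' p.1) p.2 (Ctx.sameTypes_ren ρ').symm _)

theorem Env.consVar {E Γ : Ctx G} {m : E.ten M.ground ⟶ Γ.ten M.ground} (h : Env M σ E Γ m)
    {x y : ℕ} (A : Ty G) (hx : σ x = .var y) :
    Env M σ ((y, A) :: E) ((x, A) :: Γ)
      (m ▷ A.interp M.ground : E.ten M.ground ⊗ A.interp M.ground ⟶ _) := by
  have hd : Sem M [(y, A)] (σ x) A (λ_ (A.interp M.ground)).hom := hx ▸ Sem.var y A
  refine (Env.cons (p := (x, A)) h hd (Shuffle.snocVar (y, A) E)).of_eq ?_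
  rw [Shuffle.ten_snocVar]
  have key : ∀ {X Y Z : C} (m : X ⟶ Y), tenHom (X ◁ (λ_ Z).inv) m (λ_ Z).hom = m ▷ Z := by
    intro X Y Z m
    rw [tenHom, ← id_tensorHom, tensorHom_comp_tensorHom, Iso.inv_hom_id, Category.id_comp,
      tensorHom_id]
  exact key m

theorem Env.up {E Γ : Ctx G} {m : E.ten M.ground ⟶ Γ.ten M.ground} (h : Env M σ E Γ m)
    (A : Ty G) : ∃ m', Env M (up σ) ((0, A) :: E.shift 1) ((0, A) :: Γ.shift 1) m' ∧
      (Ctx.tenCast M.ground (Ctx.sameTypes_binder A E) ≫ m') =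
        (m ▷ A.interp M.ground ≫ Ctx.tenCast M.ground (Ctx.sameTypes_binder A Γ) :
          E.ten M.ground ⊗ A.interp M.ground ⟶ _) := by
  have h₁ := h.rename (ρ := (· + 1)) (ρ' := (· + 1)) (add_left_injective 1) (τ := VLambda.up σ)
    fun p _ => rfl
  refine ⟨_, h₁.consVar A (x := 0) (y := 0) rfl, ?_⟩
  have key : ∀ {X X' Y Y' P : C} (e : X ⟶ X') (e' : X' ⟶ X) (m : X ⟶ Y) (g : Y ⟶ Y')
      (c : X ⊗ P ⟶ X' ⊗ P) (c' : Y ⊗ P ⟶ Y' ⊗ P), e ≫ e' = 𝟙 _ → c = e ▷ P → c' = g ▷ P →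
      c ≫ (e' ≫ m ≫ g) ▷ P = m ▷ P ≫ c' := by
    rintro X X' Y Y' P e e' m g _ _ h rfl rfl
    rw [← comp_whiskerRight, reassoc_of% h, comp_whiskerRight]
  exact key _ _ _ _ _ _ (Ctx.tenCast_comp M.ground _ _)
    (Ctx.tenCast_cons M.ground 0 0 A (Ctx.sameTypes_shift 1 E) _)
    (Ctx.tenCast_cons M.ground 0 0 A (Ctx.sameTypes_shift 1 Γ) _)

/-- A direct version for two bound variables. Iterating `Env.up` would produce contexts shifted
twice by one instead of once by two. -/
theorem Env.up₂ {E Γ : Ctx G} {m : E.ten M.ground ⟶ Γ.ten M.ground} (h : Env M σ E Γ m)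
    (A B : Ty G) {τ : ℕ → Tm S} (h₀ : τ 0 = .var 0) (h₁ : τ 1 = .var 1)
    (h₂ : ∀ p ∈ Γ, τ (p.1 + 2) = (σ p.1).rename (· + 2)) :
    ∃ m', Env M τ ((0, B) :: (1, A) :: E.shift 2) ((0, B) :: (1, A) :: Γ.shift 2) m' ∧
      (Ctx.tenCast M.ground (Ctx.sameTypes_binder₂ A B E) ≫ m') =
        (m ▷ A.interp M.ground ▷ B.interp M.ground ≫
          Ctx.tenCast M.ground (Ctx.sameTypes_binder₂ A B Γ) :
            (E.ten M.ground ⊗ A.interp M.ground) ⊗ B.interp M.ground ⟶ _) := by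
  have h₃ := h.rename (ρ := (· + 2)) (ρ' := (· + 2)) (add_left_injective 2) h₂
  refine ⟨_, (h₃.consVar A (x := 1) (y := 1) h₁).consVar B (x := 0) (y := 0) h₀, ?_⟩
  have key : ∀ {X X' Y Y' P Q : C} (e : X ⟶ X') (e' : X' ⟶ X) (m : X ⟶ Y) (g : Y ⟶ Y')
      (c : X ⊗ P ⟶ X' ⊗ P) (c' : Y ⊗ P ⟶ Y' ⊗ P) (d : (X ⊗ P) ⊗ Q ⟶ (X' ⊗ P) ⊗ Q)
      (d' : (Y ⊗ P) ⊗ Q ⟶ (Y' ⊗ P) ⊗ Q), e ≫ e' = 𝟙 _ → c = e ▷ P → c' = g ▷ P →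
      d = c ▷ Q → d' = c' ▷ Q → d ≫ (e' ≫ m ≫ g) ▷ P ▷ Q = m ▷ P ▷ Q ≫ d' := by
    rintro X X' Y Y' P Q e e' m g _ _ _ _ h rfl rfl rfl rfl
    simp only [← comp_whiskerRight, reassoc_of% h]
  exact key _ _ _ _ _ _ _ _ (Ctx.tenCast_comp M.ground _ _)
    (Ctx.tenCast_cons M.ground 1 1 A (Ctx.sameTypes_shift 2 E) (Ctx.SameTypes.tail
      (Ctx.sameTypes_binder₂ A B E)))
    (Ctx.tenCast_cons M.ground 1 1 A (Ctx.sameTypes_shift 2 Γ) (Ctx.SameTypes.tail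
      (Ctx.sameTypes_binder₂ A B Γ)))
    (Ctx.tenCast_cons M.ground 0 0 B _ _) (Ctx.tenCast_cons M.ground 0 0 B _ _)

/-- The interpretation of a term after a substitution. -/
theorem Sem.subst {Γ : Ctx G} {v : Tm S} {A : Ty G} {f : Γ.ten M.ground ⟶ A.interp M.ground}
    (h : Sem M Γ v A f) : ∀ {σ : ℕ → Tm S} {E : Ctx G} {m : E.ten M.ground ⟶ Γ.ten M.ground},
      Env M σ E Γ m → E.Distinct → Sem M E (v.subst σ) A (m ≫ f) := by
  induction h with
  | op f d s hE ih =>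
    intro σ E m h hE
    obtain ⟨e, t, he, ht⟩ := h.splitMulti s
    refine (Sem.op f (fun i => ih i (he i) ?_) t hE).of_eq ?_
    · exact t.distinct hE i
    · rw [famTensorMap_comp, Category.assoc, ← reassoc_of% ht]
  | var x A =>
    intro σ E m h hE
    cases h with
    | cons e d s =>
      -- The rest of the substitution is empty, so the shuffle has an empty left side and
      -- contributes only a unitor.
      cases e
      obtain ⟨rfl, hs⟩ := s.eq_of_nil
      obtain rfl := eq_of_heq hs
      refine d.of_eq ?_
      rw [Shuffle.ten_nilLeft]
      have key : ∀ {X Y : C} (g : X ⟶ Y), g = tenHom (λ_ X).inv (𝟙 _) g ≫ (λ_ Y).hom := by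
        intro X Y g
        rw [tenHom, id_tensorHom]
        simp
      exact key _
  | star =>
    intro σ E m h hE
    cases h
    exact Sem.star.of_eq (Category.comp_id _).symm
  | toStar d e s _ ihd ihe =>
    intro σ E m h hE
    obtain ⟨E₁, E₂, t, m₁, m₂, h₁, h₂, hm⟩ := h.split s
    exact (Sem.toStar (ihd h₁ (t.distinct hE).1) (ihe h₂ (t.distinct hE).2) t hE).of_eq
      (toStarHom_comp hm _ _)
  | ten d e s _ ihd ihe =>
    intro σ E m h hE
    obtain ⟨E₁, E₂, t, m₁, m₂, h₁, h₂, hm⟩ := h.split s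
    exact (Sem.ten (ihd h₁ (t.distinct hE).1) (ihe h₂ (t.distinct hE).2) t hE).of_eq
      (tenHom_comp hm _ _)
  | app d e s _ ihd ihe =>
    intro σ E m h hE
    obtain ⟨E₁, E₂, t, m₁, m₂, h₁, h₂, hm⟩ := h.split s
    exact (Sem.app (ihd h₁ (t.distinct hE).1) (ihe h₂ (t.distinct hE).2) t hE).of_eq
      (appliedHom_comp hm _ _)
  | @pm Γ Δ E₀ v w A B D f g d e s _ ihd ihe =>
    intro σ E m h hE
    obtain ⟨E₁, E₂, t, m₁, m₂, h₁, h₂, hm⟩ := h.split s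
    obtain ⟨m', h', hm'⟩ := h₂.up₂ A B (τ := VLambda.up (VLambda.up σ)) rfl rfl
      fun p _ => by simp [VLambda.up, Tm.shift, Tm.rename_rename, Nat.add_assoc]
    refine (Sem.pm (ihd h₁ (t.distinct hE).1) (ihe h' (cons₂_distinct (t.distinct hE).2))
      t hE).of_eq ?_
    refine Eq.trans (congrArg _ ?_) (pmHom_comp hm _ _)
    exact (Category.assoc _ _ _).symm.trans ((congrArg (· ≫ g) hm').trans (Category.assoc _ _ _))
  | @lam Γ v A B f d ih =>
    intro σ E m h hE
    obtain ⟨m', h', hm'⟩ := h.up A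
    refine (Sem.lam (ih h' (cons_distinct hE))).of_eq ?_
    refine Eq.trans (congrArg _ ?_) (curryHom_comp_left _ _).symm
    exact (Category.assoc _ _ _).symm.trans ((congrArg (· ≫ f) hm').trans (Category.assoc _ _ _))

theorem Env.of_perm : ∀ {Γ E : Ctx G}, E.Perm Γ → ∃ m, Env M (fun n => .var n) E Γ m
  | [], E, h => by
      obtain rfl := List.perm_nil.1 h
      exact ⟨_, .nil⟩
  | p :: Γ, E, h => by
      obtain ⟨Γ', Δ', h₁, h₂, ⟨s⟩⟩ :=
        Shuffle.of_perm (h.trans (List.perm_append_singleton p Γ).symm)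
      obtain rfl := List.singleton_perm.1 h₂
      obtain ⟨m, hm⟩ := Env.of_perm h₁.symm
      exact ⟨_, .cons hm (Sem.var p.1 p.2) s⟩

/-- Exchange is the substitution of each variable for itself along a permuted context. The morphism
`m` does not depend on the term, so the two sides of an equation are transported alike. -/
theorem Sem.perm {E Γ : Ctx G} (h : E.Perm Γ) : ∃ m : E.ten M.ground ⟶ Γ.ten M.ground,
    ∀ {v : Tm S} {A : Ty G} {f : Γ.ten M.ground ⟶ A.interp M.ground}, Sem M Γ v A f →
      Sem M E v A (m ≫ f) := by
  obtain ⟨m, hm⟩ := Env.of_perm (M := M) h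
  refine ⟨m, fun {v _ _} hv => ?_⟩
  have := hv.subst hm (hv.distinct.perm h.symm)
  rwa [Tm.subst_var] at this

end VLambda

/-! ### The equations of linear λ-calculus in autonomous categories -/

namespace VLambda

set_option linter.unusedSectionVars false

section

variable {C : Type u₄} [Category.{v₄} C] [MonoidalCategory C] [SymmetricCategory C]

theorem tenHom_id_left {E X Y Z : C} (s : E ⟶ X ⊗ Y) (f : Y ⟶ Z) :
    tenHom s (𝟙 X) f = s ≫ X ◁ f := by
  rw [tenHom, id_tensorHom]

theorem toStarHom_unit {X Y : C} (f : X ⟶ Y) : toStarHom (λ_ X).inv (𝟙 _) f = f := by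
  simp [toStarHom]

/-- The η-rule of the unit type: once `f` has reached the unit object, the braiding past it is a
composite of unitors. -/
theorem toStarHom_rightUnitor_inv {E X Y Z : C} (s : E ⟶ X ⊗ Y) (f : X ⟶ 𝟙_ C) (g : Y ⊗ 𝟙_ C ⟶ Z) :
    toStarHom s f (tenHom (ρ_ Y).inv (𝟙 Y) (𝟙 _) ≫ g) =
      tenHom (s ≫ (β_ _ _).hom) (𝟙 Y) f ≫ g := by
  rw [toStarHom, tenHom_id_left, tenHom_id_left, whiskerLeft_id, Category.comp_id,
    Category.assoc, Category.assoc, ← BraidedCategory.braiding_naturality_left_assoc,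
    braiding_tensorUnit_left]
  simp

/-- The commuting conversion for `∗`. The hypothesis `h` says that the two sides split the same
context with different bracketings; after `f` has been brought to the front the rest is naturality.
-/
theorem toStarHom_comm {E F Γ Δ Θ F' A Z : C} (s : E ⟶ F ⊗ Γ) (t : F ⟶ Δ ⊗ Θ)
    (t' : E ⟶ Δ ⊗ F') (s' : F' ⟶ Θ ⊗ Γ) (h : s ≫ t ▷ _ ≫ (α_ _ _ _).hom = t' ≫ _ ◁ s')
    (f : Δ ⟶ 𝟙_ C) (g : Θ ⟶ A) (k : Γ ⊗ A ⟶ Z) :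
    tenHom (s ≫ (β_ _ _).hom) (𝟙 Γ) (toStarHom t f g) ≫ k =
      toStarHom t' f (tenHom (s' ≫ (β_ _ _).hom) (𝟙 Γ) g ≫ k) := by
  have e : toStarHom t' f (tenHom (s' ≫ (β_ _ _).hom) (𝟙 Γ) g ≫ k) =
      (t' ≫ Δ ◁ s') ≫ f ▷ _ ≫ (λ_ _).hom ≫ (β_ _ _).hom ≫ Γ ◁ g ≫ k := by
    rw [toStarHom, tenHom_id_left]
    simp only [Category.assoc, ← leftUnitor_naturality_assoc, whisker_exchange_assoc]
  rw [e, ← h, tenHom_id_left, toStarHom]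
  simp only [Category.assoc, ← BraidedCategory.braiding_naturality_left_assoc,
    comp_whiskerRight]
  simp

/-- The β-rule of pattern matching. The braiding and the associator in `pmHom` move `Θ` to the
front, and `h` identifies this with splitting off `Δ` first and then `Γ`. -/
theorem pmHom_tenHom {E F Γ Δ Θ F' Θ' A B Z : C} (s : E ⟶ F ⊗ Θ) (t : F ⟶ Γ ⊗ Δ)
    (t' : E ⟶ F' ⊗ Δ) (s' : F' ⟶ Θ ⊗ Γ)
    (h : (s ≫ (β_ _ _).hom) ≫ _ ◁ t ≫ (α_ _ _ _).inv = t' ≫ s' ▷ _)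
    (f : Γ ⟶ A) (g : Δ ⟶ B) (c : Θ ⟶ Θ') (k : (Θ' ⊗ A) ⊗ B ⟶ Z) :
    pmHom s (tenHom t f g) (c ▷ A ▷ B ≫ k) = tenHom t' (tenHom s' c f) g ≫ k := by
  have e : tenHom t' (tenHom s' c f) g = (t' ≫ s' ▷ _) ≫ ((c ⊗ₘ f) ⊗ₘ g) := by
    rw [tenHom, tenHom, Category.assoc, ← tensorHom_id s', tensorHom_comp_tensorHom,
      Category.id_comp]
  rw [e, ← h, pmHom, tenHom]
  simp only [Category.assoc, ← associator_inv_naturality_left_assoc,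
    ← BraidedCategory.braiding_naturality_right_assoc, ← MonoidalCategory.tensorHom_def_assoc]
  rw [← associator_inv_naturality_assoc, ← id_tensorHom, tensorHom_comp_tensorHom_assoc,
    Category.id_comp, ← BraidedCategory.braiding_naturality_assoc]

/-- The η-rule of pattern matching: putting the two components back into a pair undoes the
associator in `pmHom`. -/
theorem pmHom_associator {E X Y A B Z : C} (s : E ⟶ X ⊗ Y) (f : X ⟶ A ⊗ B)
    (g : Y ⊗ (A ⊗ B) ⟶ Z) :
    pmHom s f ((α_ _ _ _).hom ≫ g) = tenHom (s ≫ (β_ _ _).hom) (𝟙 Y) f ≫ g := by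
  rw [pmHom, tenHom_id_left]
  simp only [Category.assoc, BraidedCategory.braiding_naturality_left_assoc,
    Iso.inv_hom_id_assoc]

/-- Two ways to permute the factors: `A ⊗ B` past `Θ` and then everything past `Γ`, or `A ⊗ B` past
`Θ ⊗ Γ` and then `Θ` past `Γ`. The hexagons and naturality make them agree; this is the coherence
behind the commuting conversion for `pm`. -/
theorem braiding_pm (A B Γ Θ : C) :
    (α_ (A ⊗ B) Θ Γ).inv ≫ ((β_ (A ⊗ B) Θ).hom ≫ (α_ Θ A B).inv) ▷ Γ ≫
        (β_ ((Θ ⊗ A) ⊗ B) Γ).hom =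
      (β_ (A ⊗ B) (Θ ⊗ Γ)).hom ≫ (α_ (Θ ⊗ Γ) A B).inv ≫
        ((β_ Θ Γ).hom ▷ A ≫ (α_ Γ Θ A).hom) ▷ B ≫ (α_ Γ (Θ ⊗ A) B).hom := by
  rw [comp_whiskerRight_assoc, BraidedCategory.braiding_naturality_left,
    BraidedCategory.braiding_tensor_left_hom Θ (A ⊗ B) Γ,
    BraidedCategory.braiding_tensor_right_hom (A ⊗ B) Θ Γ]
  monoidal

theorem pmHom_comm {E F Γ Δ Θ F' A B D Z : C} (s : E ⟶ F ⊗ Γ) (t : F ⟶ Δ ⊗ Θ)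
    (t' : E ⟶ Δ ⊗ F') (s' : F' ⟶ Θ ⊗ Γ) (h : s ≫ t ▷ _ ≫ (α_ _ _ _).hom = t' ≫ _ ◁ s')
    (f : Δ ⟶ A ⊗ B) (g : (Θ ⊗ A) ⊗ B ⟶ D) (k : Γ ⊗ D ⟶ Z) :
    tenHom (s ≫ (β_ _ _).hom) (𝟙 Γ) (pmHom t f g) ≫ k =
      pmHom t' f (((s' ≫ (β_ _ _).hom) ▷ A ≫ (α_ _ _ _).hom) ▷ B ≫ (α_ _ _ _).hom ≫
        Γ ◁ g ≫ k) := by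
  have e : pmHom t' f (((s' ≫ (β_ _ _).hom) ▷ A ≫ (α_ _ _ _).hom) ▷ B ≫ (α_ _ _ _).hom ≫
      Γ ◁ g ≫ k) = (t' ≫ Δ ◁ s') ≫ f ▷ _ ≫ (β_ (A ⊗ B) (Θ ⊗ Γ)).hom ≫ (α_ (Θ ⊗ Γ) A B).inv ≫
        ((β_ Θ Γ).hom ▷ A ≫ (α_ Γ Θ A).hom) ▷ B ≫ (α_ Γ (Θ ⊗ A) B).hom ≫ Γ ◁ g ≫ k := by
    rw [pmHom]
    simp only [comp_whiskerRight, Category.assoc, ← associator_inv_naturality_left_assoc,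
      ← BraidedCategory.braiding_naturality_right_assoc, whisker_exchange_assoc]
  have b := braiding_pm A B Γ Θ
  rw [e, ← h, tenHom_id_left, pmHom, ← reassoc_of% b]
  simp only [Category.assoc, ← BraidedCategory.braiding_naturality_left_assoc,
    comp_whiskerRight]
  simp

end

section

variable {G : Type u₁} {S : Signature.{u₁, u₂} G}
variable {C : Type u₄} [Category.{v₄} C] [MonoidalCategory C] [SymmetricCategory C]
  [MonoidalClosed C] {M : Interpretation S C} {σ : ℕ → Tm S}

/-- The interpretation of a substitution by variables. -/
theorem Env.ofVars {E Γ : Ctx G}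
    (H : List.Forall₂ (fun p q => σ q.1 = .var p.1 ∧ p.2 = q.2) E Γ) (h : E.SameTypes Γ) :
    Env M σ E Γ (Ctx.tenCast M.ground h) := by
  induction H with
  | nil => exact .nil
  | @cons p q E Γ hp _ ih =>
    obtain ⟨x, A⟩ := p
    obtain ⟨y, B⟩ := q
    obtain ⟨hx, rfl⟩ := hp
    exact ((ih h.tail).consVar A hx).of_eq (Ctx.tenCast_cons M.ground x y A h.tail h).symm

theorem Env.id {Γ : Ctx G} (H : ∀ p ∈ Γ, σ p.1 = .var p.1) : Env M σ Γ Γ (𝟙 _) :=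
  (Env.ofVars (List.forall₂_same.2 fun p hp => ⟨H p hp, rfl⟩) rfl).of_eq (Ctx.tenCast_refl _ _)

theorem Env.toRen {Γ : Ctx G} {ρ : ℕ → ℕ} (H : ∀ p ∈ Γ, σ (ρ p.1) = .var p.1) :
    Env M σ Γ (Γ.ren ρ) (Ctx.tenCast M.ground (Ctx.sameTypes_ren ρ).symm) :=
  Env.ofVars (List.forall₂_map_right_iff (f := fun p : ℕ × Ty G => (ρ p.1, p.2)).2 (List.forall₂_same.2 fun p hp => ⟨H p hp, rfl⟩)) _

theorem Env.ofRen {Γ : Ctx G} {ρ : ℕ → ℕ} (H : ∀ p ∈ Γ, σ p.1 = .var (ρ p.1)) :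
    Env M σ (Γ.ren ρ) Γ (Ctx.tenCast M.ground (Ctx.sameTypes_ren ρ)) :=
  Env.ofVars (List.forall₂_map_left_iff (f := fun p : ℕ × Ty G => (ρ p.1, p.2)).2 (List.forall₂_same.2 fun p hp => ⟨H p hp, rfl⟩)) _

theorem Ctx.Distinct.ne {x : ℕ} {A : Ty G} {Γ : Ctx G} (h : Ctx.Distinct ((x, A) :: Γ))
    {p : ℕ × Ty G} (hp : p ∈ Γ) : p.1 ≠ x := by
  rintro rfl
  exact (List.nodup_cons.1 (show (p.1 :: Γ.map Prod.fst).Nodup from h)).1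
    (List.mem_map_of_mem hp)

/-- The substitution of one variable. -/
theorem Sem.replace {Γ Δ E : Ctx G} {x : ℕ} {v w : Tm S} {A B : Ty G}
    {f : Ctx.ten M.ground ((x, A) :: Γ) ⟶ B.interp M.ground}
    {g : Δ.ten M.ground ⟶ A.interp M.ground} (hv : Sem M ((x, A) :: Γ) v B f)
    (hw : Sem M Δ w A g) (s : Shuffle Γ Δ E) (hE : E.Distinct) :
    Sem M E (v.replace x w) B (tenHom (s.ten M.ground) (𝟙 _) g ≫ f) := by
  have hσ : ∀ p ∈ Γ, (fun n => if n = x then w else .var n : ℕ → Tm S) p.1 = .var p.1 :=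
    fun p hp => if_neg (hv.distinct.ne hp)
  have hx : Sem M Δ ((fun n => if n = x then w else .var n : ℕ → Tm S) x) A g := by
    simpa only [if_true] using hw
  exact hv.subst (Env.cons (p := (x, A)) (Env.id hσ) hx s) hE

theorem Sem.replaceUnder {Γ Δ E : Ctx G} {x : ℕ} {v w : Tm S} {A B : Ty G} (k : ℕ)
    {f : Ctx.ten M.ground ((x, A) :: Γ) ⟶ B.interp M.ground}
    {g : Δ.ten M.ground ⟶ A.interp M.ground} (hv : Sem M ((x, A) :: Γ) v B f)
    (hw : Sem M Δ w A g) (s : Shuffle (Γ.shift k) Δ E) (hE : E.Distinct) :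
    Sem M E (v.replaceUnder k x w) B
      (tenHom (s.ten M.ground) (Ctx.tenCast M.ground (Ctx.sameTypes_shift k Γ).symm) g ≫ f) := by
  have hσ : ∀ p ∈ Γ, (fun n => if n = x then w else .var (n + k) : ℕ → Tm S) p.1 =
      .var (p.1 + k) := fun p hp => if_neg (hv.distinct.ne hp)
  have hx : Sem M Δ ((fun n => if n = x then w else .var (n + k) : ℕ → Tm S) x) A g := by
    simpa only [if_true] using hw
  exact hv.subst (Env.cons (p := (x, A)) (Env.ofRen (ρ := (· + k)) hσ) hx s) hE

theorem Sem.inst {Γ Δ E : Ctx G} {v w : Tm S} {A B : Ty G}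
    {f : Ctx.ten M.ground ((0, A) :: Γ.shift 1) ⟶ B.interp M.ground}
    {g : Δ.ten M.ground ⟶ A.interp M.ground} (hv : Sem M ((0, A) :: Γ.shift 1) v B f)
    (hw : Sem M Δ w A g) (s : Shuffle Γ Δ E) (hE : E.Distinct) :
    Sem M E (v.inst w) B
      (tenHom (s.ten M.ground) (Ctx.tenCast M.ground (Ctx.sameTypes_shift 1 Γ)) g ≫ f) :=
  hv.subst (Env.cons (p := (0, A)) (Env.toRen (ρ := (· + 1)) fun _ _ => rfl) hw s) hE

theorem Sem.inst₂ {Γ Δ Θ F E : Ctx G} {u v w : Tm S} {A B D : Ty G}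
    {f : Ctx.ten M.ground ((0, B) :: (1, A) :: Γ.shift 2) ⟶ D.interp M.ground}
    {g : Δ.ten M.ground ⟶ A.interp M.ground} {h : Θ.ten M.ground ⟶ B.interp M.ground}
    (hu : Sem M ((0, B) :: (1, A) :: Γ.shift 2) u D f)
    (hv : Sem M Δ v A g) (hw : Sem M Θ w B h) (s : Shuffle Γ Δ F) (t : Shuffle F Θ E)
    (hE : E.Distinct) : Sem M E (u.inst₂ v w) D
      (tenHom (t.ten M.ground) (tenHom (s.ten M.ground)
        (Ctx.tenCast M.ground (Ctx.sameTypes_shift 2 Γ)) g) h ≫ f) :=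
  hu.subst (Env.cons (p := (0, B)) (Env.cons (p := (1, A))
    (Env.toRen (ρ := (· + 2)) fun _ _ => rfl) hv s) hw t) hE

/-- The equations are stated for every permutation of a concatenated context; by exchange, one
convenient order suffices. -/
theorem Sem.both_of_perm {E E₀ : Ctx G} {v w : Tm S} {A : Ty G} (h : E.Perm E₀)
    {f : E₀.ten M.ground ⟶ A.interp M.ground} (hv : Sem M E₀ v A f) (hw : Sem M E₀ w A f) :
    ∃ f, Sem M E v A f ∧ Sem M E w A f := by
  obtain ⟨m, hm⟩ := Sem.perm (M := M) h
  exact ⟨_, hm hv, hm hw⟩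

theorem Ctx.tenCast_binder₂ (I : G → C) (A B : Ty G) (Γ : Ctx G) :
    Ctx.tenCast I (Ctx.sameTypes_binder₂ A B Γ) =
      Ctx.tenCast I (Ctx.sameTypes_shift 2 Γ) ▷ A.interp I ▷ B.interp I :=
  (Ctx.tenCast_cons I 0 0 B ((Ctx.sameTypes_shift 2 Γ).cons 1 1 A) _).trans
    (congrArg (· ▷ B.interp I) (Ctx.tenCast_cons I 1 1 A (Ctx.sameTypes_shift 2 Γ) _))

theorem Ctx.tenCast_binder (I : G → C) (A : Ty G) (Γ : Ctx G) :
    Ctx.tenCast I (Ctx.sameTypes_binder A Γ) =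
      Ctx.tenCast I (Ctx.sameTypes_shift 1 Γ) ▷ A.interp I :=
  Ctx.tenCast_cons I 0 0 A _ _

/-- The β-rule of functions; `c` stands for the cast to the shifted context of the body. The next
lemma is the η-rule, where `c'` is the cast back. -/
theorem appliedHom_curryHom {E X Y Z W X' : C} (s : E ⟶ X ⊗ Y) (c : X ⟶ X') (f : X' ⊗ Z ⟶ W)
    (g : Y ⟶ Z) : appliedHom s (curryHom (c ▷ Z ≫ f)) g = tenHom s c g ≫ f := by
  rw [appliedHom, tenHom, MonoidalCategory.tensorHom_def', Category.assoc,
    curryHom_appHom, MonoidalCategory.tensorHom_def', Category.assoc, Category.assoc]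

theorem curryHom_appliedHom {X X' Z W : C} (c : X ⟶ X') (c' : X' ⟶ X) (h : c ≫ c' = 𝟙 _)
    (f : X ⟶ (ihom Z).obj W) :
    curryHom (c ▷ Z ≫ appliedHom (X' ◁ (λ_ Z).inv) (c' ≫ f) (λ_ Z).hom) = f := by
  rw [appliedHom, ← id_tensorHom, tensorHom_comp_tensorHom_assoc, Category.id_comp,
    Iso.inv_hom_id, tensorHom_id, ← comp_whiskerRight_assoc, reassoc_of% h,
    whiskerRight_appHom_curryHom]

/-- The equations of linear `λ`-calculus hold in all autonomous categories. -/
theorem BaseEq.sem (M : Interpretation S C) {E : Ctx G} {v w : Tm S} {A : Ty G}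
    (h : BaseEq E v w A) : ∃ f, Sem M E v A f ∧ Sem M E w A f := by
  induction h with
  | @star_toStar E v A hv =>
    obtain ⟨f, hf⟩ := hv.exists_sem M
    refine ⟨f, (Sem.toStar .star hf (Shuffle.nilLeft E) hf.distinct).of_eq ?_, hf⟩
    rw [Shuffle.ten_nilLeft]
    exact toStarHom_unit f
  | @toStar_eta Γ Δ E v w z A hv hw hp hE =>
    obtain ⟨f, hf⟩ := hv.exists_sem M
    obtain ⟨g, hg⟩ := hw.exists_sem M
    obtain ⟨s⟩ := Shuffle.append Γ Δ
    have hp := hp.trans List.perm_append_comm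
    have hE := hE.perm hp
    refine Sem.both_of_perm hp ((Sem.toStar hf (hg.replace .star (Shuffle.nilRight Δ)
      (s.distinct hE).2) s hE).of_eq ?_) (hg.replace hf s.symm hE)
    rw [Shuffle.ten_symm, Shuffle.ten_nilRight]
    exact toStarHom_rightUnitor_inv _ _ _
  | @lam_beta Γ Δ E v w A B hv hw hp hE =>
    obtain ⟨f, hf⟩ := hv.exists_sem M
    obtain ⟨g, hg⟩ := hw.exists_sem M
    obtain ⟨s⟩ := Shuffle.append Γ Δ
    have hp := hp.trans List.perm_append_comm
    have hE := hE.perm hp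
    refine Sem.both_of_perm hp ((Sem.app (Sem.lam hf) hg s hE).of_eq ?_) (hf.inst hg s hE)
    rw [Ctx.tenCast_binder]
    exact appliedHom_curryHom _ _ _ _
  | @lam_eta E v A B hv =>
    obtain ⟨f, hf⟩ := hv.exists_sem M
    refine ⟨f, (Sem.lam (Sem.app (hf.rename (ρ := (· + 1)) (add_left_injective 1)) (Sem.var 0 A)
      (Shuffle.snocVar _ _) (cons_distinct hf.distinct))).of_eq ?_, hf⟩
    rw [Shuffle.ten_snocVar, Ctx.tenCast_binder]
    exact curryHom_appliedHom _ _ (Ctx.tenCast_comp _ _ _) _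
  | @pm_ten Γ Δ Θ E v w u A B D hv hw hu hp hE =>
    obtain ⟨f, hf⟩ := hv.exists_sem M
    obtain ⟨g, hg⟩ := hw.exists_sem M
    obtain ⟨k, hk⟩ := hu.exists_sem M
    obtain ⟨t⟩ := Shuffle.append Γ Δ
    obtain ⟨s⟩ := Shuffle.append (Γ ++ Δ) Θ
    have hp : E.Perm (Γ ++ Δ ++ Θ) := by
      refine hp.trans ?_
      rw [List.append_assoc]
      exact List.perm_append_comm.trans (List.perm_append_comm.append_right _)
    have hE := hE.perm hp
    -- The body's context comes last in the chosen order, while the substituted side needs it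
    -- bracketed with the first component; interchanging and rebracketing provides the shuffles for
    -- `Sem.inst₂`.
    obtain ⟨F, t', s', h⟩ := Shuffle.ten_assoc_symm M.ground s.symm t
    refine Sem.both_of_perm hp ((Sem.pm (Sem.ten hf hg t (s.distinct hE).1) hk s hE).of_eq ?_)
      (hk.inst₂ hf hg s' t' hE)
    rw [Shuffle.ten_symm] at h
    rw [Ctx.tenCast_binder₂]
    exact pmHom_tenHom _ _ _ _ h _ _ _ _
  | @pm_eta Γ Δ E v u z A B D hv hu hp hE =>
    obtain ⟨f, hf⟩ := hv.exists_sem M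
    obtain ⟨g, hg⟩ := hu.exists_sem M
    obtain ⟨s⟩ := Shuffle.append Γ Δ
    have hp := hp.trans List.perm_append_comm
    have hE := hE.perm hp
    have hd : Ctx.Distinct [(0, B), (1, A)] := by simp [Ctx.Distinct]
    refine Sem.both_of_perm hp ((Sem.pm hf (hg.replaceUnder 2 (Sem.ten (Sem.var 1 A) (Sem.var 0 B)
      (Shuffle.snocVar (0, B) [(1, A)]) hd) (.right _ (.right _ (Shuffle.nilRight _)))
        (cons₂_distinct (s.distinct hE).2)) s hE).of_eq ?_) (hg.replace hf s.symm hE)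
    rw [Shuffle.ten_symm, Shuffle.ten_snocVar, Ctx.tenCast_binder₂]
    refine Eq.trans (congrArg _ ?_) (pmHom_associator _ _ _)
    refine (Category.assoc _ _ _).symm.trans (congrArg (· ≫ g) ?_)
    have key : ∀ {X X' Y Z : C} (c : X ⟶ X') (c' : X' ⟶ X) (s : X' ⟶ X' ⊗ 𝟙_ C), c ≫ c' = 𝟙 _ →
        s = (ρ_ _).inv → c ▷ Y ▷ Z ≫ tenHom ((s ▷ Y ≫ (α_ _ _ _).hom) ▷ Z ≫ (α_ _ _ _).hom) c'
          (tenHom ((𝟙_ C ⊗ Y) ◁ (λ_ Z).inv) (λ_ Y).hom (λ_ Z).hom) = (α_ X Y Z).hom := by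
      rintro X X' Y Z c c' _ h rfl
      have e : tenHom ((𝟙_ C ⊗ Y) ◁ (λ_ Z).inv) (λ_ Y).hom (λ_ Z).hom = (λ_ Y).hom ▷ Z := by
        rw [tenHom, ← id_tensorHom, tensorHom_comp_tensorHom, Category.id_comp, Iso.inv_hom_id,
          tensorHom_id]
      rw [e, tenHom, MonoidalCategory.tensorHom_def', triangle_assoc_comp_right_inv,
        Category.assoc, ← associator_naturality_middle_assoc, ← associator_naturality_left]
      have e₂ : (X' ◁ (λ_ Y).inv) ▷ Z ≫ (X' ◁ (λ_ Y).hom) ▷ Z = 𝟙 _ := by simp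
      rw [reassoc_of% e₂, ← comp_whiskerRight_assoc, ← comp_whiskerRight, h]
      simp
    exact key _ _ _ (Ctx.tenCast_comp _ _ _) (Shuffle.ten_nilRight _ _)
  | @toStar_comm Γ Δ Θ E u v w z A B hu hv hw hp hE =>
    obtain ⟨f, hf⟩ := hu.exists_sem M
    obtain ⟨g, hg⟩ := hv.exists_sem M
    obtain ⟨k, hk⟩ := hw.exists_sem M
    obtain ⟨t⟩ := Shuffle.append Δ Θ
    obtain ⟨s⟩ := Shuffle.append (Δ ++ Θ) Γ
    have hp : E.Perm (Δ ++ Θ ++ Γ) := hp.trans (List.perm_append_comm.append_right _)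
    have hE := hE.perm hp
    obtain ⟨F, t', s', h⟩ := Shuffle.ten_assoc M.ground s t
    refine Sem.both_of_perm hp (hf.replace (Sem.toStar hg hk t (s.distinct hE).1) s.symm hE)
      ((Sem.toStar hg (hf.replace hk s'.symm (t'.distinct hE).2) t' hE).of_eq ?_)
    rw [Shuffle.ten_symm, Shuffle.ten_symm]
    exact (toStarHom_comm _ _ _ _ h _ _ _).symm
  | @pm_comm Γ Δ Θ E u v w z A B D D' hu hv hw hp hE =>
    obtain ⟨f, hf⟩ := hu.exists_sem M
    obtain ⟨g, hg⟩ := hv.exists_sem M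
    obtain ⟨k, hk⟩ := hw.exists_sem M
    obtain ⟨t⟩ := Shuffle.append Δ Θ
    obtain ⟨s⟩ := Shuffle.append (Δ ++ Θ) Γ
    have hp : E.Perm (Δ ++ Θ ++ Γ) := hp.trans (List.perm_append_comm.append_right _)
    have hE := hE.perm hp
    obtain ⟨F, t', s', h⟩ := Shuffle.ten_assoc M.ground s t
    refine Sem.both_of_perm hp (hf.replace (Sem.pm hg hk t (s.distinct hE).1) s.symm hE)
      ((Sem.pm hg (hf.replaceUnder 2 hk (.right _ (.right _ (s'.symm.ren (· + 2))))
        (cons₂_distinct (t'.distinct hE).2)) t' hE).of_eq ?_)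
    have hs := s'.symm.ten_ren M.ground (· + 2)
    rw [s'.ten_symm] at hs
    rw [Shuffle.ten_symm]
    refine Eq.trans (congrArg _ ?_) (pmHom_comm _ _ _ _ h _ _ _).symm
    rw [Ctx.tenCast_binder₂, Ctx.tenCast_binder₂]
    -- The primed objects are the shifted contexts under the binder, and `c`, `a`, `b` are casts
    -- between them and the unshifted ones. The claim is that these casts cancel, which reduces the
    -- goal to `pmHom_comm`.
    have key : ∀ {F F' Γ Γ' Θ Θ' A B D Z : C} (c : F ⟶ F') (c' : F' ⟶ F) (s : F ⟶ Γ ⊗ Θ)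
        (s' : F' ⟶ Γ' ⊗ Θ') (a : Γ' ⟶ Γ) (b : Θ ⟶ Θ') (b' : Θ' ⟶ Θ) (k : (Θ' ⊗ A) ⊗ B ⟶ D)
        (f : Γ ⊗ D ⟶ Z), c ≫ c' = 𝟙 _ → b' ≫ b = 𝟙 _ → s' ≫ (a ⊗ₘ b') = c' ≫ s →
        c ▷ A ▷ B ≫ tenHom ((s' ▷ A ≫ (α_ _ _ _).hom) ▷ B ≫ (α_ _ _ _).hom) a k ≫ f =
          (s ▷ A ≫ (α_ _ _ _).hom) ▷ B ≫ (α_ _ _ _).hom ≫ Γ ◁ (b ▷ A ▷ B ≫ k) ≫ f := by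
      intro F F' Γ Γ' Θ Θ' A B D Z c c' s s' a b b' k f hc hb h
      have e : c ≫ s' ≫ a ▷ _ = s ≫ _ ◁ b := by
        rw [← Category.id_comp (s ≫ _), ← hc, Category.assoc, ← reassoc_of% h, ← id_tensorHom,
          tensorHom_comp_tensorHom, hb, Category.comp_id, tensorHom_id]
      have e₁ : c ▷ A ▷ B ≫ tenHom ((s' ▷ A ≫ (α_ _ _ _).hom) ▷ B ≫ (α_ _ _ _).hom) a k ≫ f =
          (c ≫ s' ≫ a ▷ _) ▷ A ▷ B ≫ (α_ _ _ _).hom ▷ B ≫ (α_ _ _ _).hom ≫ Γ ◁ k ≫ f := by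
        rw [tenHom, MonoidalCategory.tensorHom_def]
        simp only [comp_whiskerRight, Category.assoc, ← associator_naturality_left_assoc]
        simp
      rw [e₁, e]
      simp
    exact key _ _ _ _ _ _ _ _ _ (Ctx.tenCast_comp _ _ (Ctx.sameTypes_shift 2 F).symm)
      (Ctx.tenCast_comp _ (Ctx.sameTypes_shift 2 Θ).symm _) hs

end

end VLambda

/-! ### Soundness of the theorems in models -/

namespace VLambda

set_option linter.unusedSectionVars false

section

variable {V : Type u₃} [CommMonoid V] [CompleteLattice V] [IsQuantale V]
variable {C : Type u₄} [Category.{v₄} C] [MonoidalCategory C] [SymmetricCategory C]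
  [MonoidalClosed C] [VCatSepCategory V C] [VCatSepAutonomous V C]

theorem le_dist_tensorHom {X X' Y Y' : C} {f g : X ⟶ Y} {f' g' : X' ⟶ Y'} {q r : V}
    (hq : q ≤ (VCatSepCategory.hom X Y).dist f g)
    (hr : r ≤ (VCatSepCategory.hom X' Y').dist f' g') :
    q * r ≤ (VCatSepCategory.hom (X ⊗ X') (Y ⊗ Y')).dist (f ⊗ₘ f') (g ⊗ₘ g') :=
  (mul_le_mul' hq hr).trans (VCatSepAutonomous.tensor X X' Y Y' (f, f') (g, g'))

theorem le_dist_tenHom {E X X' Y Y' : C} (s : E ⟶ X ⊗ X') {f g : X ⟶ Y} {f' g' : X' ⟶ Y'}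
    {q r : V} (hq : q ≤ (VCatSepCategory.hom X Y).dist f g)
    (hr : r ≤ (VCatSepCategory.hom X' Y').dist f' g') :
    q * r ≤ (VCatSepCategory.hom E (Y ⊗ Y')).dist (tenHom s f f') (tenHom s g g') :=
  le_dist_comp_left s (le_dist_tensorHom hq hr)

theorem le_dist_tenHom_right {E X X' Y Y' : C} (s : E ⟶ X ⊗ X') (f : X ⟶ Y) {f' g' : X' ⟶ Y'}
    {r : V} (hr : r ≤ (VCatSepCategory.hom X' Y').dist f' g') :
    r ≤ (VCatSepCategory.hom E (Y ⊗ Y')).dist (tenHom s f f') (tenHom s f g') := by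
  refine (le_mul_dist_self (VCatSepCategory.hom X Y) f r).trans ?_
  rw [mul_comm]
  exact le_dist_tenHom s le_rfl hr

theorem le_dist_whiskerRight {X Y : C} (Z : C) {f g : X ⟶ Y} {q : V}
    (hq : q ≤ (VCatSepCategory.hom X Y).dist f g) :
    q ≤ (VCatSepCategory.hom (X ⊗ Z) (Y ⊗ Z)).dist (f ▷ Z) (g ▷ Z) := by
  rw [← tensorHom_id, ← tensorHom_id]
  exact (le_mul_dist_self _ (𝟙 Z) q).trans (le_dist_tensorHom hq le_rfl)

theorem le_dist_curryHom {X Y Z : C} {f g : X ⊗ Y ⟶ Z} {q : V}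
    (hq : q ≤ (VCatSepCategory.hom (X ⊗ Y) Z).dist f g) :
    q ≤ (VCatSepCategory.hom X ((ihom Y).obj Z)).dist (curryHom f) (curryHom g) :=
  hq.trans ((VCatSepAutonomous.adjunction (V := V) Y).homEquiv X Z f g)

theorem prod_le_dist_famTensorMap : ∀ (n : ℕ) {X Y : Fin (n + 1) → C} {f g : ∀ i, X i ⟶ Y i}
    {q : Fin (n + 1) → V}, (∀ i, q i ≤ (VCatSepCategory.hom (X i) (Y i)).dist (f i) (g i)) →
      ∏ i, q i ≤ (VCatSepCategory.hom _ _).dist (famTensorMap n f) (famTensorMap n g)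
  | 0, _, _, _, _, _, h => by
      rw [Fin.prod_univ_one]
      exact h 0
  | n + 1, _, _, _, _, _, h => by
      rw [Fin.prod_univ_castSucc]
      exact le_dist_tensorHom (prod_le_dist_famTensorMap n fun i => h i.castSucc) (h _)

end

section

variable {V : Type u₃} [CommMonoid V] [CompleteLattice V] [IsQuantale V] {B : Set V}
variable {G : Type u₁} {S : Signature.{u₁, u₂} G} {T : VTheory S B}
variable {C : Type u₄} [Category.{v₄} C] [MonoidalCategory C] [SymmetricCategory C]
  [MonoidalClosed C] [VCatSepCategory V C] [VCatSepAutonomous V C]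

/-- Soundness: the theorems of `T` hold in the models of `T`. -/
theorem VTheory.Thm.sem (hV : (1 : V) = ⊤) (hB : IsQuantaleBasis B) (M : T.Model C) {Γ : Ctx G}
    {v w : Tm S} {q : V} {A : Ty G} (h : T.Thm Γ v q w A) :
    ∃ f g, Sem M.toInterpretation Γ v A f ∧ Sem M.toInterpretation Γ w A g ∧
      q ≤ (VCatSepCategory.hom _ _).dist f g := by
  -- Integrality enters here: self-distances are only known to be above the unit, while equal
  -- interpretations must satisfy the label `⊤`.
  have top_le : ∀ {X Y : C} (f : X ⟶ Y), ⊤ ≤ (VCatSepCategory.hom (V := V) X Y).dist f f :=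
    fun f => hV ▸ (VCatSepCategory.hom _ _).one_le_dist f
  induction h with
  | ax e he =>
    obtain ⟨d⟩ := e.lhs_typed
    obtain ⟨d'⟩ := e.rhs_typed
    exact ⟨_, _, d.sem _, d'.sem _, le_dist_comp_left _ (M.sat e he d d')⟩
  | base h =>
    obtain ⟨f, hv, hw⟩ := h.sem M.toInterpretation
    exact ⟨f, f, hv, hw, top_le f⟩
  | base_symm h =>
    obtain ⟨f, hv, hw⟩ := h.sem M.toInterpretation
    exact ⟨f, f, hw, hv, top_le f⟩
  | refl h =>
    obtain ⟨f, hf⟩ := h.exists_sem M.toInterpretation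
    exact ⟨f, f, hf, hf, top_le f⟩
  | trans _ _ ih ih' =>
    obtain ⟨f, g, hf, hg, h⟩ := ih
    obtain ⟨g', k, hg', hk, h'⟩ := ih'
    -- The two premises interpret the middle term separately; coherence identifies the results so
    -- that the triangle inequality applies.
    obtain rfl := hg.eq hg'
    exact ⟨f, k, hf, hk, (mul_le_mul' h h').trans (VCategory.dist_mul_dist_le _ _ _ _)⟩
  | weak _ _ hr ih =>
    obtain ⟨f, g, hf, hg, h⟩ := ih
    exact ⟨f, g, hf, hg, hr.trans h⟩
  | @arch Γ v w A q hv hw hq _ ih =>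
    obtain ⟨f, hf⟩ := hv.exists_sem M.toInterpretation
    obtain ⟨g, hg⟩ := hw.exists_sem M.toInterpretation
    -- The label is the least upper bound of the basis elements way below it, and these are
    -- precisely the labels of the premises.
    refine ⟨f, g, hf, hg, (hB.basis q).2.2.2 fun r hr => ?_⟩
    obtain ⟨f', g', hf', hg', h⟩ := ih r hr.1 hr.2
    obtain rfl := hf.eq hf'
    obtain rfl := hg.eq hg'
    exact h
  | join hv hw _ ih =>
    obtain ⟨f, hf⟩ := hv.exists_sem M.toInterpretation
    obtain ⟨g, hg⟩ := hw.exists_sem M.toInterpretation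
    refine ⟨f, g, hf, hg, iSup_le fun i => ?_⟩
    obtain ⟨f', g', hf', hg', h⟩ := ih i
    obtain rfl := hf.eq hf'
    obtain rfl := hg.eq hg'
    exact h
  | op f _ s hE ih =>
    choose k k' hk hk' h using ih
    exact ⟨_, _, Sem.op f hk s hE, Sem.op f hk' s hE,
      le_dist_comp_left _ (le_dist_comp_right _ (prod_le_dist_famTensorMap _ h))⟩
  | ten _ _ s hE ih ih' =>
    obtain ⟨f, g, hf, hg, h⟩ := ih
    obtain ⟨f', g', hf', hg', h'⟩ := ih'
    exact ⟨_, _, .ten hf hf' s hE, .ten hg hg' s hE, le_dist_tenHom _ h h'⟩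
  | pm _ _ s hE ih ih' =>
    obtain ⟨f, g, hf, hg, h⟩ := ih
    obtain ⟨f', g', hf', hg', h'⟩ := ih'
    exact ⟨_, _, .pm hf hf' s hE, .pm hg hg' s hE, le_dist_comp_left _
      (le_dist_comp (le_dist_whiskerRight _ h) (le_dist_comp_left _ (le_dist_comp_left _
        (le_dist_comp_left _ h'))))⟩
  | toStar _ _ s hE ih ih' =>
    obtain ⟨f, g, hf, hg, h⟩ := ih
    obtain ⟨f', g', hf', hg', h'⟩ := ih'
    exact ⟨_, _, .toStar hf hf' s hE, .toStar hg hg' s hE, le_dist_comp_left _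
      (le_dist_comp (le_dist_whiskerRight _ h) (le_dist_comp_left _ h'))⟩
  | lam _ ih =>
    obtain ⟨f, g, hf, hg, h⟩ := ih
    exact ⟨_, _, .lam hf, .lam hg, le_dist_curryHom (le_dist_comp_left _ h)⟩
  | app _ _ s hE ih ih' =>
    obtain ⟨f, g, hf, hg, h⟩ := ih
    obtain ⟨f', g', hf', hg', h'⟩ := ih'
    exact ⟨_, _, .app hf hf' s hE, .app hg hg' s hE, le_dist_comp_left _
      (le_dist_comp_right _ (le_dist_tensorHom h h'))⟩
  | perm _ p ih =>
    obtain ⟨f, g, hf, hg, h⟩ := ih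
    obtain ⟨m, hm⟩ := Sem.perm (M := M.toInterpretation) p
    exact ⟨_, _, hm hf, hm hg, le_dist_comp_left _ h⟩
  | @subst Γ Δ x v v' w w' A D q r _ _ hE ih ih' =>
    obtain ⟨f, g, hf, hg, h⟩ := ih
    obtain ⟨f', g', hf', hg', h'⟩ := ih'
    obtain ⟨s⟩ := Shuffle.append Δ Γ
    refine ⟨_, _, hf.replace hf' s.symm hE, hg.replace hg' s.symm hE, ?_⟩
    -- In the composite the substituted term comes first, so its label has to be the first factor.
    rw [mul_comm]
    exact le_dist_comp (le_dist_tenHom_right _ _ h') h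

end

end VLambda

/-! ### The induced functor and the interpretation of the structural terms -/

namespace VLambda

set_option linter.unusedSectionVars false

section

variable {C : Type u₄} [Category.{v₄} C] [MonoidalCategory C] [SymmetricCategory C]

theorem tenHom_snocVar {X X' Y Z W : C} (f : X ⟶ Z) (g : Y ⟶ W) (l : X' ⟶ X) :
    tenHom (X' ◁ (λ_ Y).inv) (l ≫ f) ((λ_ Y).hom ≫ g) = l ▷ Y ≫ (f ⊗ₘ g) := by
  rw [tenHom, ← id_tensorHom, tensorHom_comp_tensorHom, Iso.inv_hom_id_assoc, Category.id_comp,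
    ← tensorHom_id, tensorHom_comp_tensorHom, Category.id_comp]

theorem tenHom_snocVar_symm {X Y : C} :
    tenHom ((𝟙_ C ⊗ X) ◁ (λ_ Y).inv ≫ (β_ _ _).hom) (λ_ Y).hom (λ_ X).hom =
      (λ_ X).hom ▷ Y ≫ (β_ X Y).hom := by
  rw [tenHom, Category.assoc, ← BraidedCategory.braiding_naturality, ← id_tensorHom,
    tensorHom_comp_tensorHom_assoc, Iso.inv_hom_id, Category.id_comp, tensorHom_id]

theorem pmHom_rightUnitor_inv {A B Z : C} (g : (𝟙_ C ⊗ A) ⊗ B ⟶ Z) :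
    pmHom (ρ_ (𝟙_ C ⊗ (A ⊗ B))).inv (λ_ _).hom g =
      (λ_ (A ⊗ B)).hom ≫ (λ_ A).inv ▷ B ≫ g := by
  rw [pmHom, ← rightUnitor_inv_naturality_assoc, braiding_tensorUnit_right]
  simp

theorem toStarHom_snocVar {Y : C} :
    toStarHom ((𝟙_ C ⊗ 𝟙_ C) ◁ (λ_ Y).inv) (λ_ (𝟙_ C)).hom (λ_ Y).hom =
      (λ_ (𝟙_ C)).hom ▷ Y ≫ (λ_ Y).hom := by
  rw [toStarHom, whisker_exchange_assoc, leftUnitor_naturality_assoc, Iso.inv_hom_id,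
    Category.comp_id]

theorem toStarHom_snocVar_symm {Y : C} :
    toStarHom ((𝟙_ C ⊗ Y) ◁ (λ_ (𝟙_ C)).inv ≫ (β_ _ _).hom) (λ_ (𝟙_ C)).hom (λ_ Y).hom =
      (λ_ Y).hom ▷ 𝟙_ C ≫ (ρ_ Y).hom := by
  rw [toStarHom, Category.assoc, ← BraidedCategory.braiding_naturality_right_assoc,
    ← whiskerLeft_comp_assoc, Iso.inv_hom_id, whiskerLeft_id, Category.id_comp,
    braiding_tensorUnit_right]
  simp

/-- Pattern matching moves the matched pair behind the remaining variable, and building the result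
moves that variable back past `X ⊗ Y`. The two braidings are inverse by symmetry, and the associator
remains. -/
theorem associator_pmHom (X Y Z : C) :
    pmHom ((𝟙_ C ⊗ (X ⊗ Y)) ◁ (λ_ Z).inv) (λ_ (X ⊗ Y)).hom
      (tenHom (((𝟙_ C ⊗ Z) ◁ (λ_ X).inv ≫ (β_ (𝟙_ C ⊗ Z) (𝟙_ C ⊗ X)).hom) ▷ Y ≫ (α_ _ _ _).hom)
        (λ_ X).hom ((λ_ Z).hom ▷ Y ≫ (β_ Z Y).hom)) =
      (λ_ (X ⊗ Y)).hom ▷ Z ≫ (α_ X Y Z).hom := by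
  have e : tenHom (((𝟙_ C ⊗ Z) ◁ (λ_ X).inv ≫ (β_ (𝟙_ C ⊗ Z) (𝟙_ C ⊗ X)).hom) ▷ Y ≫
      (α_ _ _ _).hom) (λ_ X).hom ((λ_ Z).hom ▷ Y ≫ (β_ Z Y).hom) =
      (λ_ Z).hom ▷ X ▷ Y ≫ (α_ Z X Y).hom ≫ (β_ Z (X ⊗ Y)).hom ≫ (α_ X Y Z).hom := by
    have e₀ := tenHom_snocVar_symm (X := Z) (Y := X)
    rw [tenHom] at e₀
    rw [tenHom, ← Category.comp_id (λ_ X).hom, ← tensorHom_comp_tensorHom,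
      ← tensorHom_id (λ_ Z).hom, Category.assoc, ← associator_naturality_assoc, tensorHom_id,
      ← comp_whiskerRight_assoc, e₀, id_tensorHom, BraidedCategory.braiding_tensor_right_hom]
    simp
  rw [e, pmHom, ← associator_inv_naturality_left_assoc, Iso.inv_hom_id_assoc,
    ← BraidedCategory.braiding_naturality_right_assoc, SymmetricCategory.symmetry_assoc,
    whisker_exchange_assoc, ← whiskerLeft_comp_assoc, Iso.inv_hom_id]
  simp

end

section

variable {G : Type u₁} {S : Signature.{u₁, u₂} G}
variable {C : Type u₄} [Category.{v₄} C] [MonoidalCategory C] [SymmetricCategory C]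
  [MonoidalClosed C]

/-- The interpretation of a term with one free variable. -/
noncomputable def Val.hom (M : Interpretation S C) {A A' : Ty G} (v : Val S A A') :
    A.interp M.ground ⟶ A'.interp M.ground := v.2.some.interp M

variable {M : Interpretation S C}

theorem Val.sem {A A' : Ty G} (v : Val S A A') :
    Sem M [(0, A)] v.1 A' ((λ_ (A.interp M.ground)).hom ≫ v.hom M) := by
  refine (v.2.some.sem M).of_eq ?_
  have key : ∀ {X Y : C} (f : X ⟶ Y), (𝟙 (𝟙_ C) ▷ X ≫ (λ_ X).hom) ≫ f = (λ_ X).hom ≫ f := by simp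
  exact key _

/-- The way in which all interpretations below are computed: by coherence any instance of `Sem` will
do, whichever derivation was chosen. The unitor is the comparison for a one-variable context, whose
tensor product starts with the unit object. -/
theorem Val.hom_eq {A A' : Ty G} {v : Val S A A'} {f : A.interp M.ground ⟶ A'.interp M.ground}
    (h : Sem M [(0, A)] v.1 A' ((λ_ (A.interp M.ground)).hom ≫ f)) : v.hom M = f :=
  (cancel_epi (λ_ (A.interp M.ground)).hom).1 (v.sem.eq h)

theorem Val.hom_eq_interp {A A' : Ty G} (v : Val S A A') (d : Der [(0, A)] v.1 A') :
    v.hom M = d.interp M := by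
  refine Val.hom_eq ((d.sem M).of_eq ?_)
  have key : ∀ {X Y : C} (f : X ⟶ Y), (𝟙 (𝟙_ C) ▷ X ≫ (λ_ X).hom) ≫ f = (λ_ X).hom ≫ f := by simp
  exact key _

theorem Val.id_hom (A : Ty G) : (Val.id S A).hom M = 𝟙 _ :=
  Val.hom_eq ((Sem.var 0 A).of_eq (Category.comp_id _).symm)

theorem Sem.replace_singleton {Δ : Ctx G} {x : ℕ} {v w : Tm S} {A B : Ty G}
    {f : A.interp M.ground ⟶ B.interp M.ground} {g : Δ.ten M.ground ⟶ A.interp M.ground}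
    (hv : Sem M [(x, A)] v B ((λ_ (A.interp M.ground)).hom ≫ f)) (hw : Sem M Δ w A g) :
    Sem M Δ (v.replace x w) B (g ≫ f) := by
  refine (hv.replace hw (Shuffle.nilLeft Δ) hw.distinct).of_eq ?_
  rw [Shuffle.ten_nilLeft]
  have key : ∀ {X Y Z : C} (g : X ⟶ Y) (f : Y ⟶ Z),
      tenHom (λ_ X).inv (𝟙 _) g ≫ (λ_ Y).hom ≫ f = g ≫ f := by
    intro X Y Z g f
    rw [tenHom_id_left]
    simp
  exact key _ _

theorem Val.comp_hom {A A' A'' : Ty G} (v : Val S A A') (w : Val S A' A'') :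
    (v.comp w).hom M = v.hom M ≫ w.hom M :=
  Val.hom_eq ((w.sem.replace_singleton v.sem).of_eq (Category.assoc _ _ _))

/-- The interpretation of a term that starts with a pattern match of its free variable. -/
theorem Val.hom_eq_of_pm {A B D : Ty G} {v : Val S (.tensor A B) D} {w : Tm S}
    {f : A.interp M.ground ⊗ B.interp M.ground ⟶ D.interp M.ground} (hv : v.1 = .pm (.var 0) w)
    (h : Sem M [(0, B), (1, A)] w D ((λ_ (A.interp M.ground)).hom ▷ B.interp M.ground ≫ f)) :
    v.hom M = f := by
  refine Val.hom_eq (hv ▸ (Sem.pm (Δ := []) (Sem.var 0 (.tensor A B)) h (Shuffle.nilRight _)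
    (by simp [Ctx.Distinct])).of_eq ?_)
  rw [Shuffle.ten_nilRight]
  have key : ∀ {X Y Z : C} (c : (𝟙_ C ⊗ X) ⊗ Y ⟶ (𝟙_ C ⊗ X) ⊗ Y) (f : X ⊗ Y ⟶ Z), c = 𝟙 _ →
      pmHom (ρ_ (𝟙_ C ⊗ (X ⊗ Y))).inv (λ_ _).hom (c ≫ (λ_ X).hom ▷ Y ≫ f) = (λ_ _).hom ≫ f := by
    rintro X Y Z _ f rfl
    rw [Category.id_comp, pmHom_rightUnitor_inv]
    simp
  exact key _ _ rfl

theorem Val.tensor_hom {A A' D D' : Ty G} (v : Val S A A') (w : Val S D D') :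
    (v.tensor w).hom M = v.hom M ⊗ₘ w.hom M := by
  refine Val.hom_eq_of_pm rfl ((Sem.ten (v.sem.replace_singleton (Sem.var 1 A)) w.sem
    (Shuffle.snocVar (0, D) [(1, A)]) (by simp [Ctx.Distinct])).of_eq ?_)
  rw [Shuffle.ten_snocVar]
  exact tenHom_snocVar _ _ _

theorem Val.leftHom_hom (A : Ty G) : (Val.leftHom S A).hom M = (λ_ (A.interp M.ground)).hom := by
  refine Val.hom_eq_of_pm rfl ((Sem.toStar (Sem.var 1 .unit) (Sem.var 0 A)
    (Shuffle.snocVar (0, A) [(1, .unit)]) (by simp [Ctx.Distinct])).of_eq ?_)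
  rw [Shuffle.ten_snocVar]
  exact toStarHom_snocVar

theorem Val.rightHom_hom (A : Ty G) :
    (Val.rightHom S A).hom M = (ρ_ (A.interp M.ground)).hom := by
  refine Val.hom_eq_of_pm rfl ((Sem.toStar (Sem.var 0 .unit) (Sem.var 1 A)
    (Shuffle.snocVar (0, .unit) [(1, A)]).symm (by simp [Ctx.Distinct])).of_eq ?_)
  rw [Shuffle.ten_symm, Shuffle.ten_snocVar]
  exact toStarHom_snocVar_symm

theorem Val.braid_hom (A A' : Ty G) :
    (Val.braid S A A').hom M = (β_ (A.interp M.ground) (A'.interp M.ground)).hom := by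
  refine Val.hom_eq_of_pm rfl ((Sem.ten (Sem.var 0 A') (Sem.var 1 A)
    (Shuffle.snocVar (0, A') [(1, A)]).symm (by simp [Ctx.Distinct])).of_eq ?_)
  rw [Shuffle.ten_symm, Shuffle.ten_snocVar]
  exact tenHom_snocVar_symm

theorem Val.app_hom (A A' : Ty G) :
    (Val.app S A A').hom M = appHom (A.interp M.ground) (A'.interp M.ground) := by
  refine Val.hom_eq_of_pm rfl ((Sem.app (Sem.var 1 (.lolli A A')) (Sem.var 0 A)
    (Shuffle.snocVar (0, A) [(1, .lolli A A')]) (by simp [Ctx.Distinct])).of_eq ?_)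
  rw [Shuffle.ten_snocVar]
  have key : ∀ X Y : C, appliedHom ((𝟙_ C ⊗ (ihom X).obj Y) ◁ (λ_ X).inv) (λ_ _).hom (λ_ X).hom =
      (λ_ ((ihom X).obj Y)).hom ▷ X ≫ appHom X Y := by
    intro X Y
    rw [appliedHom, ← id_tensorHom, tensorHom_comp_tensorHom_assoc, Category.id_comp,
      Iso.inv_hom_id, tensorHom_id]
  exact key _ _

theorem Val.curry_hom {A A' D : Ty G} (v : Val S (.tensor A A') D) :
    v.curry.hom M = curryHom (Y := A'.interp M.ground) (v.hom M) := by
  refine Val.hom_eq ((Sem.lam (Γ := [(0, A)]) (v.sem.replace_singleton (Sem.ten (Sem.var 1 A)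
    (Sem.var 0 A') (Shuffle.snocVar (0, A') [(1, A)]) (by simp [Ctx.Distinct])))).of_eq ?_)
  rw [Shuffle.ten_snocVar]
  have key : ∀ {X Y Z : C} (c : (𝟙_ C ⊗ X) ⊗ Y ⟶ (𝟙_ C ⊗ X) ⊗ Y) (f : X ⊗ Y ⟶ Z), c = 𝟙 _ →
      curryHom (c ≫ tenHom ((𝟙_ C ⊗ X) ◁ (λ_ Y).inv) (λ_ X).hom (λ_ Y).hom ≫ f) =
        (λ_ X).hom ≫ curryHom f := by
    rintro X Y Z _ f rfl
    rw [tenHom, ← id_tensorHom, tensorHom_comp_tensorHom, Category.id_comp,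
      Iso.inv_hom_id, tensorHom_id, Category.id_comp, curryHom_comp_left]
  exact key _ _ rfl

theorem Val.assocHom_hom (A₁ A₂ A₃ : Ty G) : (Val.assocHom S A₁ A₂ A₃).hom M =
    (α_ (A₁.interp M.ground) (A₂.interp M.ground) (A₃.interp M.ground)).hom := by
  have h₁ : Sem M [(0, A₂), (2, A₃)] (.ten (.var 0) (.var 2)) (.tensor A₂ A₃) _ :=
    (Sem.ten (Sem.var 0 A₂) (Sem.var 2 A₃) (Shuffle.snocVar (0, A₂) [(2, A₃)]).symm
      (by simp [Ctx.Distinct])).of_eq (by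
        rw [Shuffle.ten_symm, Shuffle.ten_snocVar]
        exact tenHom_snocVar_symm)
  refine Val.hom_eq_of_pm rfl ((Sem.pm (Δ := [(0, A₃)]) (Sem.var 1 (.tensor A₁ A₂))
    (Sem.ten (Sem.var 1 A₁) h₁ (.right (0, A₂) (Shuffle.snocVar (1, A₁) [(2, A₃)]).symm)
      (by simp [Ctx.Distinct])) (Shuffle.snocVar (0, A₃) [(1, .tensor A₁ A₂)])
    (by simp [Ctx.Distinct])).of_eq ?_)
  rw [Shuffle.ten_snocVar]
  change pmHom _ _ (𝟙 _ ≫ tenHom ((Shuffle.snocVar (1, A₁) [(2, A₃)]).symm.ten M.ground ▷ _ ≫ _)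
    _ _) = _
  rw [Shuffle.ten_symm, Shuffle.ten_snocVar, Category.id_comp]
  exact associator_pmHom _ _ _

end

section

variable {V : Type u₃} [CommMonoid V] [CompleteLattice V] [IsQuantale V] {B : Set V}
variable {G : Type u₁} {S : Signature.{u₁, u₂} G} {T : VTheory S B}
variable {C : Type u₄} [Category.{v₄} C] [MonoidalCategory C] [SymmetricCategory C]
  [MonoidalClosed C] [VCatSepCategory V C] [VCatSepAutonomous V C]

/-- Soundness bounds each provable label. The unitor in front of the interpretations is removed by
composing with its inverse, which does not decrease distances. -/
theorem VTheory.dist_le_dist_hom (hV : (1 : V) = ⊤) (hB : IsQuantaleBasis B) (M : T.Model C)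
    {A A' : Ty G} (v w : Val S A A') : (T.val A A').dist v w ≤
      (VCatSepCategory.hom _ _).dist (v.hom M.toInterpretation) (w.hom M.toInterpretation) := by
  refine sSup_le fun q hq => ?_
  obtain ⟨f, g, hf, hg, h⟩ := VTheory.Thm.sem hV hB M hq
  have key : ∀ {X X' Y : C} (l : X ≅ X') (v w : X' ⟶ Y), q ≤ (VCatSepCategory.hom X Y).dist
      (l.hom ≫ v) (l.hom ≫ w) → q ≤ (VCatSepCategory.hom X' Y).dist v w := by
    intro X X' Y l v w h
    simpa using le_dist_comp_left l.inv h
  obtain rfl := hf.eq v.sem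
  obtain rfl := hg.eq w.sem
  exact key (λ_ _) _ _ h

/-- The functor from the syntactic category that is induced by a model. -/
noncomputable def Syn.functor (hV : (1 : V) = ⊤) (hB : IsQuantaleBasis B) (M : T.Model C) : Syn T ⥤ C where
  obj A := Ty.interp M.toInterpretation.ground A
  map := Quotient.lift (fun v => Val.hom M.toInterpretation v) fun v w h =>
    -- Identified terms have interpretations at distance at least the unit in both directions, and
    -- separatedness of the target makes these equal.
    VCatSepCategory.isSeparated (V := V) _ _ _ _
      (h.1.trans (VTheory.dist_le_dist_hom hV hB M v w))
      (h.2.trans (VTheory.dist_le_dist_hom hV hB M w v))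
  map_id A := Val.id_hom A
  map_comp := by rintro _ _ _ ⟨v⟩ ⟨w⟩; exact v.comp_hom w

theorem Syn.functor_isVCatFunctor (hV : (1 : V) = ⊤) (hB : IsQuantaleBasis B) (M : T.Model C) :
    IsVCatFunctor V (Syn.functor hV hB M) := by
  rintro A A' ⟨v⟩ ⟨w⟩
  exact VTheory.dist_le_dist_hom hV hB M v w

theorem Syn.functor_strictlyPreservesAutonomous (hV : (1 : V) = ⊤) (hB : IsQuantaleBasis B)
    (M : T.Model C) (h : (Syn.autonomousData T).IsAutonomous) :
    letI := h.monoidalCategory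
    letI := h.symmetricCategory
    letI := h.monoidalClosed
    StrictlyPreservesAutonomous (Syn.functor hV hB M) := by
  let := h.monoidalCategory
  let := h.symmetricCategory
  let := h.monoidalClosed
  have happ : ∀ X Y : Syn T, (Syn.functor hV hB M).map (appHom X Y) =
      appHom ((Syn.functor hV hB M).obj X) ((Syn.functor hV hB M).obj Y) := by
    intro X Y
    rw [h.appHom_eq]
    exact Val.app_hom X Y
  have hcurry : ∀ {X Y Z : Syn T} (f : X ⊗ Y ⟶ Z), (Syn.functor hV hB M).map (curryHom f) =
      curryHom (Y := (Syn.functor hV hB M).obj Y) ((Syn.functor hV hB M).map f) := by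
    rintro X Y Z ⟨v⟩
    refine (congrArg _ (h.curryHom_eq (X := X) (Y := Y) (Z := Z) _)).trans ?_
    exact Val.curry_hom v
  exact
    { unit := rfl
      tensorObj := fun _ _ => rfl
      lolli := fun _ _ => rfl
      tensorHom := by rintro _ _ _ _ ⟨v⟩ ⟨w⟩; exact heq_of_eq (v.tensor_hom w)
      associator := fun X Y Z => heq_of_eq (Val.assocHom_hom X Y Z)
      leftUnitor := fun X => heq_of_eq (Val.leftHom_hom X)
      rightUnitor := fun X => heq_of_eq (Val.rightHom_hom X)
      braiding := fun X Y => heq_of_eq (Val.braid_hom X Y)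
      app := fun X Y => heq_of_eq (happ X Y)
      curry := by
        intro X Y Z f g hg
        obtain rfl := eq_of_heq hg
        exact heq_of_eq (hcurry f)
      lolliMap := by
        intro X Y Y' f
        -- No term for `X ⊸ f` has to be interpreted, since it is determined by application and
        -- transposition.
        rw [ihom_map_eq_curryHom, ihom_map_eq_curryHom]
        refine heq_of_eq ((hcurry _).trans (congrArg _ ?_))
        exact (Functor.map_comp _ _ _).trans (congrArg (· ≫ _) (happ X Y)) }

end

end VLambda

theorem mainTheorem4 {V : Type u₃} [CommMonoid V] [CompleteLattice V] [IsQuantale V]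
    (hV : (1 : V) = ⊤) {B : Set V} (hB : VLambda.IsQuantaleBasis B)
    {G : Type u₁} {S : VLambda.Signature.{u₁, u₂} G} (T : VLambda.VTheory S B)
    {C : Type u₄} [Category.{v₄} C] [MonoidalCategory C] [SymmetricCategory C]
    [MonoidalClosed C] [VLambda.VCatSepCategory V C] [VLambda.VCatSepAutonomous V C]
    (M : T.Model C) :
    ∃ h : (VLambda.Syn.autonomousData T).IsAutonomous,
      letI := h.monoidalCategory
      letI := h.symmetricCategory
      letI := h.monoidalClosed
      VLambda.VCatSepAutonomous V (VLambda.Syn T) ∧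
      ∃ F : VLambda.Syn T ⥤ C,
        (∀ A : VLambda.Ty G, F.obj (VLambda.Syn.of A) = A.interp M.toInterpretation.ground) ∧
        (∀ (A A' : VLambda.Ty G) (v : VLambda.Val S A A') (d : VLambda.Der [(0, A)] v.1 A'),
          F.map (VLambda.Syn.mk v) ≍ d.interp M.toInterpretation) ∧
        VLambda.IsVCatFunctor V F ∧
        VLambda.StrictlyPreservesAutonomous F := by
  have h := VLambda.Syn.isAutonomous T
  exact ⟨h, VLambda.Syn.vCatSepAutonomous T h, VLambda.Syn.functor hV hB M, fun _ => rfl,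
    fun _ _ v d => heq_of_eq (v.hom_eq_interp d),
    VLambda.Syn.functor_isVCatFunctor hV hB M,
    VLambda.Syn.functor_strictlyPreservesAutonomous hV hB M h⟩
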